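/- **Functional equations for multirooted hypermaps.** A hypermap is a triple $(D,R,L)$ where $D$ is a finite set of darts and $R,L$ are permutations of $D$ generating a transitive group; its vertices, hyperedges and faces are the cycles of $R$, of $L$ and of $RL$ ($L$ followed by $R$), the degree of a vertex is the number of its darts, and the genus $g$ of a hypermap with $t$ darts, $v$ vertices, $e$ hyperedges and $f$ faces is given by $v+e+f=t+2(1-g)$. For $\rho\ge1$ a $\rho$-rooted hypermap is a hypermap with a distinguished sequence of $\rho$ darts with pairwise distinct initial vertices (the initial vertex of a dart is the cycle of $R$ containing it); these are counted up to isomorphism. By convention there is also one empty hypermap, with $t=e=g=0$, $v=f=1$, whose vertex has degree $0$; it counts as a $1$-rooted hypermap and as a $\rho$-rooted hypermap for no $\rho\ge2$. Let $H_m(g,t,f,e,[d_1,\dots,d_\rho])$ be the number of $\rho$-rooted hypermaps of genus $g$ with $t$ darts, $f$ faces and $e$ hyperedges such that the initial vertex of the $i$-th distinguished dart has degree $d_i$ for every $i$, and for $g\ge 0$ let $$H_g(v_1,\dots,v_\rho,x,y,u,z)=\sum_{t\ge0,\ f\ge1,\ e\ge0,\ d_1,\dots,d_\rho\ge0} H_m(g,t,f,e,[d_1,\dots,d_\rho])\,v_1^{d_1}\cdots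 v_\rho^{d_\rho}\,x^f y^e u^{v} z^t,\qquad v=t+2(1-g)-e-f,$$ a formal power series in $z$ with coefficients in $\mathbb{Q}[v_1,\dots,v_\rho,x,y,u]$; put $H_g=0$ for $g<0$. Then for all $g\ge0$ and $\rho\ge1$, with $W=v_2,\dots,v_\rho$, $$\begin{aligned} H_g(v_1,W,x,y,u,z)={}&\frac{v_1z}{u}\sum_{j=0}^{g}\sum_{X\subseteq W}H_j(v_1,X,y,x,u,z)\,H_{g-j}(v_1,W-X,x,y,u,z)\\ &+\frac{v_1z}{u}\,H_{g-1}(v_1,v_1,W,y,x,u,z)\\ &+\frac{v_1uz}{v_1-1}\bigl(H_g(v_1,W,y,x,u,z)-H_g(1,W,y,x,u,z)\bigr)\\ &+v_1uz\sum_{j=2}^{\rho}v_j\frac{\partial}{\partial v_j}\left(v_j\,\frac{H_g(v_j,W-\{v_j\},y,x,u,z)-H_g(v_1,W-\{v_j\},y,x,u,z)}{v_j-v_1}\right)\\ &+xu\,\delta_{g=0}\,\delta_{\rho=1}, \end{aligned}$$ where all the divisions are exact in $\mathbb{Q}[v_1,\dots,v_\rho,x,y,u][[z]]$. Moreover these equations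 define the series: any family of power series $F_{g,\rho}\in\mathbb{Q}[v_1,\dots,v_\rho,x,y,u][[z]]$ ($g\ge0$, $\rho\ge1$) that satisfies all of them (with exact divisions) is equal to the family of the $H_g(v_1,\dots,v_\rho,x,y,u,z)$. -/

import Mathlib

/-! ### Multirooted hypermaps -/

/-- A non-empty hypermap on the set of darts `D` (a pair of permutations `R`, `L` generating a
transitive group), with a sequence of `ρ` distinguished darts whose initial vertices
(cycles of `R`) are pairwise distinct. -/
structure MultirootedHypermap (D : Type) (ρ : ℕ) where
  R : Equiv.Perm D
  L : Equiv.Perm D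
  nonempty : Nonempty D
  transitive : MulAction.IsPretransitive (Subgroup.closure {R, L}) D
  root : Fin ρ → D
  distinct_vertices : ∀ i j, i ≠ j → ¬ R.SameCycle (root i) (root j)

/-- The number of cycles of a permutation, fixed points included. -/
noncomputable def cycleCount {D : Type} (p : Equiv.Perm D) : ℕ :=
  Nat.card (Quotient (Equiv.Perm.SameCycle.setoid p))

namespace MultirootedHypermap

variable {D D' D'' : Type} {ρ : ℕ}

noncomputable def numVertices (M : MultirootedHypermap D ρ) : ℕ := cycleCount M.R

noncomputable def numHyperedges (M : MultirootedHypermap D ρ) : ℕ := cycleCount M.L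

/-- Faces are the cycles of `L` followed by `R`. -/
noncomputable def numFaces (M : MultirootedHypermap D ρ) : ℕ := cycleCount (M.R * M.L)

/-- The degree of the initial vertex of the `i`-th distinguished dart. -/
noncomputable def rootDegree (M : MultirootedHypermap D ρ) (i : Fin ρ) : ℕ :=
  Nat.card {a : D // M.R.SameCycle (M.root i) a}

/-- The genus formula `v + e + f = t + 2 (1 - g)`, where `t` is the number of darts. -/
def HasGenus (M : MultirootedHypermap D ρ) (g : ℕ) : Prop :=
  (M.numVertices : ℤ) + M.numHyperedges + M.numFaces = Nat.card D + 2 * (1 - (g : ℤ))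

/-- Isomorphism: a bijection between the darts that carries the two permutations and the sequence
of distinguished darts of `M` to those of `M'`. -/
def Isomorphic (M : MultirootedHypermap D ρ) (M' : MultirootedHypermap D' ρ) : Prop :=
  ∃ φ : D ≃ D', (∀ a, φ (M.R a) = M'.R (φ a)) ∧ (∀ a, φ (M.L a) = M'.L (φ a)) ∧
    ∀ i, φ (M.root i) = M'.root i

theorem Isomorphic.refl (M : MultirootedHypermap D ρ) : M.Isomorphic M :=
  ⟨Equiv.refl D, fun _ => rfl, fun _ => rfl, fun _ => rfl⟩

theorem Isomorphic.symm {M : MultirootedHypermap D ρ} {M' : MultirootedHypermap D' ρ}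
    (h : M.Isomorphic M') : M'.Isomorphic M := by
  obtain ⟨φ, hR, hL, hr⟩ := h
  refine ⟨φ.symm, fun a => ?_, fun a => ?_, fun i => ?_⟩
  · rw [Equiv.symm_apply_eq, hR, Equiv.apply_symm_apply]
  · rw [Equiv.symm_apply_eq, hL, Equiv.apply_symm_apply]
  · rw [Equiv.symm_apply_eq, hr]

theorem Isomorphic.trans {M : MultirootedHypermap D ρ} {M' : MultirootedHypermap D' ρ}
    {M'' : MultirootedHypermap D'' ρ} (h : M.Isomorphic M') (h' : M'.Isomorphic M'') :
    M.Isomorphic M'' := by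
  obtain ⟨φ, hR, hL, hr⟩ := h
  obtain ⟨ψ, hR', hL', hr'⟩ := h'
  refine ⟨φ.trans ψ, fun a => ?_, fun a => ?_, fun i => ?_⟩
  · simp [hR, hR']
  · simp [hL, hL']
  · simp [hr, hr']

/-- Every isomorphism class of non-empty multirooted hypermaps with `t` darts has a representative
on the darts `Fin t`. -/
def isoSetoid (t ρ : ℕ) : Setoid (MultirootedHypermap (Fin t) ρ) where
  r M M' := M.Isomorphic M'
  iseqv := ⟨Isomorphic.refl, Isomorphic.symm, Isomorphic.trans⟩

end MultirootedHypermap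

/-- `numMultirooted g t f e d` is the number of `ρ`-rooted hypermaps (up to isomorphism) of genus
`g` with `t` darts, `f` faces and `e` hyperedges whose `i`-th distinguished dart has an initial
vertex of degree `d i`. The case `t = 0` is the empty hypermap, which by convention has genus 0,
one face, no hyperedge, and a single vertex, of degree 0; it counts as one 1-rooted hypermap. -/
noncomputable def numMultirooted {ρ : ℕ} (g t f e : ℕ) (d : Fin ρ → ℕ) : ℕ :=
  open Classical in
  if t = 0 then
    if g = 0 ∧ f = 1 ∧ e = 0 ∧ ρ = 1 ∧ (∀ i, d i = 0) then 1 else 0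
  else
    Set.ncard (Quotient.mk (MultirootedHypermap.isoSetoid t ρ) ''
      {M | M.HasGenus g ∧ M.numFaces = f ∧ M.numHyperedges = e ∧ ∀ i, M.rootDegree i = d i})

/-! ### Generating series -/

/-- The variables `v_1, …, v_ρ` (indexed from 0), `x`, `y`, `u`. -/
inductive HVar (ρ : ℕ) : Type
  | v (i : Fin ρ)
  | x
  | y
  | u

/-- Polynomials in `v_1, …, v_ρ, x, y, u`. -/
abbrev HPoly (ρ : ℕ) : Type := MvPolynomial (HVar ρ) ℚ

/-- Formal power series in `z` whose coefficients are polynomials in `v_1, …, v_ρ, x, y, u`. -/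
abbrev HSeries (ρ : ℕ) : Type := PowerSeries (HPoly ρ)

/-- The variable `v_{i+1}`. -/
noncomputable def vv {ρ : ℕ} (i : Fin ρ) : HPoly ρ := MvPolynomial.X (HVar.v i)

noncomputable def xx {ρ : ℕ} : HPoly ρ := MvPolynomial.X HVar.x

noncomputable def yy {ρ : ℕ} : HPoly ρ := MvPolynomial.X HVar.y

noncomputable def uu {ρ : ℕ} : HPoly ρ := MvPolynomial.X HVar.u

/-- The generating series `H_g(v_1, …, v_ρ, x, y, u, z)`, the sum of
`numMultirooted g t f e d * v_1 ^ d_1 ⋯ v_ρ ^ d_ρ * x ^ f * y ^ e * u ^ v * z ^ t` where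
`v = t + 2 (1 - g) - e - f`. For given `t` the numbers vanish outside the ranges of summation
(at most `t` faces if `t ≥ 1`, at most `t` hyperedges, degrees at most `t`), and also when
`t + 2 (1 - g) - e - f` is negative. -/
noncomputable def hypermapSeries (g ρ : ℕ) : HSeries ρ :=
  PowerSeries.mk fun t =>
    ∑ f ∈ Finset.Icc 1 (t + 1), ∑ e ∈ Finset.range (t + 1), ∑ d : Fin ρ → Fin (t + 1),
      (numMultirooted g t f e (fun i => (d i : ℕ)) : HPoly ρ) *
        ((∏ i, vv i ^ (d i : ℕ)) * xx ^ f * yy ^ e * uu ^ (t + 2 - 2 * g - e - f))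

/-- `F.evalAt a p q` is `F(a_1, …, a_m, p, q, u, z)`: the variables `v_i`, `x`, `y` are replaced
by the polynomials `a_i`, `p`, `q`. -/
noncomputable def HSeries.evalAt {m n : ℕ} (F : HSeries m) (a : Fin m → HPoly n)
    (p q : HPoly n) : HSeries n :=
  PowerSeries.map (MvPolynomial.aeval (R := ℚ) (fun s : HVar m =>
    match s with
    | HVar.v i => a i
    | HVar.x => p
    | HVar.y => q
    | HVar.u => uu) : HPoly m →ₐ[ℚ] HPoly n).toRingHom F

/-- The partial derivative with respect to `v_{j+1}`. -/
noncomputable def HSeries.deriv {n : ℕ} (j : Fin n) (F : HSeries n) : HSeries n :=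
  PowerSeries.mk fun t => MvPolynomial.pderiv (HVar.v j) (PowerSeries.coeff t F)

/-- The argument list `(a, X)` where `W = (v_2, …, v_ρ)`, `ρ = n + 1`, and `X` is the sublist of `W`
with the positions in `X` (position `i : Fin n` holds the variable `vv i.succ`). -/
noncomputable def headSublist {n : ℕ} (a : HPoly (n + 1)) (X : Finset (Fin n)) :
    Fin (X.card + 1) → HPoly (n + 1) :=
  Fin.cons a fun i => vv (X.orderEmbOfFin rfl i).succ

/-- The quotient `a / b` in an integral domain for `b ≠ 0` dividing `a`; used only together with the
assertion that `b` divides `a`. -/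
noncomputable def exactQuot {S : Type} [CommRing S] (a b : S) : S :=
  open Classical in if h : b ∣ a then h.choose else 0

/-! ### The functional equation -/

section Equation

variable (F : (g ρ : ℕ) → HSeries ρ) (g n : ℕ)

/-- `∑_{j=0}^g ∑_{X ⊆ W} F_j(v_1, X, y, x, u, z) F_{g-j}(v_1, W - X, x, y, u, z)`. -/
noncomputable def convolutionTerm : HSeries (n + 1) :=
  ∑ j ∈ Finset.range (g + 1), ∑ X : Finset (Fin n),
    (F j (X.card + 1)).evalAt (headSublist (vv 0) X) yy xx *
      (F (g - j) (Xᶜ.card + 1)).evalAt (headSublist (vv 0) Xᶜ) xx yy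

/-- `F_{g-1}(v_1, v_1, W, y, x, u, z)`, which is `0` for `g = 0`. -/
noncomputable def handleTerm : HSeries (n + 1) :=
  if g = 0 then 0 else (F (g - 1) (n + 2)).evalAt (Fin.cons (vv 0) vv) yy xx

/-- `F_g(v_1, W, y, x, u, z) - F_g(1, W, y, x, u, z)`. -/
noncomputable def differenceAtOne : HSeries (n + 1) :=
  (F g (n + 1)).evalAt vv yy xx -
    (F g (n + 1)).evalAt (Fin.cons 1 fun i : Fin n => vv i.succ) yy xx

/-- `F_g(v_j, W - {v_j}, y, x, u, z) - F_g(v_1, W - {v_j}, y, x, u, z)`, where `v_j = vv i.succ`. -/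
noncomputable def differenceAt (i : Fin n) : HSeries (n + 1) :=
  (F g (({i}ᶜ : Finset (Fin n)).card + 1)).evalAt (headSublist (vv i.succ) {i}ᶜ) yy xx -
    (F g (({i}ᶜ : Finset (Fin n)).card + 1)).evalAt (headSublist (vv 0) {i}ᶜ) yy xx

open PowerSeries in
/-- The functional equation for genus `g` and `ρ = n + 1` distinguished darts; all the divisions
that occur in it are exact. -/
def FunctionalEquation : Prop :=
  C uu ∣ convolutionTerm F g n ∧
  C uu ∣ handleTerm F g n ∧
  C (vv 0 - 1) ∣ differenceAtOne F g n ∧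
  (∀ i : Fin n, C (vv i.succ - vv 0) ∣ differenceAt F g n i) ∧
  F g (n + 1) =
    C (vv 0) * X * exactQuot (convolutionTerm F g n) (C uu) +
    C (vv 0) * X * exactQuot (handleTerm F g n) (C uu) +
    C (vv 0 * uu) * X * exactQuot (differenceAtOne F g n) (C (vv 0 - 1)) +
    C (vv 0 * uu) * X * ∑ i : Fin n, C (vv i.succ) *
      HSeries.deriv i.succ
        (C (vv i.succ) * exactQuot (differenceAt F g n i) (C (vv i.succ - vv 0))) +
    (if g = 0 ∧ n = 0 then C (xx * uu) else 0)

end Equation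

/-! The equation records the removal of the first distinguished dart, carried out on labelled
hypermaps. Write the dart set as `Option D` with the root dart at `none`. Every pair of permutations
of `Option D` arises exactly once from a pair `R`, `L` on `D` and two elements `b`, `c` of `Option
D` (`insert_bijective`). Here `b` decides where the new dart sits in its hyperedge and `c` where it
sits in its face; the value `none` means that the new dart forms a hyperedge or a face of its own.

If `b` or `c` is `none`, the genus does not change, and one gets the one-dart map or an old map
times `v * y` or `v * x`. If both are old darts in one vertex, that vertex, enlarged by the new
dart, is cut in two. If they are in different vertices, these are merged: either the rest is
connected, of genus `g - 1` and with one root more, or it has two components, among which genus and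
roots are distributed. That the genus of a connected pair is a natural number
(`Conn.exists_eulerGenus`) makes this case distinction complete.

Let `M` be the series of nonempty maps with one vertex left uncounted, so that `H = u * M` plus `x *
u` for the empty map. The case analysis gives `C_mul_mapSeries`. The stated equation is the same
identity: the empty maps in the two factors of the convolution supply the cases where `b` or `c` is
`none`, and geometric sums turn the cutting of a vertex into the two divided differences. The
exchange of `x` and `y` is harmless because `M` is symmetric in them (`mapSum_dual`). All quotients
appear explicitly as multiples of the divisors, hence the divisions are exact.

Labelled and unlabelled counts differ by the factor `t!`, since a rooted connected map has no
nontrivial automorphism (`relabel_injective`). Thus series in isomorphism classes are exponential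
series in labelled maps, and products correspond to splitting the dart set.

Uniqueness holds because every occurrence of the unknown series on the right carries a factor `z`,
so that the coefficients are determined degree by degree. -/

open Equiv Equiv.Perm

namespace Hypermap

/-! ### Cycles of permutations -/

section Cycles

variable {D : Type} {p : Perm D} {b c x y : D}

/-- The cycle relation is the smallest equivalence relation that links every `x` to `p x`. Both
directions of the description of cycles after a transposition rest on this. -/
theorem sameCycle_le {E : D → D → Prop} (hE : Equivalence E) (h : ∀ x, E x (p x))
    (hxy : p.SameCycle x y) : E x y := by
  obtain ⟨i, rfl⟩ := hxy
  induction i with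
  | zero => exact hE.refl _
  | succ i ih =>
    rw [add_comm, zpow_one_add, Perm.mul_apply]
    exact hE.trans ih (h _)
  | pred i ih =>
    refine hE.trans ih (hE.symm ?_)
    have := h ((p ^ (-(i : ℤ) - 1)) x)
    rwa [← Perm.mul_apply, ← zpow_one_add, add_sub_cancel] at this

theorem sameCycle_mem_iff {s : Set D} (h : ∀ x, p x ∈ s ↔ x ∈ s) (hxy : p.SameCycle x y) :
    x ∈ s ↔ y ∈ s :=
  sameCycle_le (E := fun x y => x ∈ s ↔ y ∈ s)
    ⟨fun _ => Iff.rfl, fun h => h.symm, fun h h' => h.trans h'⟩ (fun x => (h x).symm) hxy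

/-- The number of elements in the cycle of `x`. -/
noncomputable def cycleDegree (p : Perm D) (x : D) : ℕ := Nat.card {a : D // p.SameCycle x a}

theorem cycleDegree_eq_ncard (p : Perm D) (x : D) :
    cycleDegree p x = {a : D | p.SameCycle x a}.ncard := rfl

theorem cycleDegree_pos [Finite D] (p : Perm D) (x : D) : 0 < cycleDegree p x :=
  have : Nonempty {a : D // p.SameCycle x a} := ⟨⟨x, SameCycle.refl _ _⟩⟩
  Nat.card_pos

theorem SameCycle.cycleDegree_eq (h : p.SameCycle x y) : cycleDegree p x = cycleDegree p y := by
  rw [cycleDegree_eq_ncard, cycleDegree_eq_ncard]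
  congr 1
  ext a
  exact ⟨fun h' => h.symm.trans h', fun h' => h.trans h'⟩

theorem cycleDegree_eq_minimalPeriod [Finite D] (p : Perm D) (x : D) :
    cycleDegree p x = Function.minimalPeriod p x := by
  have hpos : 0 < Function.minimalPeriod p x := by
    refine Function.IsPeriodicPt.minimalPeriod_pos (orderOf_pos p) ?_
    rw [Function.IsPeriodicPt, Function.IsFixedPt, iterate_eq_pow, pow_orderOf_eq_one]
    rfl
  rw [cycleDegree, ← Nat.card_fin (Function.minimalPeriod p x)]
  symm
  refine Nat.card_eq_of_bijective
    (fun i : Fin (Function.minimalPeriod p x) =>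
      (⟨p^[i] x, ⟨(i : ℕ), by rw [zpow_natCast, iterate_eq_pow]⟩⟩ : {a : D // p.SameCycle x a}))
    ⟨fun i j hij => ?_, ?_⟩
  · exact Fin.ext (Function.iterate_injOn_Iio_minimalPeriod i.2 j.2 (congrArg Subtype.val hij))
  · rintro ⟨a, ha⟩
    obtain ⟨n, -, -, rfl⟩ := SameCycle.exists_pow_eq'' ha
    refine ⟨⟨n % Function.minimalPeriod p x, Nat.mod_lt _ hpos⟩, Subtype.ext ?_⟩
    show p^[n % Function.minimalPeriod p x] x = (p ^ n) x
    rw [Function.iterate_mod_minimalPeriod_eq, iterate_eq_pow]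

/-- Discarding the class of `c` from the finer quotient leaves exactly one representative for every
class of the coarser one; the class of `b` stands for the merged class. -/
theorem card_quotient_of_merge [Finite D] {r s : Setoid D} (hbc : ¬ r b c)
    (h : ∀ x y, s x y ↔ r x y ∨ ((r b x ∨ r c x) ∧ (r b y ∨ r c y))) :
    Nat.card (Quotient r) = Nat.card (Quotient s) + 1 := by
  classical
  let f : {q : Quotient r // q ≠ Quotient.mk r c} → Quotient s := fun q =>
    Quotient.map' (s₂ := s) id (fun x y hxy => (h x y).2 (Or.inl hxy)) q.1
  have hf : Function.Bijective f := by
    constructor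
    · rintro ⟨q, hq⟩ ⟨q', hq'⟩ hqq
      induction q using Quotient.inductionOn with | h x => ?_
      induction q' using Quotient.inductionOn with | h y => ?_
      have hx : ¬ r c x := fun hx => hq (Quotient.sound (r.symm hx))
      have hy : ¬ r c y := fun hx => hq' (Quotient.sound (r.symm hx))
      have hs : s x y := Quotient.exact hqq
      refine Subtype.ext (Quotient.sound ?_)
      rcases (h x y).1 hs with h1 | ⟨h1, h2⟩
      · exact h1
      · exact r.trans (r.symm (h1.resolve_right hx)) (h2.resolve_right hy)
    · intro q
      induction q using Quotient.inductionOn with | h x => ?_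
      by_cases hx : r c x
      · refine ⟨⟨Quotient.mk r b, fun e => hbc (Quotient.exact e)⟩, Quotient.sound ?_⟩
        exact (h b x).2 (Or.inr ⟨Or.inl (r.refl b), Or.inr hx⟩)
      · exact ⟨⟨Quotient.mk r x, fun e => hx (r.symm (Quotient.exact e))⟩, rfl⟩
  rw [← Nat.card_eq_of_bijective f hf, ← Nat.card_congr (optionSubtypeNe (Quotient.mk r c)),
    Finite.card_option]

theorem cycleCount_pos [Finite D] [Nonempty D] (p : Perm D) : 0 < cycleCount p :=
  have : Nonempty (Quotient (SameCycle.setoid p)) := ⟨Quotient.mk _ (Classical.arbitrary D)⟩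
  Nat.card_pos

theorem SameCycle.exists_pow_lt_cycleDegree [Finite D] (h : p.SameCycle x y) :
    ∃ j < cycleDegree p x, (p ^ j) x = y := by
  obtain ⟨n, -, -, rfl⟩ := h.exists_pow_eq''
  refine ⟨n % cycleDegree p x, Nat.mod_lt _ (cycleDegree_pos p x), ?_⟩
  rw [cycleDegree_eq_minimalPeriod, ← iterate_eq_pow, Function.iterate_mod_minimalPeriod_eq,
    iterate_eq_pow]

theorem pow_apply_inj_of_lt_cycleDegree [Finite D] {i j : ℕ} (hi : i < cycleDegree p x)
    (hj : j < cycleDegree p x) (h : (p ^ i) x = (p ^ j) x) : i = j := by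
  rw [cycleDegree_eq_minimalPeriod] at hi hj
  rw [← iterate_eq_pow, ← iterate_eq_pow] at h
  exact Function.iterate_injOn_Iio_minimalPeriod hi hj h

/-! ### Transport along bijections -/

theorem sameCycle_permCongr {D' : Type} (e : D ≃ D') (p : Perm D) {x y : D} :
    (e.permCongr p).SameCycle (e x) (e y) ↔ p.SameCycle x y := by
  have hz : ∀ i : ℤ, (e.permCongr p) ^ i = e.permCongr (p ^ i) := fun i =>
    (map_zpow e.permCongrHom p i).symm
  simp [SameCycle, hz]

theorem cycleCount_permCongr {D' : Type} (e : D ≃ D') (p : Perm D) :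
    cycleCount (e.permCongr p) = cycleCount p :=
  (Nat.card_congr (Quotient.congr e fun _ _ => (sameCycle_permCongr e p).symm)).symm

theorem cycleDegree_permCongr {D' : Type} (e : D ≃ D') (p : Perm D) (x : D) :
    cycleDegree (e.permCongr p) (e x) = cycleDegree p x :=
  (Nat.card_congr (e.subtypeEquiv fun _ => (sameCycle_permCongr e p).symm)).symm

theorem cycleCount_conj (p q : Perm D) : cycleCount (p * q * p⁻¹) = cycleCount q :=
  cycleCount_permCongr p q

theorem cycleCount_mul_comm (p q : Perm D) : cycleCount (p * q) = cycleCount (q * p) := by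
  rw [← cycleCount_conj q (p * q)]
  simp [mul_assoc]

theorem cycleCount_inv (p : Perm D) : cycleCount p⁻¹ = cycleCount p :=
  Nat.card_congr (Quotient.congr (Equiv.refl D) fun _ _ => sameCycle_inv)

/-! ### One more fixed point -/

/-- The permutation `p`, extended by the fixed point `none`. -/
def optPerm (p : Perm D) : Perm (Option D) := optionCongr p

@[simp] theorem optPerm_none : optPerm p none = none := rfl

@[simp] theorem optPerm_some : optPerm p (some x) = some (p x) := rfl

theorem optPerm_mul (p q : Perm D) : optPerm (p * q) = optPerm p * optPerm q := by
  ext1 a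
  cases a <;> rfl

theorem optPerm_zpow (p : Perm D) (i : ℤ) : optPerm p ^ i = optPerm (p ^ i) :=
  (map_zpow (MonoidHom.mk' optPerm optPerm_mul) p i).symm

theorem sameCycle_optPerm_some :
    (optPerm p).SameCycle (some x) (some y) ↔ p.SameCycle x y := by
  simp [SameCycle, optPerm_zpow]

theorem sameCycle_optPerm_none {p : Perm D} {x : D} :
    (optPerm p).SameCycle none (some x) ↔ False := by
  simp [SameCycle, optPerm_zpow]

theorem not_sameCycle_optPerm (p : Perm D) (c : D) : ¬ (optPerm p).SameCycle none (some c) :=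
  fun h => sameCycle_optPerm_none.1 h

theorem cycleDegree_optPerm_none : cycleDegree (optPerm p) none = 1 := by
  rw [cycleDegree_eq_ncard, Set.ncard_eq_one]
  refine ⟨none, ?_⟩
  ext a
  cases a with
  | none => simp [SameCycle.refl]
  | some a => simp [sameCycle_optPerm_none]

theorem cycleDegree_optPerm_some :
    cycleDegree (optPerm p) (some x) = cycleDegree p x := by
  rw [cycleDegree_eq_ncard, cycleDegree_eq_ncard,
    ← Set.ncard_image_of_injective _ (Option.some_injective D)]
  congr 1
  ext a
  cases a with
  | none => simpa using fun h => sameCycle_optPerm_none.1 (SameCycle.symm h)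
  | some a => simp [sameCycle_optPerm_some]

theorem cycleCount_optPerm [Finite D] (p : Perm D) :
    cycleCount (optPerm p) = cycleCount p + 1 := by
  rw [cycleCount, cycleCount, ← Finite.card_option]
  symm
  refine Nat.card_eq_of_bijective (fun q : Option (Quotient (SameCycle.setoid p)) =>
    q.elim (Quotient.mk (SameCycle.setoid (optPerm p)) none)
      (Quotient.map' some fun _ _ h => sameCycle_optPerm_some.2 h)) ⟨?_, ?_⟩
  · intro q q' h
    induction q with
    | none =>
      induction q' with
      | none => rfl
      | some q' =>
        induction q' using Quotient.inductionOn with | h x => ?_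
        exact (sameCycle_optPerm_none.1 (Quotient.exact h)).elim
    | some q =>
      induction q using Quotient.inductionOn with | h x => ?_
      induction q' with
      | none => exact (sameCycle_optPerm_none.1 (SameCycle.symm (Quotient.exact h))).elim
      | some q' =>
        induction q' using Quotient.inductionOn with | h y => ?_
        exact congrArg some (Quotient.sound (sameCycle_optPerm_some.1 (Quotient.exact h)))
  · intro q
    induction q using Quotient.inductionOn with | h x => ?_
    cases x with
    | none => exact ⟨none, rfl⟩
    | some x => exact ⟨some (Quotient.mk _ x), rfl⟩

/-! ### Disjoint unions -/

section Sum

variable {A B : Type} {p : Perm A} {q : Perm B}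

theorem sumCongr_zpow (i : ℤ) : Perm.sumCongr p q ^ i = Perm.sumCongr (p ^ i) (q ^ i) :=
  (map_zpow (sumCongrHom A B) (p, q) i).symm

theorem sameCycle_sumCongr_inl {x y : A} :
    (Perm.sumCongr p q).SameCycle (Sum.inl x) (Sum.inl y) ↔ p.SameCycle x y := by
  simp [SameCycle, sumCongr_zpow]

theorem sameCycle_sumCongr_inr {x y : B} :
    (Perm.sumCongr p q).SameCycle (Sum.inr x) (Sum.inr y) ↔ q.SameCycle x y := by
  simp [SameCycle, sumCongr_zpow]

theorem sameCycle_sumCongr_inl_inr {x : A} {y : B} :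
    (Perm.sumCongr p q).SameCycle (Sum.inl x) (Sum.inr y) ↔ False := by
  simp [SameCycle, sumCongr_zpow]

theorem cycleDegree_sumCongr_inl {x : A} :
    cycleDegree (Perm.sumCongr p q) (Sum.inl x) = cycleDegree p x := by
  rw [cycleDegree_eq_ncard, cycleDegree_eq_ncard,
    ← Set.ncard_image_of_injective _ (Sum.inl_injective (α := A) (β := B))]
  refine congrArg Set.ncard ?_
  ext a
  cases a with
  | inl a => simp [sameCycle_sumCongr_inl]
  | inr a => simp [sameCycle_sumCongr_inl_inr]

theorem cycleDegree_sumCongr_inr {x : B} :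
    cycleDegree (Perm.sumCongr p q) (Sum.inr x) = cycleDegree q x := by
  rw [cycleDegree_eq_ncard, cycleDegree_eq_ncard,
    ← Set.ncard_image_of_injective _ (Sum.inr_injective (α := A) (β := B))]
  refine congrArg Set.ncard ?_
  ext a
  cases a with
  | inr a => simp [sameCycle_sumCongr_inr]
  | inl a => simpa using fun h => sameCycle_sumCongr_inl_inr.1 (SameCycle.symm h)

theorem cycleCount_sumCongr [Finite A] [Finite B] (p : Perm A) (q : Perm B) :
    cycleCount (Perm.sumCongr p q) = cycleCount p + cycleCount q := by
  rw [cycleCount, cycleCount, cycleCount, ← Nat.card_sum]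
  symm
  refine Nat.card_eq_of_bijective
    (fun s : Quotient (SameCycle.setoid p) ⊕ Quotient (SameCycle.setoid q) =>
      s.elim (Quotient.map' (s₂ := SameCycle.setoid (Perm.sumCongr p q)) Sum.inl
          fun _ _ h => sameCycle_sumCongr_inl.2 h)
        (Quotient.map' Sum.inr fun _ _ h => sameCycle_sumCongr_inr.2 h)) ⟨?_, ?_⟩
  · rintro (s | s) (s' | s') h <;> induction s using Quotient.inductionOn with | h x => ?_ <;>
      induction s' using Quotient.inductionOn with | h y => ?_
    · exact congrArg Sum.inl (Quotient.sound (sameCycle_sumCongr_inl.1 (Quotient.exact h)))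
    · exact (sameCycle_sumCongr_inl_inr.1 (Quotient.exact h)).elim
    · exact (sameCycle_sumCongr_inl_inr.1 (SameCycle.symm (Quotient.exact h))).elim
    · exact congrArg Sum.inr (Quotient.sound (sameCycle_sumCongr_inr.1 (Quotient.exact h)))
  · intro s
    induction s using Quotient.inductionOn with | h x => ?_
    cases x with
    | inl x => exact ⟨Sum.inl (Quotient.mk _ x), rfl⟩
    | inr x => exact ⟨Sum.inr (Quotient.mk _ x), rfl⟩

end Sum

/-! ### Multiplication by a transposition -/

section Swap

variable [DecidableEq D]

/-- Starting at `c`, the new permutation steps to `p b` and then follows the old cycle of `b`, which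
eventually returns to `b`. If `b` were never met, no step would be disturbed by the transposition,
and the order of `p` gives a contradiction. -/
theorem sameCycle_mul_swap_self [Finite D] (h : ¬ p.SameCycle b c) :
    (p * swap b c).SameCycle b c := by
  by_contra hn
  have key : ∀ i : ℕ, (p * swap b c).SameCycle c ((p ^ (i + 1)) b) := by
    intro i
    induction i with
    | zero => exact ⟨1, by simp⟩
    | succ i ih =>
      have h1 : (p ^ (i + 1)) b ≠ b := fun e => hn (by rw [e] at ih; exact ih.symm)
      have h2 : (p ^ (i + 1)) b ≠ c := fun e => h ⟨(i + 1 : ℕ), by rw [zpow_natCast]; exact e⟩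
      have h3 : (p ^ (i + 1 + 1)) b = (p * swap b c) ((p ^ (i + 1)) b) := by
        rw [Perm.mul_apply, swap_apply_of_ne_of_ne h1 h2, pow_succ', Perm.mul_apply]
      rw [h3]
      exact ih.apply_right
  obtain ⟨k, hk⟩ := Nat.exists_eq_succ_of_ne_zero (orderOf_pos p).ne'
  have := key k
  rw [← Nat.succ_eq_add_one, ← hk, pow_orderOf_eq_one] at this
  exact hn this.symm

/-- A transposition of points in different cycles joins these two cycles and touches no other. Each
inclusion needs to be checked only on single steps, by `sameCycle_le`. -/
theorem sameCycle_mul_swap_iff [Finite D] (h : ¬ p.SameCycle b c) :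
    (p * swap b c).SameCycle x y ↔ p.SameCycle x y ∨
      ((p.SameCycle b x ∨ p.SameCycle c x) ∧ (p.SameCycle b y ∨ p.SameCycle c y)) := by
  have hbc := sameCycle_mul_swap_self h
  set q := p * swap b c with hq
  have hqb : q b = p c := by simp [hq]
  have hqc : q c = p b := by simp [hq]
  have hqx : ∀ x, x ≠ b → x ≠ c → q x = p x := fun x h1 h2 => by
    rw [hq, Perm.mul_apply, swap_apply_of_ne_of_ne h1 h2]
  have hle : ∀ {x y}, p.SameCycle x y → q.SameCycle x y := by
    intro x y hxy
    refine sameCycle_le (E := q.SameCycle) ⟨SameCycle.refl _, SameCycle.symm, SameCycle.trans⟩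
      (fun x => ?_) hxy
    by_cases hb : x = b
    · subst hb
      refine hbc.trans ?_
      rw [← hqc]; exact ⟨1, by simp⟩
    by_cases hc : x = c
    · subst hc
      refine hbc.symm.trans ?_
      rw [← hqb]; exact ⟨1, by simp⟩
    · rw [← hqx x hb hc]; exact ⟨1, by simp⟩
  constructor
  · intro hxy
    refine sameCycle_le (E := fun x y => p.SameCycle x y ∨
      ((p.SameCycle b x ∨ p.SameCycle c x) ∧ (p.SameCycle b y ∨ p.SameCycle c y)))
      ⟨fun x => Or.inl (SameCycle.refl _ _), ?_, ?_⟩ ?_ hxy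
    · rintro x y (h | ⟨h, h'⟩)
      · exact Or.inl h.symm
      · exact Or.inr ⟨h', h⟩
    · rintro x y z (h | ⟨h, h'⟩) (k | ⟨k, k'⟩)
      · exact Or.inl (h.trans k)
      · exact Or.inr ⟨k.imp (fun k => k.trans h.symm) (fun k => k.trans h.symm), k'⟩
      · exact Or.inr ⟨h, h'.imp (fun h => h.trans k) (fun h => h.trans k)⟩
      · exact Or.inr ⟨h, k'⟩
    · intro x
      by_cases hb : x = b
      · subst hb
        exact Or.inr ⟨Or.inl (SameCycle.refl _ _), Or.inr (hqb ▸ ⟨1, by simp⟩)⟩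
      by_cases hc : x = c
      · subst hc
        exact Or.inr ⟨Or.inr (SameCycle.refl _ _), Or.inl (hqc ▸ ⟨1, by simp⟩)⟩
      · exact Or.inl (hqx x hb hc ▸ ⟨1, by simp⟩)
  · rintro (h | ⟨h, h'⟩)
    · exact hle h
    · have h1 : q.SameCycle b x := h.elim hle fun h => hbc.trans (hle h)
      have h2 : q.SameCycle b y := h'.elim hle fun h => hbc.trans (hle h)
      exact h1.symm.trans h2

theorem cycleDegree_mul_swap [Finite D] (h : ¬ p.SameCycle b c) :
    cycleDegree (p * swap b c) b = cycleDegree p b + cycleDegree p c := by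
  simp only [cycleDegree_eq_ncard]
  rw [← Set.ncard_union_eq]
  · congr 1
    ext a
    simp only [Set.mem_ofPred_eq, Set.mem_union, sameCycle_mul_swap_iff h]
    have := SameCycle.refl p b
    tauto
  · rw [Set.disjoint_left]
    intro a ha hc
    exact h (SameCycle.trans ha (SameCycle.symm hc))

theorem cycleDegree_mul_swap_of_not [Finite D] (h : ¬ p.SameCycle b c) (hb : ¬ p.SameCycle b x)
    (hc : ¬ p.SameCycle c x) : cycleDegree (p * swap b c) x = cycleDegree p x := by
  simp only [cycleDegree_eq_ncard]
  congr 1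
  ext a
  simp only [Set.mem_ofPred_eq, sameCycle_mul_swap_iff h]
  tauto

theorem cycleCount_mul_swap [Finite D] (h : ¬ p.SameCycle b c) :
    cycleCount p = cycleCount (p * swap b c) + 1 :=
  card_quotient_of_merge (r := SameCycle.setoid p) h fun _ _ => sameCycle_mul_swap_iff h

/-- The first step from `n` jumps ahead to `p ^ (j + 1) n`; from there the old cycle is followed
undisturbed until it returns to `n`. Hence the new cycle of `n` consists of the last `d - j` points
of the old cycle of length `d`. -/
theorem pow_mul_swap_apply {n : D} {j : ℕ} (hj : 0 < j) (i : ℕ)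
    (hi : i + 1 + j ≤ Function.minimalPeriod p n) :
    ((p * swap n ((p ^ j) n)) ^ (i + 1)) n = (p ^ (i + 1 + j)) n := by
  induction i with
  | zero => simp [pow_add]
  | succ i ih =>
    rw [pow_succ', Perm.mul_apply, ih (by omega), Perm.mul_apply, swap_apply_of_ne_of_ne,
      ← Perm.mul_apply, ← pow_succ']
    · congr 2; ring
    · intro e
      have : p^[i + 1 + j] n = p^[0] n := by rw [iterate_eq_pow]; exact e
      have := Function.iterate_injOn_Iio_minimalPeriod (f := p) (x := n)
        (Set.mem_Iio.2 (by omega)) (Set.mem_Iio.2 (by omega)) this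
      omega
    · intro e
      have : p^[i + 1 + j] n = p^[j] n := by rw [iterate_eq_pow, iterate_eq_pow]; exact e
      have := Function.iterate_injOn_Iio_minimalPeriod (f := p) (x := n)
        (Set.mem_Iio.2 (by omega)) (Set.mem_Iio.2 (by omega)) this
      omega

theorem cycleDegree_mul_swap_pow [Finite D] {n : D} {j : ℕ} (hj : 0 < j)
    (hj' : j < cycleDegree p n) :
    cycleDegree (p * swap n ((p ^ j) n)) n = cycleDegree p n - j := by
  rw [cycleDegree_eq_minimalPeriod] at *
  rw [cycleDegree_eq_minimalPeriod]
  set d := Function.minimalPeriod p n with hd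
  have hper : (p ^ d) n = n := by
    rw [← iterate_eq_pow]; exact Function.iterate_minimalPeriod
  set q := p * swap n ((p ^ j) n) with hq
  have hqd : Function.IsPeriodicPt q (d - j) n := by
    rw [Function.IsPeriodicPt, Function.IsFixedPt, iterate_eq_pow]
    obtain ⟨i, hi⟩ : ∃ i, d - j = i + 1 := ⟨d - j - 1, by omega⟩
    rw [hi, pow_mul_swap_apply hj i (by omega), ← hi, Nat.sub_add_cancel hj'.le, hper]
  refine le_antisymm (hqd.minimalPeriod_le (by omega)) ?_
  by_contra! hlt
  have hpos := hqd.minimalPeriod_pos (by omega)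
  obtain ⟨i, hi⟩ : ∃ i, Function.minimalPeriod q n = i + 1 :=
    ⟨Function.minimalPeriod q n - 1, by omega⟩
  have h1 : (q ^ (i + 1)) n = n := by
    rw [← hi, ← iterate_eq_pow]; exact Function.iterate_minimalPeriod
  rw [pow_mul_swap_apply hj i (by omega)] at h1
  have h2 : p^[i + 1 + j] n = p^[0] n := by rw [iterate_eq_pow]; exact h1
  have := Function.iterate_injOn_Iio_minimalPeriod (f := p) (x := n)
    (Set.mem_Iio.2 (by omega)) (Set.mem_Iio.2 (by omega)) h2
  omega

theorem not_sameCycle_mul_swap [Finite D] (hbc : b ≠ c) (h : p.SameCycle b c) :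
    ¬ (p * swap b c).SameCycle b c := by
  obtain ⟨j, hj, rfl⟩ := SameCycle.exists_pow_lt_cycleDegree h
  have hj0 : 0 < j := Nat.pos_of_ne_zero fun e => hbc (by simp [e])
  intro h'
  obtain ⟨i, hi, he⟩ := SameCycle.exists_pow_lt_cycleDegree h'
  rw [cycleDegree_mul_swap_pow hj0 hj] at hi
  obtain ⟨k, rfl⟩ : ∃ k, i = k + 1 := by
    refine ⟨i - 1, ?_⟩
    rcases i with _ | i
    · exact absurd he hbc
    · rfl
  rw [pow_mul_swap_apply hj0 k (by rw [← cycleDegree_eq_minimalPeriod]; omega)] at he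
  have := pow_apply_inj_of_lt_cycleDegree (by omega) hj he
  omega

theorem mul_swap_mul_swap_self (p : Perm D) (b c : D) : p * swap b c * swap b c = p := by
  rw [mul_assoc, swap_mul_self, mul_one]

/-- Cutting a cycle is the reverse of joining two, since the same transposition applied twice
cancels. This and the next three results are the joining results read backwards, with
`not_sameCycle_mul_swap` supplying their hypothesis. -/
theorem sameCycle_iff_of_sameCycle [Finite D] (hbc : b ≠ c) (h : p.SameCycle b c) :
    p.SameCycle x y ↔ (p * swap b c).SameCycle x y ∨
      (((p * swap b c).SameCycle b x ∨ (p * swap b c).SameCycle c x) ∧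
        ((p * swap b c).SameCycle b y ∨ (p * swap b c).SameCycle c y)) := by
  have := sameCycle_mul_swap_iff (x := x) (y := y) (not_sameCycle_mul_swap hbc h)
  rwa [mul_swap_mul_swap_self] at this

theorem cycleCount_mul_swap_of_sameCycle [Finite D] (hbc : b ≠ c) (h : p.SameCycle b c) :
    cycleCount (p * swap b c) = cycleCount p + 1 := by
  have := cycleCount_mul_swap (not_sameCycle_mul_swap hbc h)
  rwa [mul_swap_mul_swap_self] at this

theorem cycleDegree_add_of_sameCycle [Finite D] (hbc : b ≠ c) (h : p.SameCycle b c) :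
    cycleDegree (p * swap b c) b + cycleDegree (p * swap b c) c = cycleDegree p b := by
  have := cycleDegree_mul_swap (not_sameCycle_mul_swap hbc h)
  rw [mul_swap_mul_swap_self] at this
  exact this.symm

theorem cycleDegree_mul_swap_of_sameCycle_of_not [Finite D] (hbc : b ≠ c) (h : p.SameCycle b c)
    (hx : ¬ (p * swap b c).SameCycle b x) (hx' : ¬ (p * swap b c).SameCycle c x) :
    cycleDegree (p * swap b c) x = cycleDegree p x := by
  have := cycleDegree_mul_swap_of_not (not_sameCycle_mul_swap hbc h) hx hx'
  rw [mul_swap_mul_swap_self] at this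
  exact this.symm

/-- Summation over the ways to split a cycle by a transposition. -/
theorem sum_cycleDegree_mul_swap [Fintype D] {K : Type*} [AddCommMonoid K] (p : Perm D) (n : D)
    (f : ℕ → ℕ → K) [DecidablePred fun b => b ≠ n ∧ p.SameCycle n b] :
    ∑ b, (if b ≠ n ∧ p.SameCycle n b then
        f (cycleDegree (p * swap n b) n) (cycleDegree (p * swap n b) b) else 0) =
      ∑ k ∈ Finset.range (cycleDegree p n - 1), f (k + 1) (cycleDegree p n - (k + 1)) := by
  rw [← Finset.sum_filter]
  symm
  -- Cutting at the point `p ^ j n` leaves `d - j` points in the cycle of `n`; to leave `k + 1` of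
  -- them, take `j = d - (k + 1)`.
  refine Finset.sum_bij (fun k _ => (p ^ (cycleDegree p n - (k + 1))) n) ?_ ?_ ?_ ?_
  · intro k hk
    rw [Finset.mem_range] at hk
    simp only [Finset.mem_filter, Finset.mem_univ, true_and]
    refine ⟨fun e => ?_, ⟨(cycleDegree p n - (k + 1) : ℕ), by rw [zpow_natCast]⟩⟩
    have := pow_apply_inj_of_lt_cycleDegree (p := p) (x := n) (j := 0) (by omega) (by omega) e
    omega
  · intro k hk l hl h
    rw [Finset.mem_range] at hk hl
    have := pow_apply_inj_of_lt_cycleDegree (by omega) (by omega) h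
    omega
  · intro b hb
    simp only [Finset.mem_filter, Finset.mem_univ, true_and] at hb
    obtain ⟨j, hj, rfl⟩ := SameCycle.exists_pow_lt_cycleDegree hb.2
    have hj0 : 0 < j := Nat.pos_of_ne_zero fun e => hb.1 (by simp [e])
    refine ⟨cycleDegree p n - j - 1, Finset.mem_range.2 (by omega), ?_⟩
    congr 2
    omega
  · intro k hk
    rw [Finset.mem_range] at hk
    have h0 : 0 < cycleDegree p n - (k + 1) := by omega
    have h1 : cycleDegree p n - (k + 1) < cycleDegree p n := by omega
    have hs : p.SameCycle n ((p ^ (cycleDegree p n - (k + 1))) n) :=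
      ⟨(cycleDegree p n - (k + 1) : ℕ), by rw [zpow_natCast]⟩
    have hne : n ≠ (p ^ (cycleDegree p n - (k + 1))) n := fun e => by
      have := pow_apply_inj_of_lt_cycleDegree (p := p) (x := n) (i := 0) (by omega) (by omega) e
      omega
    have h2 := cycleDegree_mul_swap_pow h0 h1
    have h3 := cycleDegree_add_of_sameCycle hne hs
    congr 1 <;> omega

end Swap

end Cycles

/-! ### Insertion of a dart -/

section Insertion

variable {D : Type} [DecidableEq D]

/-- The vertex permutation obtained by inserting the dart `none`. -/
def insertR (R : Perm D) (b c : Option D) : Perm (Option D) :=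
  optPerm R * swap none c * swap none b

/-- The hyperedge permutation obtained by inserting the dart `none` before `b`. -/
def insertL (L : Perm D) (b : Option D) : Perm (Option D) := swap none b * optPerm L

theorem insertL_eq (L : Perm D) (b : Option D) :
    insertL L b = Perm.decomposeOption.symm (b, L) := by
  rw [Perm.decomposeOption_symm_apply]; rfl

/-- A permutation of `Option D` is uniquely a transposition `swap none b` times an extension of a
permutation of `D`. Applied to `L` this determines `b` and the old `L`; after `swap none b` is
cancelled from `R`, the same decomposition of the inverse determines `c` and the old `R`. -/
theorem insert_bijective : Function.Bijective
    (fun s : (Perm D × Perm D) × (Option D × Option D) =>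
      (insertR s.1.1 s.2.1 s.2.2, insertL s.1.2 s.2.1)) := by
  have key : ∀ (R : Perm D) (c : Option D), (optPerm R * swap none c)⁻¹ = insertL R⁻¹ c := by
    intro R c
    rw [mul_inv_rev, swap_inv, insertL]
    rfl
  constructor
  · rintro ⟨⟨R, L⟩, ⟨b, c⟩⟩ ⟨⟨R', L'⟩, ⟨b', c'⟩⟩ h
    simp only [Prod.mk.injEq] at h ⊢
    obtain ⟨h1, h2⟩ := h
    rw [insertL_eq, insertL_eq] at h2
    have h2' := Perm.decomposeOption.symm.injective h2
    simp only [Prod.mk.injEq] at h2'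
    obtain ⟨rfl, rfl⟩ := h2'
    have h3 := congrArg (·⁻¹) (mul_right_cancel h1)
    simp only [key, insertL_eq] at h3
    have h3' := Perm.decomposeOption.symm.injective h3
    simp only [Prod.mk.injEq, inv_inj] at h3'
    exact ⟨⟨h3'.2, rfl⟩, rfl, h3'.1⟩
  · rintro ⟨R, L⟩
    obtain ⟨⟨b, L'⟩, hL⟩ := Perm.decomposeOption.symm.surjective L
    obtain ⟨⟨c, R'⟩, hR⟩ := Perm.decomposeOption.symm.surjective (R * swap none b)⁻¹
    refine ⟨((R'⁻¹, L'), (b, c)), ?_⟩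
    simp only [Prod.mk.injEq]
    refine ⟨?_, by rw [insertL_eq, hL]⟩
    rw [← insertL_eq, ← inv_inv R', ← key, inv_inj] at hR
    rw [insertR, hR, mul_swap_mul_swap_self]

theorem cycleCount_optPerm_mul_swap [Finite D] (p : Perm D) (c : D) :
    cycleCount (optPerm p * swap none (some c)) = cycleCount p := by
  have h1 := cycleCount_mul_swap (not_sameCycle_optPerm p c)
  rw [cycleCount_optPerm] at h1
  omega

theorem cycleCount_insertL_none [Finite D] (L : Perm D) :
    cycleCount (insertL L none) = cycleCount L + 1 := by
  rw [insertL, swap_self, ← cycleCount_optPerm]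
  rfl

theorem cycleCount_insertL_some [Finite D] (L : Perm D) (b : D) :
    cycleCount (insertL L (some b)) = cycleCount L := by
  rw [insertL, cycleCount_mul_comm, cycleCount_optPerm_mul_swap]

/-- The two copies of `swap none b` meet in the middle and cancel, so the faces depend on `c` alone.
Up to a cyclic rotation of the product, `c` plays for the faces the part that `b` plays for the
hyperedges. -/
theorem cycleCount_insertR_mul_insertL (R L : Perm D) (b c : Option D) :
    cycleCount (insertR R b c * insertL L b) = cycleCount (insertL (L * R) c) := by
  have : insertR R b c * insertL L b = optPerm R * (swap none c * optPerm L) := by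
    rw [insertR, insertL, ← mul_assoc, mul_swap_mul_swap_self, mul_assoc]
  rw [this, cycleCount_mul_comm, insertL, optPerm_mul, mul_assoc]

theorem cycleCount_insert_mul_none [Finite D] (R L : Perm D) (b : Option D) :
    cycleCount (insertR R b none * insertL L b) = cycleCount (R * L) + 1 := by
  rw [cycleCount_insertR_mul_insertL, cycleCount_insertL_none, cycleCount_mul_comm]

theorem cycleCount_insert_mul_some [Finite D] (R L : Perm D) (b : Option D) (c : D) :
    cycleCount (insertR R b (some c) * insertL L b) = cycleCount (R * L) := by
  rw [cycleCount_insertR_mul_insertL, cycleCount_insertL_some, cycleCount_mul_comm]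

theorem insertR_none_some (R : Perm D) (c : D) :
    insertR R none (some c) = optPerm R * swap none (some c) := by
  rw [insertR, swap_self]; rfl

theorem insertR_some_none (R : Perm D) (b : D) :
    insertR R (some b) none = optPerm R * swap none (some b) := by
  rw [insertR, swap_self]; rfl

theorem insertR_none_none (R : Perm D) : insertR R none none = optPerm R := by
  rw [insertR, swap_self]; rfl

/-! ### Insertion of a dart into the vertex of `c` -/

section OneSome

variable [Finite D] {R : Perm D} {b c x y : D}

theorem sameCycle_optPerm_mul_swap_some :
    (optPerm R * swap none (some c)).SameCycle (some x) (some y) ↔ R.SameCycle x y := by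
  rw [sameCycle_mul_swap_iff (not_sameCycle_optPerm R c)]
  simp only [sameCycle_optPerm_some, sameCycle_optPerm_none, false_or, or_iff_left_iff_imp]
  exact fun h => h.1.symm.trans h.2

theorem sameCycle_optPerm_mul_swap_none :
    (optPerm R * swap none (some c)).SameCycle none (some y) ↔ R.SameCycle c y := by
  rw [sameCycle_mul_swap_iff (not_sameCycle_optPerm R c)]
  simp only [sameCycle_optPerm_some, sameCycle_optPerm_none, false_or]
  exact ⟨fun h => h.2, fun h => ⟨Or.inl (SameCycle.refl _ _), h⟩⟩

theorem cycleDegree_optPerm_mul_swap_none :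
    cycleDegree (optPerm R * swap none (some c)) none = cycleDegree R c + 1 := by
  rw [cycleDegree_mul_swap (not_sameCycle_optPerm R c), cycleDegree_optPerm_none,
    cycleDegree_optPerm_some, add_comm]

theorem cycleDegree_optPerm_mul_swap_some (h : ¬ R.SameCycle c x) :
    cycleDegree (optPerm R * swap none (some c)) (some x) = cycleDegree R x := by
  rw [cycleDegree_mul_swap_of_not (not_sameCycle_optPerm R c) (not_sameCycle_optPerm R x),
    cycleDegree_optPerm_some]
  rwa [sameCycle_optPerm_some]

end OneSome

/-! ### Insertion with `b` and `c` in one vertex: the enlarged vertex is cut in two -/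

section Split

variable [Finite D] {R : Perm D} {b c x y : D} (h : R.SameCycle c b)

include h

theorem not_sameCycle_insertR : ¬ (insertR R (some b) (some c)).SameCycle none (some b) :=
  not_sameCycle_mul_swap (by simp) (sameCycle_optPerm_mul_swap_none.2 h)

theorem sameCycle_iff_insertR : R.SameCycle x y ↔
    (insertR R (some b) (some c)).SameCycle (some x) (some y) ∨
      (((insertR R (some b) (some c)).SameCycle none (some x) ∨
          (insertR R (some b) (some c)).SameCycle (some b) (some x)) ∧
        ((insertR R (some b) (some c)).SameCycle none (some y) ∨
          (insertR R (some b) (some c)).SameCycle (some b) (some y))) := by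
  rw [← sameCycle_optPerm_mul_swap_some (c := c)]
  exact sameCycle_iff_of_sameCycle (by simp) (sameCycle_optPerm_mul_swap_none.2 h)

theorem sameCycle_root_iff_insertR : R.SameCycle c x ↔
    (insertR R (some b) (some c)).SameCycle none (some x) ∨
      (insertR R (some b) (some c)).SameCycle (some b) (some x) := by
  rw [← sameCycle_optPerm_mul_swap_none,
    sameCycle_iff_of_sameCycle (by simp) (sameCycle_optPerm_mul_swap_none.2 h)]
  have := SameCycle.refl (optPerm R * swap none (some c) * swap none (some b)) none
  unfold insertR
  tauto

theorem cycleCount_insertR_of_sameCycle :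
    cycleCount (insertR R (some b) (some c)) = cycleCount R + 1 := by
  rw [insertR, cycleCount_mul_swap_of_sameCycle (by simp) (sameCycle_optPerm_mul_swap_none.2 h),
    cycleCount_optPerm_mul_swap]

theorem cycleDegree_insertR_of_sameCycle (hx : ¬ R.SameCycle c x) :
    cycleDegree (insertR R (some b) (some c)) (some x) = cycleDegree R x := by
  rw [sameCycle_root_iff_insertR h, not_or] at hx
  rw [← cycleDegree_optPerm_mul_swap_some (c := c)]
  · exact cycleDegree_mul_swap_of_sameCycle_of_not (by simp)
      (sameCycle_optPerm_mul_swap_none.2 h) hx.1 hx.2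
  · rw [sameCycle_root_iff_insertR h, not_or]
    exact hx

end Split

-- The vertex of `c`, of degree `d`, has `d + 1` darts once the new dart is in it. The positions of
-- `b` produce each splitting of `d + 1` into positive parts `k + 1` and `d - k` exactly once.
open scoped Classical in
theorem sum_cycleDegree_insertR {D : Type} [DecidableEq D] [Fintype D] {K : Type*}
    [AddCommMonoid K] (R : Perm D) (c : D) (f : ℕ → ℕ → K) :
    ∑ b, (if R.SameCycle c b then f (cycleDegree (insertR R (some b) (some c)) none)
        (cycleDegree (insertR R (some b) (some c)) (some b)) else 0) =
      ∑ k ∈ Finset.range (cycleDegree R c), f (k + 1) (cycleDegree R c - k) := by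
  have := sum_cycleDegree_mul_swap (optPerm R * swap none (some c)) none f
  rw [Fintype.sum_option] at this
  simp only [cycleDegree_optPerm_mul_swap_none, sameCycle_optPerm_mul_swap_none] at this
  simpa [insertR] using this

/-! ### Insertion with `b` and `c` in different vertices: these are merged -/

section Merge

variable [Finite D] {R : Perm D} {b c x y : D} (h : ¬ R.SameCycle c b)

include h

theorem cycleCount_insertR_of_not_sameCycle :
    cycleCount R = cycleCount (insertR R (some b) (some c)) + 1 := by
  rw [insertR, ← cycleCount_mul_swap (by rwa [sameCycle_optPerm_mul_swap_none]),
    cycleCount_optPerm_mul_swap]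

theorem sameCycle_none_insertR :
    (insertR R (some b) (some c)).SameCycle none (some x) ↔
      R.SameCycle c x ∨ R.SameCycle b x := by
  rw [insertR, sameCycle_mul_swap_iff (by rwa [sameCycle_optPerm_mul_swap_none]),
    sameCycle_optPerm_mul_swap_none, sameCycle_optPerm_mul_swap_some]
  have := SameCycle.refl (optPerm R * swap none (some c)) none
  tauto

theorem sameCycle_some_insertR (hx : ¬ R.SameCycle c x) (hx' : ¬ R.SameCycle b x) :
    (insertR R (some b) (some c)).SameCycle (some x) (some y) ↔ R.SameCycle x y := by
  rw [insertR, sameCycle_mul_swap_iff (by rwa [sameCycle_optPerm_mul_swap_none])]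
  simp only [sameCycle_optPerm_mul_swap_none, sameCycle_optPerm_mul_swap_some]
  tauto

theorem cycleDegree_none_insertR :
    cycleDegree (insertR R (some b) (some c)) none =
      cycleDegree R b + cycleDegree R c + 1 := by
  have h' : ¬ (optPerm R * swap none (some c)).SameCycle none (some b) := by
    rwa [sameCycle_optPerm_mul_swap_none]
  rw [insertR, cycleDegree_mul_swap h', cycleDegree_optPerm_mul_swap_none,
    cycleDegree_optPerm_mul_swap_some h]
  ring

theorem cycleDegree_some_insertR (hx : ¬ R.SameCycle c x) (hx' : ¬ R.SameCycle b x) :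
    cycleDegree (insertR R (some b) (some c)) (some x) = cycleDegree R x := by
  have h' : ¬ (optPerm R * swap none (some c)).SameCycle none (some b) := by
    rwa [sameCycle_optPerm_mul_swap_none]
  rw [insertR, cycleDegree_mul_swap_of_not h', cycleDegree_optPerm_mul_swap_some hx]
  · rwa [sameCycle_optPerm_mul_swap_none]
  · rwa [sameCycle_optPerm_mul_swap_some]

end Merge

end Insertion

/-! ### Connectedness -/

section Connected

variable {D : Type}

/-- `s` is a union of orbits of the group generated by `R` and `L`. -/
def IsInvariant (R L : Perm D) (s : Set D) : Prop :=
  (∀ x, R x ∈ s ↔ x ∈ s) ∧ ∀ x, L x ∈ s ↔ x ∈ s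

theorem IsInvariant.compl {R L : Perm D} {s : Set D} (h : IsInvariant R L s) :
    IsInvariant R L sᶜ :=
  ⟨fun x => not_congr (h.1 x), fun x => not_congr (h.2 x)⟩

theorem IsInvariant.inter {R L : Perm D} {s t : Set D} (h : IsInvariant R L s)
    (h' : IsInvariant R L t) : IsInvariant R L (s ∩ t) :=
  ⟨fun x => and_congr (h.1 x) (h'.1 x), fun x => and_congr (h.2 x) (h'.2 x)⟩

theorem IsInvariant.union {R L : Perm D} {s t : Set D} (h : IsInvariant R L s)
    (h' : IsInvariant R L t) : IsInvariant R L (s ∪ t) :=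
  ⟨fun x => or_congr (h.1 x) (h'.1 x), fun x => or_congr (h.2 x) (h'.2 x)⟩

/-- There is at most one orbit of the group generated by `R` and `L`. -/
def Conn (R L : Perm D) : Prop :=
  ∀ s : Set D, IsInvariant R L s → s.Nonempty → s = Set.univ

/-- The orbits of `b` and `c` are all the orbits of the group generated by `R` and `L`. -/
def ConnVia (R L : Perm D) (b c : D) : Prop :=
  ∀ s : Set D, IsInvariant R L s → (b ∈ s ↔ c ∈ s) → s.Nonempty → s = Set.univ

theorem Conn.connVia {R L : Perm D} (h : Conn R L) (b c : D) : ConnVia R L b c :=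
  fun s hs _ hn => h s hs hn

theorem ConnVia.conn {R L : Perm D} {b c : D} (h : ConnVia R L b c) (hbc : R.SameCycle c b) :
    Conn R L :=
  fun s hs hn => h s hs (sameCycle_mem_iff hs.1 hbc).symm hn

/-- Sets invariant under the generators are invariant under the group; conversely an orbit is an
invariant set. Invariant sets are easier to follow through insertions and decompositions than group
elements. -/
theorem isPretransitive_iff_conn (R L : Perm D) :
    MulAction.IsPretransitive (Subgroup.closure {R, L}) D ↔ Conn R L := by
  constructor
  · intro h s hs ⟨x, hx⟩
    rw [Set.eq_univ_iff_forall]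
    intro y
    obtain ⟨⟨g, hg⟩, rfl⟩ := h.exists_smul_eq x y
    have key : ∀ z, g z ∈ s ↔ z ∈ s := by
      induction hg using Subgroup.closure_induction with
      | mem g hg =>
        rcases hg with rfl | rfl
        exacts [hs.1, hs.2]
      | one => exact fun _ => Iff.rfl
      | mul g g' _ _ h h' => exact fun z => (h _).trans (h' z)
      | inv g _ h => exact fun z => by rw [← h]; simp
    exact (key x).2 hx
  · intro h
    refine ⟨fun x y => ?_⟩
    have hmem : ∀ g : Perm D, g ∈ Subgroup.closure {R, L} →
        ∀ z, g z ∈ MulAction.orbit (Subgroup.closure {R, L}) x ↔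
          z ∈ MulAction.orbit (Subgroup.closure {R, L}) x := fun g hg z => by
      rw [← MulAction.orbit_eq_iff, ← MulAction.orbit_eq_iff,
        ← MulAction.orbit_smul (⟨g, hg⟩ : Subgroup.closure {R, L}) z]
      rfl
    have := h (MulAction.orbit (Subgroup.closure {R, L}) x)
      ⟨hmem R (Subgroup.subset_closure (by simp)), hmem L (Subgroup.subset_closure (by simp))⟩
      ⟨x, MulAction.mem_orbit_self x⟩
    exact Set.eq_univ_iff_forall.1 this y

theorem isInvariant_permCongr {D' : Type} (e : D ≃ D') {R L : Perm D} {s : Set D'} :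
    IsInvariant (e.permCongr R) (e.permCongr L) s ↔ IsInvariant R L (e ⁻¹' s) := by
  constructor
  · intro h
    exact ⟨fun x => by simpa using h.1 (e x), fun x => by simpa using h.2 (e x)⟩
  · intro h
    exact ⟨fun x => by simpa using h.1 (e.symm x), fun x => by simpa using h.2 (e.symm x)⟩

theorem conn_permCongr {D' : Type} (e : D ≃ D') (R L : Perm D) :
    Conn (e.permCongr R) (e.permCongr L) ↔ Conn R L := by
  constructor
  · intro h s hs hn
    have := h (e.symm ⁻¹' s) ((isInvariant_permCongr e).2 (by simpa [← Set.preimage_comp] using hs))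
      (by rw [← e.image_eq_preimage_symm]; exact hn.image e)
    rw [← e.image_eq_preimage_symm] at this
    rw [← Set.preimage_image_eq s e.injective, this, Set.preimage_univ]
  · intro h s hs hn
    have := h (e ⁻¹' s) ((isInvariant_permCongr e).1 hs) (hn.preimage e.surjective)
    rw [← Set.image_preimage_eq s e.surjective, this, Set.image_univ, e.range_eq_univ]

theorem swap_mem_iff [DecidableEq D] {s : Set D} {b c : D} (h : b ∈ s ↔ c ∈ s) (x : D) :
    swap b c x ∈ s ↔ x ∈ s := by
  rcases eq_or_ne x b with rfl | hb
  · rw [swap_apply_left, h]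
  rcases eq_or_ne x c with rfl | hc
  · rw [swap_apply_right, h]
  · rw [swap_apply_of_ne_of_ne hb hc]

/-- The transposition `swap none b` preserves every set that contains both or neither of its points,
so an invariant set for the larger map is one for the smaller map together with a consistent
decision about `none`, `b` and `c`. -/
theorem isInvariant_insert [DecidableEq D] {R L : Perm D} {b c : Option D} {s : Set (Option D)} :
    IsInvariant (insertR R b c) (insertL L b) s ↔
      IsInvariant R L (some ⁻¹' s) ∧ (none ∈ s ↔ b ∈ s) ∧ (none ∈ s ↔ c ∈ s) := by
  constructor
  · rintro ⟨hR, hL⟩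
    have hb : none ∈ s ↔ b ∈ s := by
      have := hL none
      rw [insertL, Perm.mul_apply, optPerm_none, swap_apply_left] at this
      exact this.symm
    have hc : none ∈ s ↔ c ∈ s := by
      -- This argument is chosen so that its image under the new vertex permutation is `none`; the
      -- next test point of the same shape has image `some (R x)`.
      have := hR (swap none b c)
      rwa [insertR, Perm.mul_apply, Perm.mul_apply, swap_apply_self, swap_apply_right,
        optPerm_none, swap_mem_iff hb] at this
    refine ⟨⟨fun x => ?_, fun x => ?_⟩, hb, hc⟩
    · have := hR (swap none b (swap none c (some x)))
      rwa [insertR, Perm.mul_apply, Perm.mul_apply, swap_apply_self, swap_apply_self,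
        optPerm_some, swap_mem_iff hb, swap_mem_iff hc] at this
    · have := hL (some x)
      rwa [insertL, Perm.mul_apply, swap_mem_iff hb] at this
  · rintro ⟨⟨hR, hL⟩, hb, hc⟩
    have hR' : ∀ x, optPerm R x ∈ s ↔ x ∈ s := by
      rintro (_ | x)
      exacts [Iff.rfl, hR x]
    have hL' : ∀ x, optPerm L x ∈ s ↔ x ∈ s := by
      rintro (_ | x)
      exacts [Iff.rfl, hL x]
    refine ⟨fun x => ?_, fun x => ?_⟩
    · rw [insertR, Perm.mul_apply, Perm.mul_apply, hR', swap_mem_iff hc, swap_mem_iff hb]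
    · rw [insertL, Perm.mul_apply, swap_mem_iff hb, hL']

theorem conn_insert_none_none [DecidableEq D] (R L : Perm D) :
    Conn (insertR R none none) (insertL L none) ↔ IsEmpty D := by
  constructor
  · intro h
    have := h {none} (isInvariant_insert.2 ⟨⟨by simp, by simp⟩, by simp, by simp⟩) ⟨none, rfl⟩
    refine ⟨fun x => ?_⟩
    have hx : (some x : Option D) ∈ (Set.univ : Set (Option D)) := Set.mem_univ _
    rw [← this] at hx
    simp at hx
  · intro h s _ ⟨x, hx⟩
    rw [Set.eq_univ_iff_forall]
    intro y
    rwa [Subsingleton.elim y x]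

/-- The new dart ties `b` and `c` together and does nothing else: its membership in an invariant set
is forced by theirs. -/
theorem conn_insert_some_some [DecidableEq D] (R L : Perm D) (b c : D) :
    Conn (insertR R (some b) (some c)) (insertL L (some b)) ↔ ConnVia R L b c := by
  constructor
  · intro h s hs hbc ⟨x, hx⟩
    have := h {y | y.elim (b ∈ s) (· ∈ s)}
      (isInvariant_insert.2 ⟨hs, Iff.rfl, hbc⟩) ⟨some x, hx⟩
    rw [Set.eq_univ_iff_forall] at this ⊢
    exact fun y => this (some y)
  · intro h s hs hn
    rw [isInvariant_insert] at hs
    obtain ⟨hs, hb, hc⟩ := hs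
    have hne : (some ⁻¹' s).Nonempty := by
      obtain ⟨x, hx⟩ := hn
      cases x with
      | none => exact ⟨b, hb.1 hx⟩
      | some x => exact ⟨x, hx⟩
    have := Set.eq_univ_iff_forall.1 (h _ hs (hb.symm.trans hc) hne)
    rw [Set.eq_univ_iff_forall]
    rintro (_ | x)
    exacts [hb.2 (this b), this x]

theorem conn_insert_none_some [DecidableEq D] (R L : Perm D) (c : D) :
    Conn (insertR R none (some c)) (insertL L none) ↔ Conn R L := by
  constructor
  · intro h s hs ⟨x, hx⟩
    have := h {y | y.elim (c ∈ s) (· ∈ s)}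
      (isInvariant_insert.2 ⟨hs, Iff.rfl, Iff.rfl⟩) ⟨some x, hx⟩
    rw [Set.eq_univ_iff_forall] at this ⊢
    exact fun y => this (some y)
  · intro h s hs hn
    rw [isInvariant_insert] at hs
    obtain ⟨hs, -, hc⟩ := hs
    have hne : (some ⁻¹' s).Nonempty := by
      obtain ⟨x, hx⟩ := hn
      cases x with
      | none => exact ⟨c, hc.1 hx⟩
      | some x => exact ⟨x, hx⟩
    have := Set.eq_univ_iff_forall.1 (h _ hs hne)
    rw [Set.eq_univ_iff_forall]
    rintro (_ | x)
    exacts [hc.2 (this c), this x]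

theorem conn_insert_some_none [DecidableEq D] (R L : Perm D) (b : D) :
    Conn (insertR R (some b) none) (insertL L (some b)) ↔ Conn R L := by
  constructor
  · intro h s hs ⟨x, hx⟩
    have := h {y | y.elim (b ∈ s) (· ∈ s)}
      (isInvariant_insert.2 ⟨hs, Iff.rfl, Iff.rfl⟩) ⟨some x, hx⟩
    rw [Set.eq_univ_iff_forall] at this ⊢
    exact fun y => this (some y)
  · intro h s hs hn
    rw [isInvariant_insert] at hs
    obtain ⟨hs, hb, -⟩ := hs
    have hne : (some ⁻¹' s).Nonempty := by
      obtain ⟨x, hx⟩ := hn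
      cases x with
      | none => exact ⟨b, hb.1 hx⟩
      | some x => exact ⟨x, hx⟩
    have := Set.eq_univ_iff_forall.1 (h _ hs hne)
    rw [Set.eq_univ_iff_forall]
    rintro (_ | x)
    exacts [hb.2 (this b), this x]

/-- `A` and its complement are the orbits of `b` and `c`. -/
structure IsSplit (R L : Perm D) (b c : D) (A : Set D) : Prop where
  inv : IsInvariant R L A
  left_mem : b ∈ A
  right_notMem : c ∉ A
  left_conn : ∀ s ⊆ A, IsInvariant R L s → s.Nonempty → s = A
  right_conn : ∀ s ⊆ Aᶜ, IsInvariant R L s → s.Nonempty → s = Aᶜ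

theorem IsSplit.unique {R L : Perm D} {b c : D} {A A' : Set D} (h : IsSplit R L b c A)
    (h' : IsSplit R L b c A') : A = A' := by
  have h1 := h.left_conn (A ∩ A') Set.inter_subset_left (h.inv.inter h'.inv)
    ⟨b, h.left_mem, h'.left_mem⟩
  have h2 := h'.left_conn (A ∩ A') Set.inter_subset_right (h.inv.inter h'.inv)
    ⟨b, h.left_mem, h'.left_mem⟩
  exact h1.symm.trans h2

/-- A nonempty invariant set meets `A` or its complement and therefore fills that part, so it
contains `b` or `c`. If it contains both, it fills both parts. -/
theorem IsSplit.connVia {R L : Perm D} {b c : D} {A : Set D} (h : IsSplit R L b c A) :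
    ConnVia R L b c := by
  intro s hs hbc hn
  have hb : b ∈ s := by
    by_contra hb
    have hc : c ∉ s := fun hc => hb (hbc.2 hc)
    have h1 : ¬ (s ∩ A).Nonempty := fun hn => by
      have := h.left_conn _ Set.inter_subset_right (hs.inter h.inv) hn
      have hm := h.left_mem
      rw [← this] at hm
      exact hb hm.1
    have h2 : ¬ (s ∩ Aᶜ).Nonempty := fun hn => by
      have := h.right_conn _ Set.inter_subset_right (hs.inter h.inv.compl) hn
      have hm : c ∈ Aᶜ := h.right_notMem
      rw [← this] at hm
      exact hc hm.1
    obtain ⟨x, hx⟩ := hn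
    by_cases hA : x ∈ A
    · exact h1 ⟨x, hx, hA⟩
    · exact h2 ⟨x, hx, hA⟩
  have h1 := h.left_conn _ Set.inter_subset_right (hs.inter h.inv) ⟨b, hb, h.left_mem⟩
  have h2 := h.right_conn _ Set.inter_subset_right (hs.inter h.inv.compl)
    ⟨c, hbc.1 hb, h.right_notMem⟩
  rw [Set.eq_univ_iff_forall]
  intro x
  by_cases hA : x ∈ A
  · rw [← h1] at hA; exact hA.1
  · have hA' : x ∈ Aᶜ := hA
    rw [← h2] at hA'; exact hA'.1

theorem IsSplit.not_conn {R L : Perm D} {b c : D} {A : Set D} (h : IsSplit R L b c A) :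
    ¬ Conn R L := fun hc => by
  have := hc A h.inv ⟨b, h.left_mem⟩
  exact h.right_notMem (this ▸ Set.mem_univ c)

/-- The set `A` is the orbit of `b`, described as the intersection of all invariant sets that
contain `b`. -/
theorem ConnVia.exists_isSplit {R L : Perm D} {b c : D} (h : ConnVia R L b c)
    (hn : ¬ Conn R L) : ∃ A, IsSplit R L b c A := by
  set A : Set D := {x | ∀ s, IsInvariant R L s → b ∈ s → x ∈ s} with hA
  have hAle : ∀ s, IsInvariant R L s → b ∈ s → A ⊆ s := fun s hs hb x hx => hx s hs hb
  have hinv : IsInvariant R L A :=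
    ⟨fun x => forall_congr' fun s => forall_congr' fun hs => imp_congr_right fun _ => hs.1 x,
      fun x => forall_congr' fun s => forall_congr' fun hs => imp_congr_right fun _ => hs.2 x⟩
  have hb : b ∈ A := fun s _ hb => hb
  -- If `c` were in the orbit of `b`, no invariant set could separate them: one containing `b`
  -- contains the orbit, and one containing only `c` has a complement containing the orbit. The map
  -- would then be connected.
  have hc : c ∉ A := fun hc => hn fun s hs hne => h s hs
    ⟨fun hb => hAle s hs hb hc, fun hcs => by
      by_contra hbs
      exact hAle _ hs.compl hbs hc hcs⟩ hne
  refine ⟨A, hinv, hb, hc, fun s hsA hs hne => ?_, fun s hsA hs hne => ?_⟩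
  · by_cases hbs : b ∈ s
    · exact hsA.antisymm (hAle s hs hbs)
    · obtain ⟨x, hx⟩ := hne
      exact (hAle _ hs.compl hbs (hsA hx) hx).elim
  · by_cases hcs : c ∈ s
    · have := h (s ∪ A) (hs.union hinv) ⟨fun _ => Or.inl hcs, fun _ => Or.inr hb⟩ ⟨c, Or.inl hcs⟩
      refine hsA.antisymm fun x hx => ?_
      have hx' := Set.eq_univ_iff_forall.1 this x
      exact hx'.resolve_right hx
    · have hbs : b ∉ s := fun hbs => hsA hbs hb
      have := h s hs ⟨fun h => (hbs h).elim, fun h => (hcs h).elim⟩ hne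
      exact (hbs (this ▸ Set.mem_univ b)).elim

end Connected

/-! ### Separation into two connected parts -/

section Separation

variable {D : Type}

/-- Invariant subsets of an invariant part are the invariant sets of the restricted permutations, so
the minimality conditions in `IsSplit` are connectedness of the two restrictions. -/
theorem forall_subset_iff_conn {P : D → Prop} {R L : Perm D} {R₁ L₁ : Perm {x // P x}}
    (hR : ∀ x, P (R x) ↔ P x) (hL : ∀ x, P (L x) ↔ P x)
    (hR₁ : ∀ x : {x // P x}, R x = R₁ x) (hL₁ : ∀ x : {x // P x}, L x = L₁ x) :
    (∀ s ⊆ {x | P x}, IsInvariant R L s → s.Nonempty → s = {x | P x}) ↔ Conn R₁ L₁ := by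
  constructor
  · intro h t ht ⟨y, hy⟩
    have := h (Subtype.val '' t) (by rintro _ ⟨x, -, rfl⟩; exact x.2) ⟨?_, ?_⟩ ⟨_, y, hy, rfl⟩
    · rw [Set.eq_univ_iff_forall]
      intro x
      have hx : (x : D) ∈ {x | P x} := x.2
      rw [← this] at hx
      obtain ⟨z, hz, hzx⟩ := hx
      rwa [← Subtype.ext hzx]
    · intro x
      by_cases hx : P x
      · lift x to {x // P x} using hx
        rw [hR₁, Subtype.val_injective.mem_set_image, Subtype.val_injective.mem_set_image, ht.1]
      · refine iff_of_false ?_ ?_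
        · rintro ⟨z, -, hz⟩
          exact hx ((hR x).1 (hz ▸ z.2))
        · rintro ⟨z, -, rfl⟩
          exact hx z.2
    · intro x
      by_cases hx : P x
      · lift x to {x // P x} using hx
        rw [hL₁, Subtype.val_injective.mem_set_image, Subtype.val_injective.mem_set_image, ht.2]
      · refine iff_of_false ?_ ?_
        · rintro ⟨z, -, hz⟩
          exact hx ((hL x).1 (hz ▸ z.2))
        · rintro ⟨z, -, rfl⟩
          exact hx z.2
  · intro h s hsP hs ⟨x, hx⟩
    have := h (Subtype.val ⁻¹' s) ⟨fun x => by simpa [hR₁] using hs.1 x,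
      fun x => by simpa [hL₁] using hs.2 x⟩ ⟨⟨x, hsP hx⟩, hx⟩
    refine hsP.antisymm fun y hy => ?_
    exact Set.eq_univ_iff_forall.1 this ⟨y, hy⟩

variable (P : D → Prop) [DecidablePred P] (R₁ L₁ : Perm {x // P x}) (R₂ L₂ : Perm {x // ¬ P x})

theorem subtypeCongr_mem_iff (x : D) : P (R₁.subtypeCongr R₂ x) ↔ P x := by
  by_cases hx : P x
  · simp [hx, Perm.subtypeCongr.left_apply, (R₁ ⟨x, hx⟩).2]
  · simp [hx, Perm.subtypeCongr.right_apply, (R₂ ⟨x, hx⟩).2]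

theorem subtypeCongr_mul :
    R₁.subtypeCongr R₂ * L₁.subtypeCongr L₂ = (R₁ * L₁).subtypeCongr (R₂ * L₂) :=
  Perm.subtypeCongr.trans _ _ _ _

theorem cycleCount_subtypeCongr [Finite D] :
    cycleCount (R₁.subtypeCongr R₂) = cycleCount R₁ + cycleCount R₂ := by
  rw [Perm.subtypeCongr, cycleCount_permCongr]
  exact cycleCount_sumCongr R₁ R₂

theorem isSplit_subtypeCongr {b c : D} :
    IsSplit (R₁.subtypeCongr R₂) (L₁.subtypeCongr L₂) b c {x | P x} ↔
      P b ∧ ¬ P c ∧ Conn R₁ L₁ ∧ Conn R₂ L₂ := by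
  have h1 := forall_subset_iff_conn (subtypeCongr_mem_iff P R₁ R₂) (subtypeCongr_mem_iff P L₁ L₂)
    (fun x => Perm.subtypeCongr.left_apply_subtype R₁ R₂ x)
    (fun x => Perm.subtypeCongr.left_apply_subtype L₁ L₂ x)
  have h2 := forall_subset_iff_conn (P := fun x => ¬ P x)
    (fun x => not_congr (subtypeCongr_mem_iff P R₁ R₂ x))
    (fun x => not_congr (subtypeCongr_mem_iff P L₁ L₂ x))
    (fun x => Perm.subtypeCongr.right_apply_subtype R₁ R₂ x)
    (fun x => Perm.subtypeCongr.right_apply_subtype L₁ L₂ x)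
  constructor
  · intro h
    exact ⟨h.left_mem, h.right_notMem, h1.1 h.left_conn, h2.1 h.right_conn⟩
  · rintro ⟨hb, hc, hR, hL⟩
    exact ⟨⟨subtypeCongr_mem_iff P R₁ R₂, subtypeCongr_mem_iff P L₁ L₂⟩, hb, hc,
      h1.2 hR, h2.2 hL⟩

theorem exists_subtypeCongr {R : Perm D} (hR : ∀ x, P (R x) ↔ P x) :
    ∃ (R₁ : Perm {x // P x}) (R₂ : Perm {x // ¬ P x}), R₁.subtypeCongr R₂ = R := by
  refine ⟨R.subtypePerm fun x => hR x, R.subtypePerm fun x => not_congr (hR x), ?_⟩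
  ext x
  by_cases hx : P x
  · simp [hx, Perm.subtypeCongr.left_apply]
  · simp [hx, Perm.subtypeCongr.right_apply]

theorem subtypeCongr_injective : Function.Injective
    fun s : Perm {x // P x} × Perm {x // ¬ P x} => s.1.subtypeCongr s.2 :=
  Perm.subtypeCongrHom_injective P

theorem sum_perm_ite [Fintype D] [DecidableEq D] [Fintype {x // P x}] [Fintype {x // ¬ P x}]
    [DecidablePred fun R : Perm D => ∀ x, P (R x) ↔ P x] {K : Type*} [AddCommMonoid K]
    (F : Perm D → K) :
    ∑ R : Perm D, (if ∀ x, P (R x) ↔ P x then F R else 0) =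
      ∑ R₁ : Perm {x // P x}, ∑ R₂ : Perm {x // ¬ P x}, F (R₁.subtypeCongr R₂) := by
  rw [← Finset.sum_filter, ← Fintype.sum_prod_type']
  symm
  refine Finset.sum_bij (fun s _ => s.1.subtypeCongr s.2) ?_ ?_ ?_ ?_
  · intro s _
    simpa using subtypeCongr_mem_iff P s.1 s.2
  · intro s _ s' _ h
    exact subtypeCongr_injective P h
  · intro R hR
    obtain ⟨R₁, R₂, h⟩ := exists_subtypeCongr P (R := R) (by simpa using hR)
    exact ⟨(R₁, R₂), Finset.mem_univ _, h⟩
  · intro s _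
    rfl

theorem card_add_card_not [Finite D] :
    Nat.card {x // P x} + Nat.card {x // ¬ P x} = Nat.card D := by
  rw [← Nat.card_sum, Nat.card_congr (sumCompl P)]

end Separation

/-! ### The genus is a natural number -/

/-- The Euler characteristic relation for `R` and `L`, with genus `g`. -/
def EulerGenus {D : Type} (g : ℕ) (R L : Perm D) : Prop :=
  cycleCount R + cycleCount L + cycleCount (R * L) + 2 * g = Nat.card D + 2

theorem cycleCount_of_isEmpty {D : Type} [IsEmpty D] (p : Perm D) : cycleCount p = 0 := by
  have : IsEmpty (Quotient (SameCycle.setoid p)) :=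
    ⟨fun q => q.inductionOn fun x => isEmptyElim x⟩
  exact Nat.card_of_isEmpty

theorem eulerGenus_permCongr {D D' : Type} (e : D ≃ D') {g : ℕ} {R L : Perm D} :
    EulerGenus g (e.permCongr R) (e.permCongr L) ↔ EulerGenus g R L := by
  have : e.permCongr R * e.permCongr L = e.permCongr (R * L) :=
    (map_mul e.permCongrHom R L).symm
  rw [EulerGenus, EulerGenus, this, cycleCount_permCongr, cycleCount_permCongr,
    cycleCount_permCongr, Nat.card_congr e]

/-- Induction on the number of darts, removing one dart. The genus is 0 for a single dart, is
unchanged when `b` or `c` is `none` or when both are in one vertex, rises by one when two vertices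
of a connected map are merged, and is the sum of the two genera when the merging joins two
components. The last case needs strong induction, as both components are smaller. -/
theorem Conn.exists_eulerGenus {D : Type} [Finite D] [Nonempty D] {R L : Perm D}
    (h : Conn R L) : ∃ g, EulerGenus g R L := by
  classical
  obtain ⟨n, hn⟩ : ∃ n, Nat.card D = n := ⟨_, rfl⟩
  induction n using Nat.strong_induction_on generalizing D with | _ n ih => ?_
  obtain ⟨a⟩ := ‹Nonempty D›
  set D' := {x : D // x ≠ a}
  let e : D ≃ Option D' := (optionSubtypeNe a).symm
  have hcard : Nat.card D = Nat.card D' + 1 := by rw [Nat.card_congr e, Finite.card_option]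
  obtain ⟨⟨⟨R', L'⟩, ⟨b, c⟩⟩, hRL⟩ :=
    insert_bijective.surjective (e.permCongr R, e.permCongr L)
  simp only [Prod.mk.injEq] at hRL
  have h' := (conn_permCongr e R L).2 h
  simp_rw [← eulerGenus_permCongr e]
  rw [← hRL.1, ← hRL.2] at h' ⊢
  unfold EulerGenus at ih ⊢
  simp_rw [Finite.card_option]
  have hind : ∀ _ : Conn R' L', Nonempty D' → ∃ g, cycleCount R' + cycleCount L' +
      cycleCount (R' * L') + 2 * g = Nat.card D' + 2 :=
    fun hc _ => ih (Nat.card D') (by omega) hc rfl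
  rcases b with _ | b <;> rcases c with _ | c
  · rw [conn_insert_none_none] at h'
    refine ⟨0, ?_⟩
    rw [cycleCount_insert_mul_none, cycleCount_insertL_none, insertR_none_none,
      cycleCount_optPerm, cycleCount_of_isEmpty, cycleCount_of_isEmpty, cycleCount_of_isEmpty,
      Nat.card_of_isEmpty]
  · rw [conn_insert_none_some] at h'
    obtain ⟨g, hg⟩ := hind h' ⟨c⟩
    refine ⟨g, ?_⟩
    rw [cycleCount_insert_mul_some, cycleCount_insertL_none, insertR_none_some,
      cycleCount_optPerm_mul_swap]
    omega
  · rw [conn_insert_some_none] at h'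
    obtain ⟨g, hg⟩ := hind h' ⟨b⟩
    refine ⟨g, ?_⟩
    rw [cycleCount_insert_mul_none, cycleCount_insertL_some, insertR_some_none,
      cycleCount_optPerm_mul_swap]
    omega
  · rw [conn_insert_some_some] at h'
    rw [cycleCount_insert_mul_some, cycleCount_insertL_some]
    by_cases hbc : R'.SameCycle c b
    · obtain ⟨g, hg⟩ := hind (h'.conn hbc) ⟨b⟩
      refine ⟨g, ?_⟩
      rw [cycleCount_insertR_of_sameCycle hbc]
      omega
    have hm := cycleCount_insertR_of_not_sameCycle hbc
    by_cases hc : Conn R' L'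
    · obtain ⟨g, hg⟩ := hind hc ⟨b⟩
      exact ⟨g + 1, by omega⟩
    · obtain ⟨A, hA⟩ := h'.exists_isSplit hc
      obtain ⟨R₁, R₂, rfl⟩ := exists_subtypeCongr (· ∈ A) hA.inv.1
      obtain ⟨L₁, L₂, rfl⟩ := exists_subtypeCongr (· ∈ A) hA.inv.2
      obtain ⟨hb, hc, h1, h2⟩ := (isSplit_subtypeCongr (· ∈ A) R₁ L₁ R₂ L₂).1 hA
      have : Nonempty {x // x ∈ A} := ⟨⟨b, hb⟩⟩
      have : Nonempty {x // x ∉ A} := ⟨⟨c, hc⟩⟩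
      have hsum := card_add_card_not (· ∈ A)
      obtain ⟨g₁, hg₁⟩ := ih (Nat.card {x // x ∈ A}) (by omega) h1 rfl
      obtain ⟨g₂, hg₂⟩ := ih (Nat.card {x // x ∉ A}) (by omega) h2 rfl
      refine ⟨g₁ + g₂, ?_⟩
      rw [subtypeCongr_mul, cycleCount_subtypeCongr, cycleCount_subtypeCongr]
      rw [cycleCount_subtypeCongr] at hm
      omega

/-! ### Weighted sums over labelled rooted hypermaps -/

section MapSum

variable {D ι κ K : Type} [CommRing K]

/-- The function on `Option κ` with the value `a` at `none` that extends `f`. -/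
def optCons {α : Type} (a : α) (f : κ → α) : Option κ → α := fun o => o.elim a f

@[simp] theorem optCons_none {α : Type} (a : α) (f : κ → α) : optCons a f none = a := rfl

@[simp] theorem optCons_some {α : Type} (a : α) (f : κ → α) (i : κ) :
    optCons a f (some i) = f i := rfl

theorem comp_optCons {α β : Type} (g : α → β) (a : α) (f : κ → α) :
    g ∘ optCons a f = optCons (g a) (g ∘ f) := by
  funext o
  cases o <;> rfl

theorem sum_optCons {α : Type} [Fintype α] [Fintype κ] [DecidableEq κ] (F : (Option κ → α) → K) :
    ∑ r, F r = ∑ a, ∑ f, F (optCons a f) := by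
  rw [← Fintype.sum_prod_type']
  refine Fintype.sum_equiv (Equiv.piOptionEquivProd (β := fun _ => α)) _ _ fun r => ?_
  congr 1
  funext o
  cases o <;> rfl

def RootsDistinct (R : Perm D) (r : ι → D) : Prop :=
  ∀ i j, i ≠ j → ¬ R.SameCycle (r i) (r j)

theorem rootsDistinct_optCons {R : Perm D} {a : D} {f : κ → D} :
    RootsDistinct R (optCons a f) ↔ (∀ i, ¬ R.SameCycle a (f i)) ∧ RootsDistinct R f := by
  constructor
  · intro h
    exact ⟨fun i => h none (some i) (by simp), fun i j hij => h (some i) (some j) (by simpa)⟩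
  · rintro ⟨h1, h2⟩ (_ | i) (_ | j) hij
    · exact (hij rfl).elim
    · exact h1 j
    · exact fun h => h1 i h.symm
    · exact h2 i j fun e => hij (congrArg some e)

theorem rootsDistinct_permCongr {D' : Type} (e : D ≃ D') {R : Perm D} {r : ι → D} :
    RootsDistinct (e.permCongr R) (e ∘ r) ↔ RootsDistinct R r := by
  simp [RootsDistinct, sameCycle_permCongr]

theorem rootsDistinct_comp {ι' : Type} (e : ι ≃ ι') {R : Perm D} {r : ι' → D} :
    RootsDistinct R (r ∘ e) ↔ RootsDistinct R r := by
  constructor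
  · intro h i j hij
    have := h (e.symm i) (e.symm j) (by simpa)
    simpa using this
  · intro h i j hij
    exact h _ _ (by simpa)

/-- The contribution of the root vertices. -/
noncomputable def rootWeight [Fintype ι] (R : Perm D) (r : ι → D) (v : ι → K) : K :=
  ∏ i, v i ^ cycleDegree R (r i)

theorem rootWeight_optCons [Fintype κ] (R : Perm D) (a : D) (f : κ → D) (v : K) (w : κ → K) :
    rootWeight R (optCons a f) (optCons v w) = v ^ cycleDegree R a * rootWeight R f w := by
  simp [rootWeight, Fintype.prod_option]

/-- The contribution of the faces, the hyperedges and the vertices, one vertex not counted. -/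
noncomputable def weight (R L : Perm D) (x y u : K) : K :=
  x ^ cycleCount (R * L) * y ^ cycleCount L * u ^ (cycleCount R - 1)

/-- The conditions on a labelled rooted hypermap of genus `g`. -/
structure IsRooted (g : ℕ) (R L : Perm D) (r : ι → D) : Prop where
  conn : Conn R L
  genus : EulerGenus g R L
  roots : RootsDistinct R r

open scoped Classical in
/-- The weight of a labelled rooted hypermap of genus `g`. -/
noncomputable def mapTerm [Fintype ι] (g : ℕ) (R L : Perm D) (r : ι → D) (v : ι → K)
    (x y u : K) : K :=
  if IsRooted g R L r then rootWeight R r v * weight R L x y u else 0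

theorem mapTerm_of_isRooted [Fintype ι] {g : ℕ} {R L : Perm D} {r : ι → D} (h : IsRooted g R L r)
    (v : ι → K) (x y u : K) :
    mapTerm g R L r v x y u = rootWeight R r v * weight R L x y u := if_pos h

theorem mapTerm_of_not_isRooted [Fintype ι] {g : ℕ} {R L : Perm D} {r : ι → D}
    (h : ¬ IsRooted g R L r) (v : ι → K) (x y u : K) : mapTerm g R L r v x y u = 0 := if_neg h

/-- The weighted sum over the rooted hypermaps of genus `g` with the set of darts `D`. -/
noncomputable def mapSum (g : ℕ) (D : Type) [Fintype D] [DecidableEq D] [Fintype ι] [DecidableEq ι]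
    (v : ι → K) (x y u : K) : K :=
  ∑ R : Perm D, ∑ L : Perm D, ∑ r : ι → D, mapTerm g R L r v x y u

theorem mapTerm_permCongr [Fintype ι] {D' : Type} (e : D ≃ D') (g : ℕ) (R L : Perm D) (r : ι → D)
    (v : ι → K) (x y u : K) :
    mapTerm g (e.permCongr R) (e.permCongr L) (e ∘ r) v x y u = mapTerm g R L r v x y u := by
  have hmul : e.permCongr R * e.permCongr L = e.permCongr (R * L) :=
    (map_mul e.permCongrHom R L).symm
  have h : IsRooted g (e.permCongr R) (e.permCongr L) (e ∘ r) ↔ IsRooted g R L r := by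
    constructor
    · rintro ⟨h1, h2, h3⟩
      exact ⟨(conn_permCongr e R L).1 h1, (eulerGenus_permCongr e).1 h2,
        (rootsDistinct_permCongr e).1 h3⟩
    · rintro ⟨h1, h2, h3⟩
      exact ⟨(conn_permCongr e R L).2 h1, (eulerGenus_permCongr e).2 h2,
        (rootsDistinct_permCongr e).2 h3⟩
  have hw : rootWeight (e.permCongr R) (e ∘ r) v * weight (e.permCongr R) (e.permCongr L) x y u =
      rootWeight R r v * weight R L x y u := by
    simp only [rootWeight, weight, hmul, cycleCount_permCongr, cycleDegree_permCongr,
      Function.comp_apply]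
  classical exact if_congr h hw rfl

variable [Fintype D] [DecidableEq D] [Fintype ι] [DecidableEq ι] [Fintype κ] [DecidableEq κ]

theorem mapSum_congr_dart {D' : Type} [Fintype D'] [DecidableEq D'] (e : D ≃ D') (g : ℕ)
    (v : ι → K) (x y u : K) : mapSum g D v x y u = mapSum g D' v x y u := by
  refine Fintype.sum_equiv e.permCongr _ _ fun R => ?_
  refine Fintype.sum_equiv e.permCongr _ _ fun L => ?_
  refine Fintype.sum_equiv (Equiv.arrowCongr (Equiv.refl ι) e) _ _ fun r => ?_
  exact (mapTerm_permCongr e g R L r v x y u).symm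

theorem mapSum_congr_index {ι' : Type} [Fintype ι'] [DecidableEq ι'] (e : ι ≃ ι') (g : ℕ)
    (v : ι' → K) (x y u : K) : mapSum g D (v ∘ e) x y u = mapSum g D v x y u := by
  refine Finset.sum_congr rfl fun R _ => Finset.sum_congr rfl fun L _ => ?_
  refine (Fintype.sum_equiv (Equiv.arrowCongr e.symm (Equiv.refl D)) _ _ fun r => ?_).symm
  have hr : (Equiv.arrowCongr e.symm (Equiv.refl D)) r = r ∘ e := rfl
  have h : IsRooted g R L (r ∘ e) ↔ IsRooted g R L r :=
    ⟨fun ⟨h1, h2, h3⟩ => ⟨h1, h2, (rootsDistinct_comp e).1 h3⟩,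
      fun ⟨h1, h2, h3⟩ => ⟨h1, h2, (rootsDistinct_comp e).2 h3⟩⟩
  have hw : rootWeight R (r ∘ e) (v ∘ e) = rootWeight R r v :=
    Fintype.prod_equiv e _ _ fun _ => rfl
  rw [hr]
  classical exact if_congr h.symm (by rw [hw]) rfl

/-- Replacing `L` by `(R * L)⁻¹` exchanges faces and hyperedges up to inversion. It keeps the
vertices and the roots, and `R` with the new permutation has the same invariant sets. -/
theorem mapSum_dual (g : ℕ) (v : ι → K) (x y u : K) :
    mapSum g D v x y u = mapSum g D v y x u := by
  refine Finset.sum_congr rfl fun R _ => ?_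
  refine Fintype.sum_equiv ((Equiv.mulLeft R).trans (Equiv.inv _)) _ _ fun L => ?_
  refine Finset.sum_congr rfl fun r _ => ?_
  have hL : ((Equiv.mulLeft R).trans (Equiv.inv _)) L = (R * L)⁻¹ := rfl
  have h1 : cycleCount (R * (R * L)⁻¹) = cycleCount L := by
    rw [mul_inv_rev, ← mul_assoc, cycleCount_conj, cycleCount_inv]
  have hinv : ∀ s : Set D, IsInvariant R (R * L)⁻¹ s ↔ IsInvariant R L s := by
    intro s
    constructor
    · rintro ⟨hR, hL⟩
      refine ⟨hR, fun x => ?_⟩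
      have := hL ((R * L) x)
      rw [← Perm.mul_apply, inv_mul_cancel, Perm.one_apply, Perm.mul_apply, hR] at this
      exact this.symm
    · rintro ⟨hR, hL⟩
      refine ⟨hR, fun x => ?_⟩
      have h1 := hR (L ((R * L)⁻¹ x))
      rw [hL, ← Perm.mul_apply, ← Perm.mul_apply, mul_inv_cancel, Perm.one_apply] at h1
      exact h1.symm
  have h : IsRooted g R (R * L)⁻¹ r ↔ IsRooted g R L r := by
    have hc : Conn R (R * L)⁻¹ ↔ Conn R L :=
      forall_congr' fun s => imp_congr_left (hinv s)
    have hg : EulerGenus g R (R * L)⁻¹ ↔ EulerGenus g R L := by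
      rw [EulerGenus, EulerGenus, h1, cycleCount_inv, add_right_comm (cycleCount R)]
    exact ⟨fun ⟨a, b, c⟩ => ⟨hc.1 a, hg.1 b, c⟩, fun ⟨a, b, c⟩ => ⟨hc.2 a, hg.2 b, c⟩⟩
  rw [hL]
  classical exact if_congr h.symm (by simp only [weight, h1, cycleCount_inv, mul_comm (y ^ _)]) rfl

theorem mapSum_of_isEmpty [IsEmpty D] [Nonempty ι] (g : ℕ) (v : ι → K) (x y u : K) :
    mapSum g D v x y u = 0 := by
  refine Finset.sum_eq_zero fun R _ => Finset.sum_eq_zero fun L _ =>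
    Finset.sum_eq_zero fun r _ => ?_
  exact isEmptyElim (r (Classical.arbitrary ι))

/-- The contribution of a hypermap, rooted at `none`, with all other roots different from `none`. -/
noncomputable def insertTerm (g : ℕ) (R L : Perm D) (b c : Option D) (r : κ → D) (v : K)
    (w : κ → K) (x y u : K) : K :=
  mapTerm g (insertR R b c) (insertL L b) (optCons none (some ∘ r)) (optCons v w) x y u

theorem sum_some_comp {α : Type} [Fintype α] (F : (κ → Option α) → K)
    (hF : ∀ r i, r i = none → F r = 0) : ∑ r, F r = ∑ r : κ → α, F (some ∘ r) := by
  symm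
  refine Finset.sum_of_injOn (fun r => some ∘ r) ?_ (fun _ _ => Finset.mem_coe.2 (Finset.mem_univ _))
    ?_ fun _ _ => rfl
  · intro r _ r' _ h
    exact (Option.some_injective α).comp_left h
  · intro r _ hr
    by_contra hne
    have h : ∀ i, ∃ a, r i = some a := fun i => Option.ne_none_iff_exists'.1 fun hi => hne (hF r i hi)
    choose f hf using h
    exact hr ⟨f, by simp, funext fun i => (hf i).symm⟩

/-- Conjugation by a transposition moves the first root to `none`, so all of the `card D + 1`
possible positions contribute equally. With the root at `none`, the pairs of permutations are
parametrised by insertions. -/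
theorem mapSum_option (g : ℕ) (v : K) (w : κ → K) (x y u : K) :
    mapSum g (Option D) (optCons v w) x y u = (Fintype.card D + 1 : ℕ) *
      ∑ R : Perm D, ∑ L : Perm D, ∑ b : Option D, ∑ c : Option D, ∑ r : κ → D,
        insertTerm g R L b c r v w x y u := by
  have h1 : mapSum g (Option D) (optCons v w) x y u = ∑ a : Option D,
      ∑ R : Perm (Option D), ∑ L : Perm (Option D), ∑ r : κ → Option D,
        mapTerm g R L (optCons a r) (optCons v w) x y u := by
    simp only [mapSum, sum_optCons]
    conv_rhs => rw [Finset.sum_comm]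
    refine Finset.sum_congr rfl fun R _ => ?_
    rw [Finset.sum_comm]
  have h2 : ∀ a : Option D, ∑ R : Perm (Option D), ∑ L : Perm (Option D), ∑ r : κ → Option D,
        mapTerm g R L (optCons a r) (optCons v w) x y u =
      ∑ R : Perm (Option D), ∑ L : Perm (Option D), ∑ r : κ → Option D,
        mapTerm g R L (optCons none r) (optCons v w) x y u := by
    intro a
    set e : Perm (Option D) := swap none a
    have he : e none = a := swap_apply_left _ _
    refine (Fintype.sum_equiv e.permCongr _ _ fun R => ?_).symm
    refine Fintype.sum_equiv e.permCongr _ _ fun L => ?_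
    refine Fintype.sum_equiv (Equiv.arrowCongr (Equiv.refl κ) e) _ _ fun r => ?_
    rw [← mapTerm_permCongr e g R L, comp_optCons, he]
    rfl
  rw [h1, Finset.sum_congr rfl fun a _ => h2 a, Finset.sum_const, Finset.card_univ,
    Fintype.card_option, nsmul_eq_mul]
  congr 1
  -- Another root at `none` would share its vertex with the first root, so such sequences have
  -- weight zero.
  have h3 : ∀ R L : Perm (Option D), ∑ r : κ → Option D,
      mapTerm g R L (optCons none r) (optCons v w) x y u =
      ∑ r : κ → D, mapTerm g R L (optCons none (some ∘ r)) (optCons v w) x y u := by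
    intro R L
    refine sum_some_comp _ fun r i hi => if_neg fun h => ?_
    refine h.roots none (some i) (by simp) ?_
    rw [optCons_some, hi, optCons_none]
  simp only [h3]
  rw [← Fintype.sum_prod_type', ← Function.Bijective.sum_comp insert_bijective,
    Fintype.sum_prod_type, Fintype.sum_prod_type]
  refine Finset.sum_congr rfl fun R _ => Finset.sum_congr rfl fun L _ => ?_
  rw [Fintype.sum_prod_type]
  rfl

end MapSum

/-! ### Removal of the root dart -/

section Removal

variable {D κ K : Type} [CommRing K] [Fintype D] [DecidableEq D] [Fintype κ] [DecidableEq κ]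

omit [DecidableEq κ] in
theorem cycleDegree_optPerm_swap_of_roots {R : Perm D} {c : D} {r : κ → D}
    (h : RootsDistinct R (optCons c r)) (v : K) (w : κ → K) :
    rootWeight (optPerm R * swap none (some c)) (optCons none (some ∘ r)) (optCons v w) =
      v * rootWeight R (optCons c r) (optCons v w) := by
  rw [rootWeight_optCons, rootWeight_optCons, cycleDegree_optPerm_mul_swap_none, pow_succ', mul_assoc]
  congr 2
  refine Finset.prod_congr rfl fun i _ => ?_
  rw [Function.comp_apply,
    cycleDegree_optPerm_mul_swap_some ((rootsDistinct_optCons.1 h).1 i)]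

omit [Fintype κ] [DecidableEq κ] in
theorem rootsDistinct_optPerm_swap {R : Perm D} {c : D} {r : κ → D} :
    RootsDistinct (optPerm R * swap none (some c)) (optCons none (some ∘ r)) ↔
      RootsDistinct R (optCons c r) := by
  rw [rootsDistinct_optCons, rootsDistinct_optCons]
  simp only [RootsDistinct, Function.comp_apply, sameCycle_optPerm_mul_swap_none,
    sameCycle_optPerm_mul_swap_some]

-- The new dart is a hyperedge by itself, whence `y`, and raises the degree of the root vertex by
-- one, whence `v`. With the new dart gone, `c` takes its place as first root in the same vertex. In
-- `insertTerm_some_none` the new dart creates a face instead, whence `x`.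
omit [DecidableEq κ] in
theorem insertTerm_none_some (g : ℕ) (R L : Perm D) (c : D) (r : κ → D) (v : K) (w : κ → K)
    (x y u : K) : insertTerm g R L none (some c) r v w x y u =
      v * y * mapTerm g R L (optCons c r) (optCons v w) x y u := by
  have hg : EulerGenus g (insertR R none (some c)) (insertL L none) ↔ EulerGenus g R L := by
    rw [EulerGenus, EulerGenus, cycleCount_insert_mul_some, cycleCount_insertL_none,
      insertR_none_some, cycleCount_optPerm_mul_swap, Finite.card_option]
    omega
  have h : IsRooted g (insertR R none (some c)) (insertL L none) (optCons none (some ∘ r)) ↔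
      IsRooted g R L (optCons c r) := by
    constructor
    · rintro ⟨h1, h2, h3⟩
      rw [insertR_none_some, rootsDistinct_optPerm_swap] at h3
      exact ⟨(conn_insert_none_some R L c).1 h1, hg.1 h2, h3⟩
    · rintro ⟨h1, h2, h3⟩
      refine ⟨(conn_insert_none_some R L c).2 h1, hg.2 h2, ?_⟩
      rwa [insertR_none_some, rootsDistinct_optPerm_swap]
  by_cases hr : IsRooted g R L (optCons c r)
  · rw [insertTerm, mapTerm_of_isRooted (h.2 hr), mapTerm_of_isRooted hr, weight, weight,
      cycleCount_insert_mul_some, cycleCount_insertL_none, insertR_none_some,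
      cycleCount_optPerm_mul_swap, cycleDegree_optPerm_swap_of_roots hr.roots]
    ring
  · rw [insertTerm, mapTerm_of_not_isRooted (mt h.1 hr), mapTerm_of_not_isRooted hr, mul_zero]

omit [DecidableEq κ] in
theorem insertTerm_some_none (g : ℕ) (R L : Perm D) (b : D) (r : κ → D) (v : K) (w : κ → K)
    (x y u : K) : insertTerm g R L (some b) none r v w x y u =
      v * x * mapTerm g R L (optCons b r) (optCons v w) x y u := by
  have hg : EulerGenus g (insertR R (some b) none) (insertL L (some b)) ↔ EulerGenus g R L := by
    rw [EulerGenus, EulerGenus, cycleCount_insert_mul_none, cycleCount_insertL_some,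
      insertR_some_none, cycleCount_optPerm_mul_swap, Finite.card_option]
    omega
  have h : IsRooted g (insertR R (some b) none) (insertL L (some b)) (optCons none (some ∘ r)) ↔
      IsRooted g R L (optCons b r) := by
    constructor
    · rintro ⟨h1, h2, h3⟩
      rw [insertR_some_none, rootsDistinct_optPerm_swap] at h3
      exact ⟨(conn_insert_some_none R L b).1 h1, hg.1 h2, h3⟩
    · rintro ⟨h1, h2, h3⟩
      refine ⟨(conn_insert_some_none R L b).2 h1, hg.2 h2, ?_⟩
      rwa [insertR_some_none, rootsDistinct_optPerm_swap]
  by_cases hr : IsRooted g R L (optCons b r)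
  · rw [insertTerm, mapTerm_of_isRooted (h.2 hr), mapTerm_of_isRooted hr, weight, weight,
      cycleCount_insert_mul_none, cycleCount_insertL_some, insertR_some_none,
      cycleCount_optPerm_mul_swap, cycleDegree_optPerm_swap_of_roots hr.roots]
    ring
  · rw [insertTerm, mapTerm_of_not_isRooted (mt h.1 hr), mapTerm_of_not_isRooted hr, mul_zero]

theorem sum_insertTerm_none_some (g : ℕ) (v : K) (w : κ → K) (x y u : K) :
    ∑ R : Perm D, ∑ L : Perm D, ∑ c : D, ∑ r : κ → D,
      insertTerm g R L none (some c) r v w x y u = v * y * mapSum g D (optCons v w) x y u := by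
  simp only [mapSum, sum_optCons, insertTerm_none_some, Finset.mul_sum]

theorem sum_insertTerm_some_none (g : ℕ) (v : K) (w : κ → K) (x y u : K) :
    ∑ R : Perm D, ∑ L : Perm D, ∑ b : D, ∑ r : κ → D,
      insertTerm g R L (some b) none r v w x y u = v * x * mapSum g D (optCons v w) x y u := by
  simp only [mapSum, sum_optCons, insertTerm_some_none, Finset.mul_sum]

/-- The new dart is a component by itself, so connectedness forces it to be the only dart: one
vertex of degree 1, one hyperedge, one face, genus 0, and no room for further roots. -/
theorem sum_insertTerm_none_none (g : ℕ) (v : K) (w : κ → K) (x y u : K) :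
    ∑ R : Perm D, ∑ L : Perm D, ∑ r : κ → D, insertTerm g R L none none r v w x y u =
      if Fintype.card D = 0 ∧ g = 0 ∧ Fintype.card κ = 0 then v * x * y else 0 := by
  by_cases hD : IsEmpty D
  swap
  · rw [if_neg fun h => hD (Fintype.card_eq_zero_iff.1 h.1)]
    refine Finset.sum_eq_zero fun R _ => Finset.sum_eq_zero fun L _ =>
      Finset.sum_eq_zero fun r _ => mapTerm_of_not_isRooted (fun h => hD ?_) _ _ _ _
    exact (conn_insert_none_none R L).1 h.conn
  by_cases hκ : IsEmpty κ
  swap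
  · rw [if_neg fun h => hκ (Fintype.card_eq_zero_iff.1 h.2.2)]
    obtain ⟨i⟩ := not_isEmpty_iff.1 hκ
    exact Finset.sum_eq_zero fun R _ => Finset.sum_eq_zero fun L _ =>
      Finset.sum_eq_zero fun r _ => isEmptyElim (r i)
  rw [Fintype.sum_subsingleton _ 1, Fintype.sum_subsingleton _ 1,
    Fintype.sum_subsingleton _ isEmptyElim]
  have hg : EulerGenus g (insertR (1 : Perm D) none none) (insertL 1 none) ↔ g = 0 := by
    rw [EulerGenus, cycleCount_insert_mul_none, cycleCount_insertL_none, insertR_none_none,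
      cycleCount_optPerm, Finite.card_option, cycleCount_of_isEmpty, cycleCount_of_isEmpty,
      Nat.card_of_isEmpty]
    omega
  by_cases h0 : g = 0
  · rw [if_pos ⟨Fintype.card_eq_zero, h0, Fintype.card_eq_zero⟩, insertTerm,
      mapTerm_of_isRooted ⟨(conn_insert_none_none _ _).2 hD, hg.2 h0, rootsDistinct_optCons.2
        ⟨isEmptyElim, isEmptyElim⟩⟩, rootWeight_optCons, weight, cycleCount_insert_mul_none,
      cycleCount_insertL_none, insertR_none_none, cycleCount_optPerm, cycleCount_of_isEmpty,
      cycleCount_of_isEmpty, cycleDegree_optPerm_none]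
    simp [rootWeight, mul_assoc]
  · rw [if_neg fun h => h0 h.2.1, insertTerm,
      mapTerm_of_not_isRooted fun h => h0 (hg.1 h.genus)]

/-! #### A vertex that is split -/

open scoped Classical in
/-- The weighted sum over rooted hypermaps in which a first root of degree `d` has weight `φ d`. -/
noncomputable def rootedSum (g : ℕ) (D : Type) [Fintype D] [DecidableEq D] (φ : ℕ → K) (w : κ → K)
    (x y u : K) : K :=
  ∑ R : Perm D, ∑ L : Perm D, ∑ c : D, ∑ r : κ → D,
    if IsRooted g R L (optCons c r) then
      φ (cycleDegree R c) * (rootWeight R r w * weight R L x y u) else 0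

theorem mapSum_optCons (g : ℕ) (v : K) (w : κ → K) (x y u : K) :
    mapSum g D (optCons v w) x y u = rootedSum g D (fun d => v ^ d) w x y u := by
  simp only [mapSum, sum_optCons, rootedSum, mapTerm, rootWeight_optCons, mul_assoc]

theorem mul_rootedSum (g : ℕ) (a : K) (φ : ℕ → K) (w : κ → K) (x y u : K) :
    a * rootedSum g D φ w x y u = rootedSum g D (fun d => a * φ d) w x y u := by
  simp only [rootedSum, Finset.mul_sum, mul_ite, mul_zero, mul_assoc]

theorem rootedSum_sub (g : ℕ) (φ ψ : ℕ → K) (w : κ → K) (x y u : K) :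
    rootedSum g D φ w x y u - rootedSum g D ψ w x y u =
      rootedSum g D (fun d => φ d - ψ d) w x y u := by
  simp only [rootedSum, ← Finset.sum_sub_distrib]
  refine Finset.sum_congr rfl fun R _ => Finset.sum_congr rfl fun L _ =>
    Finset.sum_congr rfl fun c _ => Finset.sum_congr rfl fun r _ => ?_
  split_ifs
  · ring
  · ring

theorem sum_split_at {α : Type} [Fintype α] (j : κ) (F : α → ({i // i ≠ j} → α) → K) :
    ∑ r : κ → α, F (r j) (fun i => r i) = ∑ a, ∑ s, F a s := by
  rw [← Fintype.sum_prod_type']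
  exact Fintype.sum_equiv (Equiv.funSplitAt j α) _ _ fun r => rfl

section Split

variable {R : Perm D} {b c : D} {r : κ → D} (h : R.SameCycle c b)

include h

-- The old vertex of `c` consists of the old darts in the two new vertices, so the vertex that is
-- split off must be free of roots too if `c` is to be the only root in their union.
omit [Fintype κ] [DecidableEq κ] in
theorem rootsDistinct_iff_insertR : RootsDistinct R (optCons c r) ↔
    RootsDistinct (insertR R (some b) (some c)) (optCons none (some ∘ r)) ∧
      ∀ j, ¬ (insertR R (some b) (some c)).SameCycle (some b) (some (r j)) := by
  rw [rootsDistinct_optCons, rootsDistinct_optCons]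
  simp only [RootsDistinct, Function.comp_apply, sameCycle_root_iff_insertR h,
    sameCycle_iff_insertR h, not_or]
  constructor
  · rintro ⟨h1, h2⟩
    exact ⟨⟨fun i => (h1 i).1, fun i j hij => (h2 i j hij).1⟩, fun i => (h1 i).2⟩
  · rintro ⟨⟨h1, h2⟩, h3⟩
    exact ⟨fun i => ⟨h1 i, h3 i⟩, fun i j hij => ⟨h2 i j hij, fun h => h.1.elim (h1 i) (h3 i)⟩⟩

-- When the split-off vertex carries the root `r j`, this root lies in the old vertex of `c` and has
-- to be forgotten; the others are then distinct from `c` in the old map precisely because they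
-- avoid both new vertices.
omit [Fintype κ] [DecidableEq κ] in
theorem rootsDistinct_insertR_iff {j : κ}
    (hj : (insertR R (some b) (some c)).SameCycle (some b) (some (r j))) :
    RootsDistinct (insertR R (some b) (some c)) (optCons none (some ∘ r)) ↔
      RootsDistinct R (optCons c fun i : {i // i ≠ j} => r i) := by
  rw [rootsDistinct_optCons, rootsDistinct_optCons]
  simp only [RootsDistinct, Function.comp_apply, sameCycle_root_iff_insertR h,
    sameCycle_iff_insertR h, not_or]
  constructor
  · rintro ⟨h1, h2⟩
    have h3 : ∀ i : {i // i ≠ j},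
        ¬ (insertR R (some b) (some c)).SameCycle (some b) (some (r i)) :=
      fun i hi => h2 i j i.2 (hi.symm.trans hj)
    exact ⟨fun i => ⟨h1 i, h3 i⟩, fun i k hik => ⟨h2 i k (fun e => hik (Subtype.ext e)),
      fun h => h.1.elim (h1 i) (h3 i)⟩⟩
  · rintro ⟨h1, h2⟩
    refine ⟨fun i hi => ?_, fun i k hik hs => ?_⟩
    · by_cases hij : i = j
      · subst hij
        exact not_sameCycle_insertR h (hi.trans hj.symm)
      · exact (h1 ⟨i, hij⟩).1 hi
    · by_cases hij : i = j
      · subst hij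
        exact (h1 ⟨k, hik.symm⟩).2 (hj.trans hs)
      by_cases hkj : k = j
      · subst hkj
        exact (h1 ⟨i, hik⟩).2 (hj.trans hs.symm)
      · exact (h2 ⟨i, hij⟩ ⟨k, hkj⟩ fun e => hik (congrArg Subtype.val e)).1 hs

-- The factor `u` counts the additional vertex. The vertex split off at `b` carries either no root
-- or exactly one root `r j`, and these alternatives exclude one another, so at most one summand is
-- nonzero.
open scoped Classical in
theorem insertTerm_of_sameCycle (g : ℕ) (L : Perm D) (v : K) (w : κ → K) (x y u : K) :
    insertTerm g R L (some b) (some c) r v w x y u = u *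
      ((if IsRooted g R L (optCons c r) then
          v ^ cycleDegree (insertR R (some b) (some c)) none *
            (rootWeight R r w * weight R L x y u) else 0) +
        ∑ j, if (insertR R (some b) (some c)).SameCycle (some b) (some (r j)) ∧
            IsRooted g R L (optCons c fun i : {i // i ≠ j} => r i) then
          v ^ cycleDegree (insertR R (some b) (some c)) none *
            w j ^ cycleDegree (insertR R (some b) (some c)) (some b) *
            (rootWeight R (fun i : {i // i ≠ j} => r i) (fun i : {i // i ≠ j} => w i) *
              weight R L x y u) else 0) := by
  have : Nonempty D := ⟨b⟩
  set N := insertR R (some b) (some c) with hN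
  have hg : EulerGenus g N (insertL L (some b)) ↔ EulerGenus g R L := by
    rw [EulerGenus, EulerGenus, hN, cycleCount_insert_mul_some, cycleCount_insertL_some,
      cycleCount_insertR_of_sameCycle h, Finite.card_option]
    omega
  have hconn : Conn N (insertL L (some b)) ↔ Conn R L :=
    (conn_insert_some_some R L b c).trans ⟨fun hc => hc.conn h, fun hc => hc.connVia b c⟩
  have hweight : weight N (insertL L (some b)) x y u = u * weight R L x y u := by
    obtain ⟨k, hk⟩ := Nat.exists_eq_succ_of_ne_zero (cycleCount_pos R).ne'
    rw [weight, weight, hN, cycleCount_insert_mul_some, cycleCount_insertL_some,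
      cycleCount_insertR_of_sameCycle h, hk]
    simp only [Nat.succ_eq_add_one, Nat.add_sub_cancel]
    ring
  by_cases hex : ∃ j, N.SameCycle (some b) (some (r j))
  swap
  · push Not at hex
    rw [Finset.sum_eq_zero fun j _ => if_neg fun hj => hex j hj.1, add_zero]
    have hroot : IsRooted g N (insertL L (some b)) (optCons none (some ∘ r)) ↔
        IsRooted g R L (optCons c r) :=
      ⟨fun ⟨h1, h2, h3⟩ => ⟨hconn.1 h1, hg.1 h2, (rootsDistinct_iff_insertR h).2 ⟨h3, hex⟩⟩,
        fun ⟨h1, h2, h3⟩ => ⟨hconn.2 h1, hg.2 h2, ((rootsDistinct_iff_insertR h).1 h3).1⟩⟩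
    by_cases hr : IsRooted g R L (optCons c r)
    · have hw : rootWeight N (some ∘ r) w = rootWeight R r w :=
        Finset.prod_congr rfl fun i _ => by
          rw [Function.comp_apply, hN,
            cycleDegree_insertR_of_sameCycle h ((rootsDistinct_optCons.1 hr.roots).1 i)]
      rw [if_pos hr, insertTerm, mapTerm_of_isRooted (hroot.2 hr), hweight, rootWeight_optCons, hw]
      ring
    · rw [if_neg hr, insertTerm, mapTerm_of_not_isRooted (mt hroot.1 hr), mul_zero]
  · obtain ⟨j, hj⟩ := hex
    have hno : ¬ IsRooted g R L (optCons c r) := fun hr =>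
      ((rootsDistinct_iff_insertR h).1 hr.roots).2 j hj
    have hroot : ∀ k, N.SameCycle (some b) (some (r k)) →
        (IsRooted g N (insertL L (some b)) (optCons none (some ∘ r)) ↔
          IsRooted g R L (optCons c fun i : {i // i ≠ k} => r i)) := fun k hk =>
      ⟨fun ⟨h1, h2, h3⟩ => ⟨hconn.1 h1, hg.1 h2, (rootsDistinct_insertR_iff h hk).1 h3⟩,
        fun ⟨h1, h2, h3⟩ => ⟨hconn.2 h1, hg.2 h2, (rootsDistinct_insertR_iff h hk).2 h3⟩⟩
    rw [if_neg hno, zero_add]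
    by_cases hr : IsRooted g N (insertL L (some b)) (optCons none (some ∘ r))
    · rw [Finset.sum_eq_single j _ (by simp), if_pos ⟨hj, (hroot j hj).1 hr⟩, insertTerm,
        mapTerm_of_isRooted hr, hweight, rootWeight_optCons]
      · have hw : rootWeight N (some ∘ r) w = w j ^ cycleDegree N (some b) *
            rootWeight R (fun i : {i // i ≠ j} => r i) (fun i : {i // i ≠ j} => w i) := by
          rw [rootWeight, Fintype.prod_eq_mul_prod_subtype_ne _ j, Function.comp_apply,
            SameCycle.cycleDegree_eq hj]
          congr 1
          refine Finset.prod_congr rfl fun i _ => ?_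
          rw [Function.comp_apply, hN, cycleDegree_insertR_of_sameCycle h
            ((rootsDistinct_optCons.1 ((hroot j hj).1 hr).roots).1 i)]
        rw [hw]
        ring
      · intro k _ hkj
        refine if_neg fun hk => ?_
        exact hr.roots (some j) (some k) (by simpa using hkj.symm) (hj.symm.trans hk.1)
    · rw [insertTerm, mapTerm_of_not_isRooted hr, Finset.sum_eq_zero, mul_zero]
      exact fun k _ => if_neg fun hk => hr ((hroot k hk.1).2 hk.2)

end Split

-- The split-off vertex does not contain `none`, so all its darts are old ones, and each of them is
-- a possible position for the root `r j`. This is the source of the factor that later becomes a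
-- derivative.
open scoped Classical in
theorem sum_sameCycle_some (N : Perm (Option D)) (b : D) (hN : ¬ N.SameCycle none (some b))
    (a : K) : ∑ d : D, (if N.SameCycle (some b) (some d) then a else 0) =
      (cycleDegree N (some b) : K) * a := by
  rw [← Finset.sum_filter, Finset.sum_const, nsmul_eq_mul]
  congr 2
  rw [cycleDegree_eq_ncard, ← Fintype.card_subtype, ← Nat.card_eq_fintype_card]
  change Set.ncard {d : D | N.SameCycle (some b) (some d)} = _
  rw [← Set.ncard_image_of_injective _ (Option.some_injective D)]
  congr 1
  ext d
  cases d with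
  | none => simpa using fun h => hN h.symm
  | some d => simp

-- A root vertex of degree `d` is cut into the new root vertex of degree `k + 1` and a vertex of
-- degree `d - k`. If the latter carries the root `j`, there are `d - k` positions for it, and its
-- degree is marked by `w j`.
open scoped Classical in
theorem sum_insertTerm_sameCycle (g : ℕ) (v : K) (w : κ → K) (x y u : K) :
    ∑ R : Perm D, ∑ L : Perm D, ∑ b : D, ∑ c : D, ∑ r : κ → D,
      (if R.SameCycle c b then insertTerm g R L (some b) (some c) r v w x y u else 0) =
    u * (rootedSum g D (fun d => ∑ k ∈ Finset.range d, v ^ (k + 1)) w x y u +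
      ∑ j, rootedSum g D
        (fun d => ∑ k ∈ Finset.range d, ((d - k : ℕ) : K) * v ^ (k + 1) * w j ^ (d - k))
        (fun i : {i // i ≠ j} => w i) x y u) := by
  have hstep : ∀ (R L : Perm D) (c : D), ∑ b : D, ∑ r : κ → D,
      (if R.SameCycle c b then insertTerm g R L (some b) (some c) r v w x y u else 0) =
    u * ((∑ r : κ → D, if IsRooted g R L (optCons c r) then
        (∑ k ∈ Finset.range (cycleDegree R c), v ^ (k + 1)) *
          (rootWeight R r w * weight R L x y u) else 0) +
      ∑ j, ∑ s : {i // i ≠ j} → D, if IsRooted g R L (optCons c s) then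
        (∑ k ∈ Finset.range (cycleDegree R c),
          ((cycleDegree R c - k : ℕ) : K) * v ^ (k + 1) * w j ^ (cycleDegree R c - k)) *
          (rootWeight R s (fun i : {i // i ≠ j} => w i) * weight R L x y u) else 0) := by
    intro R L c
    have e1 := sum_cycleDegree_insertR R c (fun k _ => v ^ k)
    have e2 := fun j => sum_cycleDegree_insertR R c (fun k l => (l : K) * v ^ k * w j ^ l)
    simp only [← e1, ← e2]
    have hb : ∀ b : D, ∑ r : κ → D,
        (if R.SameCycle c b then insertTerm g R L (some b) (some c) r v w x y u else 0) =
      u * ((∑ r : κ → D, if IsRooted g R L (optCons c r) then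
        (if R.SameCycle c b then v ^ cycleDegree (insertR R (some b) (some c)) none else 0) *
          (rootWeight R r w * weight R L x y u) else 0) +
      ∑ j, ∑ s : {i // i ≠ j} → D, if IsRooted g R L (optCons c s) then
        (if R.SameCycle c b then (cycleDegree (insertR R (some b) (some c)) (some b) : K) *
          v ^ cycleDegree (insertR R (some b) (some c)) none *
          w j ^ cycleDegree (insertR R (some b) (some c)) (some b) else 0) *
          (rootWeight R s (fun i : {i // i ≠ j} => w i) * weight R L x y u) else 0) := by
      intro b
      by_cases hcb : R.SameCycle c b
      swap
      · simp [hcb]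
      simp only [if_pos hcb, insertTerm_of_sameCycle hcb, ← Finset.mul_sum, Finset.sum_add_distrib]
      congr 2
      rw [Finset.sum_comm]
      refine Finset.sum_congr rfl fun j _ => ?_
      -- The position `a` of the root `j` is separated from the other roots `s`: the rest of the
      -- weight does not involve `a`, so the sum over `a` only counts darts.
      rw [sum_split_at j fun a s =>
        if (insertR R (some b) (some c)).SameCycle (some b) (some a) ∧
            IsRooted g R L (optCons c s) then
          v ^ cycleDegree (insertR R (some b) (some c)) none *
            w j ^ cycleDegree (insertR R (some b) (some c)) (some b) *
            (rootWeight R s (fun i : {i // i ≠ j} => w i) *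
              weight R L x y u) else 0]
      rw [Finset.sum_comm]
      refine Finset.sum_congr rfl fun s _ => ?_
      by_cases hs : IsRooted g R L (optCons c s)
      · simp only [hs, and_true, if_true]
        rw [sum_sameCycle_some _ _ (not_sameCycle_insertR hcb)]
        ring
      · simp [hs]
    simp only [hb, ← Finset.mul_sum, Finset.sum_add_distrib]
    congr 2
    · rw [Finset.sum_comm]
      refine Finset.sum_congr rfl fun r _ => ?_
      split_ifs
      · rw [Finset.sum_mul]
      · simp
    · rw [Finset.sum_comm]
      refine Finset.sum_congr rfl fun j _ => ?_
      rw [Finset.sum_comm]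
      refine Finset.sum_congr rfl fun r _ => ?_
      split_ifs
      · rw [Finset.sum_mul]
      · simp
  have hcomm : ∀ (R L : Perm D), ∑ b : D, ∑ c : D, ∑ r : κ → D,
      (if R.SameCycle c b then insertTerm g R L (some b) (some c) r v w x y u else 0) =
      ∑ c : D, ∑ b : D, ∑ r : κ → D,
      (if R.SameCycle c b then insertTerm g R L (some b) (some c) r v w x y u else 0) :=
    fun R L => by rw [Finset.sum_comm]
  simp only [hcomm, hstep, ← Finset.mul_sum, Finset.sum_add_distrib]
  congr 2
  have hj : ∀ (f : Perm D → Perm D → D → κ → K),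
      ∑ R : Perm D, ∑ L : Perm D, ∑ c : D, ∑ j : κ, f R L c j =
        ∑ j : κ, ∑ R : Perm D, ∑ L : Perm D, ∑ c : D, f R L c j := by
    intro f
    conv_rhs => rw [Finset.sum_comm]
    refine Finset.sum_congr rfl fun R _ => ?_
    conv_rhs => rw [Finset.sum_comm]
    refine Finset.sum_congr rfl fun L _ => ?_
    exact Finset.sum_comm
  rw [hj]
  rfl

end Removal

/-! #### Two vertices that are merged -/

section Merging

variable {D κ K : Type} [CommRing K] [Fintype κ]

/-- The conditions for the two roots `b`, `c` and the roots `r` that lead to a rooted hypermap of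
genus `g` when a dart is inserted that merges the vertices of `b` and `c`. -/
structure IsMergeable (g : ℕ) (R L : Perm D) (b c : D) (r : κ → D) : Prop where
  euler : cycleCount R + cycleCount L + cycleCount (R * L) + 2 * g = Nat.card D + 4
  roots : RootsDistinct R (optCons b (optCons c r))

/-- The weight of a hypermap with roots `b`, `c` and `r`. -/
noncomputable def mergeWeight (R L : Perm D) (b c : D) (r : κ → D) (v : K) (w : κ → K)
    (x y u : K) : K :=
  rootWeight R (optCons b (optCons c r)) (optCons v (optCons v w)) * weight R L x y u

/-- The map without the new dart has one vertex more, so multiplying by `u` matches the two weights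
without a division. The merged vertex has the degrees of `b` and `c` plus one, so both old vertices
are marked by `v` and one factor `v` is left over. -/
theorem mul_insertTerm_of_not_sameCycle [Fintype D] [DecidableEq D] {R : Perm D} {b c : D}
    (h : ¬ R.SameCycle c b) (g : ℕ) (L : Perm D) (r : κ → D) (v : K) (w : κ → K) (x y u : K)
    [Decidable (ConnVia R L b c ∧ IsMergeable g R L b c r)] :
    u * insertTerm g R L (some b) (some c) r v w x y u =
      v * if ConnVia R L b c ∧ IsMergeable g R L b c r then
        mergeWeight R L b c r v w x y u else 0 := by
  have : Nonempty D := ⟨b⟩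
  set N := insertR R (some b) (some c) with hN
  have hcount := cycleCount_insertR_of_not_sameCycle h
  rw [← hN] at hcount
  have hpos := cycleCount_pos N
  -- One vertex fewer and one dart more: `(V - 1) + E + F + 2 * g = (t + 1) + 2` becomes a right
  -- side `t + 4` for the old map.
  have hg : EulerGenus g N (insertL L (some b)) ↔
      cycleCount R + cycleCount L + cycleCount (R * L) + 2 * g = Nat.card D + 4 := by
    rw [EulerGenus, hN, cycleCount_insert_mul_some, cycleCount_insertL_some, ← hN,
      Finite.card_option]
    omega
  have hroots : RootsDistinct N (optCons none (some ∘ r)) ↔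
      RootsDistinct R (optCons b (optCons c r)) := by
    rw [rootsDistinct_optCons, rootsDistinct_optCons, rootsDistinct_optCons]
    simp only [RootsDistinct, Function.comp_apply, hN, sameCycle_none_insertR h, not_or]
    constructor
    · rintro ⟨h1, h2⟩
      refine ⟨?_, fun i => (h1 i).1, fun i j hij => ?_⟩
      · rintro (_ | i)
        exacts [fun h' => h h'.symm, (h1 i).2]
      · rw [← sameCycle_some_insertR h (h1 i).1 (h1 i).2]
        exact h2 i j hij
    · rintro ⟨h1, h2, h3⟩
      refine ⟨fun i => ⟨h2 i, h1 (some i)⟩, fun i j hij => ?_⟩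
      rw [sameCycle_some_insertR h (h2 i) (h1 (some i))]
      exact h3 i j hij
  have hiff : IsRooted g N (insertL L (some b)) (optCons none (some ∘ r)) ↔
      ConnVia R L b c ∧ IsMergeable g R L b c r :=
    ⟨fun ⟨h1, h2, h3⟩ => ⟨(conn_insert_some_some R L b c).1 h1, hg.1 h2, hroots.1 h3⟩,
      fun ⟨h1, h2, h3⟩ => ⟨(conn_insert_some_some R L b c).2 h1, hg.2 h2, hroots.2 h3⟩⟩
  by_cases hr : ConnVia R L b c ∧ IsMergeable g R L b c r
  · have h1 := (rootsDistinct_optCons.1 hr.2.roots).1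
    have h2 := (rootsDistinct_optCons.1 (rootsDistinct_optCons.1 hr.2.roots).2).1
    have hw : rootWeight N (some ∘ r) w = rootWeight R r w :=
      Finset.prod_congr rfl fun i _ => by
        rw [Function.comp_apply, hN, cycleDegree_some_insertR h (h2 i) (h1 (some i))]
    obtain ⟨k, hk⟩ := Nat.exists_eq_succ_of_ne_zero hpos.ne'
    rw [if_pos hr, insertTerm, mapTerm_of_isRooted (hiff.2 hr), mergeWeight, rootWeight_optCons,
      rootWeight_optCons, rootWeight_optCons, hw, weight, weight, cycleCount_insertL_some,
      cycleCount_insert_mul_some, hcount, cycleDegree_none_insertR h, hk]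
    simp only [Nat.succ_eq_add_one, Nat.add_sub_cancel]
    ring
  · rw [if_neg hr, insertTerm, mapTerm_of_not_isRooted (mt hiff.1 hr), mul_zero, mul_zero]

omit [Fintype κ] in
theorem IsMergeable.not_sameCycle {g : ℕ} {R L : Perm D} {b c : D} {r : κ → D}
    (h : IsMergeable g R L b c r) : ¬ R.SameCycle c b := fun h' =>
  (rootsDistinct_optCons.1 h.roots).1 none h'.symm

variable [Fintype D] [DecidableEq D] [DecidableEq κ]

-- For a connected map the right side `t + 4` means genus `g - 1`. In genus 0 this would be a
-- negative genus, which `Conn.exists_eulerGenus` excludes.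
open scoped Classical in
theorem sum_insertTerm_conn (g : ℕ) (v : K) (w : κ → K) (x y u : K) :
    (∑ R : Perm D, ∑ L : Perm D, ∑ b : D, ∑ c : D, ∑ r : κ → D,
      if Conn R L ∧ IsMergeable g R L b c r then mergeWeight R L b c r v w x y u else 0) =
    if g = 0 then 0 else mapSum (g - 1) D (optCons v (optCons v w)) x y u := by
  cases g with
  | zero =>
    rw [if_pos rfl]
    refine Finset.sum_eq_zero fun R _ => Finset.sum_eq_zero fun L _ => Finset.sum_eq_zero fun b _ =>
      Finset.sum_eq_zero fun c _ => Finset.sum_eq_zero fun r _ => if_neg ?_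
    rintro ⟨h1, h2⟩
    have : Nonempty D := ⟨b⟩
    obtain ⟨k, hk⟩ := h1.exists_eulerGenus
    have := h2.euler
    rw [EulerGenus] at hk
    omega
  | succ g =>
    rw [if_neg (Nat.succ_ne_zero g), Nat.add_sub_cancel]
    simp only [mapSum, sum_optCons]
    refine Finset.sum_congr rfl fun R _ => Finset.sum_congr rfl fun L _ =>
      Finset.sum_congr rfl fun b _ => Finset.sum_congr rfl fun c _ =>
        Finset.sum_congr rfl fun r _ => ?_
    have hg : EulerGenus g R L ↔
        cycleCount R + cycleCount L + cycleCount (R * L) + 2 * (g + 1) = Nat.card D + 4 := by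
      rw [EulerGenus]
      omega
    exact if_congr ⟨fun ⟨h1, h2, h3⟩ => ⟨h1, hg.2 h2, h3⟩, fun ⟨h1, h2, h3⟩ => ⟨h1, hg.1 h2, h3⟩⟩
      rfl rfl

/-! #### Two components -/

section Glue

variable (A : Finset D)

/-- The function that is `r₁` on `X` and `r₂` outside `X`. -/
def glue (X : Finset κ) (r₁ : {i // i ∈ X} → {a // a ∈ A}) (r₂ : {i // i ∉ X} → {a // a ∉ A}) :
    κ → D :=
  fun i => if h : i ∈ X then r₁ ⟨i, h⟩ else r₂ ⟨i, h⟩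

omit [Fintype κ] [Fintype D] [DecidableEq D] in
theorem glue_mem (X : Finset κ) (r₁ : {i // i ∈ X} → {a // a ∈ A})
    (r₂ : {i // i ∉ X} → {a // a ∉ A}) (i : {i // i ∈ X}) : glue A X r₁ r₂ i = r₁ i := by
  rw [glue, dif_pos i.2]

omit [Fintype κ] [Fintype D] [DecidableEq D] in
theorem glue_notMem (X : Finset κ) (r₁ : {i // i ∈ X} → {a // a ∈ A})
    (r₂ : {i // i ∉ X} → {a // a ∉ A}) (i : {i // i ∉ X}) : glue A X r₁ r₂ i = r₂ i := by
  rw [glue, dif_neg i.2]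

/-- A sequence of roots determines the set `X` of the indices whose roots lie in `A`, and two
independent sequences on `X` and off `X`. -/
theorem sum_glue (F : (κ → D) → K) :
    ∑ r, F r = ∑ X : Finset κ, ∑ r₁ : {i // i ∈ X} → {a // a ∈ A},
      ∑ r₂ : {i // i ∉ X} → {a // a ∉ A}, F (glue A X r₁ r₂) := by
  have hbij : Function.Bijective
      (fun s : (Σ X : Finset κ, ({i // i ∈ X} → {a // a ∈ A}) × ({i // i ∉ X} → {a // a ∉ A})) =>
        glue A s.1 s.2.1 s.2.2) := by
    have hmem : ∀ (X : Finset κ) r₁ r₂ i, glue A X r₁ r₂ i ∈ A ↔ i ∈ X := by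
      intro X r₁ r₂ i
      by_cases hi : i ∈ X
      · simp [glue, hi]
      · simpa [glue, hi] using (r₂ ⟨i, hi⟩).2
    constructor
    · rintro ⟨X, r₁, r₂⟩ ⟨Y, s₁, s₂⟩ h
      have hXY : X = Y := by
        ext i
        rw [← hmem X r₁ r₂ i, ← hmem Y s₁ s₂ i]
        exact iff_of_eq (congrArg (· ∈ A) (congrFun h i))
      subst hXY
      have h1 : r₁ = s₁ := funext fun i => Subtype.ext <| by
        rw [← glue_mem A X r₁ r₂, ← glue_mem A X s₁ s₂]
        exact congrFun h i
      have h2 : r₂ = s₂ := funext fun i => Subtype.ext <| by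
        rw [← glue_notMem A X r₁ r₂, ← glue_notMem A X s₁ s₂]
        exact congrFun h i
      rw [h1, h2]
    · intro r
      refine ⟨⟨Finset.univ.filter fun i => r i ∈ A, fun i => ⟨r i, (Finset.mem_filter.1 i.2).2⟩,
        fun i => ⟨r i, fun hi => i.2 (by simpa using hi)⟩⟩, ?_⟩
      funext i
      simp [glue]
  rw [← hbij.sum_comp, Fintype.sum_sigma]
  refine Finset.sum_congr rfl fun X _ => ?_
  rw [Fintype.sum_prod_type]

omit [DecidableEq D] in
theorem sum_ite_pred (P : D → Prop) [DecidablePred P] [Fintype {b // P b}] (F : D → K) :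
    ∑ b, (if P b then F b else 0) = ∑ b : {b // P b}, F b := by
  rw [← Finset.sum_filter]
  exact Finset.sum_subtype _ (by simp) F

variable {A} {R₁ L₁ : Perm {a // a ∈ A}} {R₂ L₂ : Perm {a // a ∉ A}}

omit [Fintype D] in
theorem sameCycle_subtypeCongr_left {a b : {a // a ∈ A}} :
    (R₁.subtypeCongr R₂).SameCycle a b ↔ R₁.SameCycle a b := by
  have := sameCycle_permCongr (sumCompl (· ∈ A)) (Perm.sumCongr R₁ R₂) (x := Sum.inl a)
    (y := Sum.inl b)
  rw [sameCycle_sumCongr_inl] at this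
  exact this

omit [Fintype D] in
theorem sameCycle_subtypeCongr_right {a b : {a // a ∉ A}} :
    (R₁.subtypeCongr R₂).SameCycle a b ↔ R₂.SameCycle a b := by
  have := sameCycle_permCongr (sumCompl (· ∈ A)) (Perm.sumCongr R₁ R₂) (x := Sum.inr a)
    (y := Sum.inr b)
  rw [sameCycle_sumCongr_inr] at this
  exact this

omit [Fintype D] in
theorem not_sameCycle_subtypeCongr (a : {a // a ∈ A}) (b : {a // a ∉ A}) :
    ¬ (R₁.subtypeCongr R₂).SameCycle a b := by
  have := sameCycle_permCongr (sumCompl (· ∈ A)) (Perm.sumCongr R₁ R₂) (x := Sum.inl a)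
    (y := Sum.inr b)
  rw [sameCycle_sumCongr_inl_inr] at this
  exact this.1

omit [Fintype D] in
theorem cycleDegree_subtypeCongr_left (a : {a // a ∈ A}) :
    cycleDegree (R₁.subtypeCongr R₂) a = cycleDegree R₁ a := by
  rw [← cycleDegree_sumCongr_inl (p := R₁) (q := R₂),
    ← cycleDegree_permCongr (sumCompl (· ∈ A)) (Perm.sumCongr R₁ R₂)]
  rfl

omit [Fintype D] in
theorem cycleDegree_subtypeCongr_right (a : {a // a ∉ A}) :
    cycleDegree (R₁.subtypeCongr R₂) a = cycleDegree R₂ a := by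
  rw [← cycleDegree_sumCongr_inr (p := R₁) (q := R₂),
    ← cycleDegree_permCongr (sumCompl (· ∈ A)) (Perm.sumCongr R₁ R₂)]
  rfl

variable {b : {a // a ∈ A}} {c : {a // a ∉ A}} {X : Finset κ} {r₁ : {i // i ∈ X} → {a // a ∈ A}}
  {r₂ : {i // i ∉ X} → {a // a ∉ A}}

omit [Fintype κ] [Fintype D] in
theorem rootsDistinct_glue :
    RootsDistinct (R₁.subtypeCongr R₂) (optCons (b : D) (optCons (c : D) (glue A X r₁ r₂))) ↔
      RootsDistinct R₁ (optCons b r₁) ∧ RootsDistinct R₂ (optCons c r₂) := by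
  rw [rootsDistinct_optCons, rootsDistinct_optCons, rootsDistinct_optCons, rootsDistinct_optCons]
  constructor
  · rintro ⟨h1, h2, h3⟩
    refine ⟨⟨fun i => ?_, fun i j hij => ?_⟩, fun i => ?_, fun i j hij => ?_⟩
    · have := h1 (some i)
      rwa [optCons_some, glue_mem, sameCycle_subtypeCongr_left] at this
    · have := h3 i j fun e => hij (Subtype.ext e)
      rwa [glue_mem, glue_mem, sameCycle_subtypeCongr_left] at this
    · have := h2 i
      rwa [glue_notMem, sameCycle_subtypeCongr_right] at this
    · have := h3 i j fun e => hij (Subtype.ext e)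
      rwa [glue_notMem, glue_notMem, sameCycle_subtypeCongr_right] at this
  · rintro ⟨⟨h1, h2⟩, h3, h4⟩
    refine ⟨?_, fun i => ?_, fun i j hij => ?_⟩
    · rintro (_ | i)
      · exact not_sameCycle_subtypeCongr b c
      · rw [optCons_some]
        by_cases hi : i ∈ X
        · lift i to {i // i ∈ X} using hi
          rw [glue_mem, sameCycle_subtypeCongr_left]
          exact h1 i
        · lift i to {i // i ∉ X} using hi
          rw [glue_notMem]
          exact not_sameCycle_subtypeCongr _ _
    · by_cases hi : i ∈ X
      · lift i to {i // i ∈ X} using hi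
        rw [glue_mem]
        exact fun h => not_sameCycle_subtypeCongr _ _ h.symm
      · lift i to {i // i ∉ X} using hi
        rw [glue_notMem, sameCycle_subtypeCongr_right]
        exact h3 i
    · by_cases hi : i ∈ X <;> by_cases hj : j ∈ X
      · lift i to {i // i ∈ X} using hi
        lift j to {i // i ∈ X} using hj
        rw [glue_mem, glue_mem, sameCycle_subtypeCongr_left]
        exact h2 i j fun e => hij (congrArg Subtype.val e)
      · lift i to {i // i ∈ X} using hi
        lift j to {i // i ∉ X} using hj
        rw [glue_mem, glue_notMem]
        exact not_sameCycle_subtypeCongr _ _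
      · lift i to {i // i ∉ X} using hi
        lift j to {i // i ∈ X} using hj
        rw [glue_mem, glue_notMem]
        exact fun h => not_sameCycle_subtypeCongr _ _ h.symm
      · lift i to {i // i ∉ X} using hi
        lift j to {i // i ∉ X} using hj
        rw [glue_notMem, glue_notMem, sameCycle_subtypeCongr_right]
        exact h4 i j fun e => hij (congrArg Subtype.val e)

omit [Fintype D] in
theorem rootWeight_glue (w : κ → K) :
    rootWeight (R₁.subtypeCongr R₂) (glue A X r₁ r₂) w =
      rootWeight R₁ r₁ (fun i => w i) * rootWeight R₂ r₂ (fun i => w i) := by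
  rw [rootWeight, ← Fintype.prod_subtype_mul_prod_subtype (· ∈ X)]
  congr 1
  · refine Finset.prod_congr (Finset.ext fun _ => by simp) fun i _ => ?_
    rw [glue_mem, cycleDegree_subtypeCongr_left]
  · refine Finset.prod_congr rfl fun i _ => ?_
    rw [glue_notMem, cycleDegree_subtypeCongr_right]

-- The Euler relations of the two components add up to the right side `(t₁ + 2) + (t₂ + 2) = t + 4`,
-- hence the genera add up to `g`, and only one index `j` contributes. Each component leaves one
-- vertex uncounted while their union leaves out only one altogether, whence the factor `u`.
open scoped Classical in
theorem mergeTerm_glue (g : ℕ) (v : K) (w : κ → K) (x y u : K) :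
    (if Conn R₁ L₁ ∧ Conn R₂ L₂ ∧ IsMergeable g (R₁.subtypeCongr R₂) (L₁.subtypeCongr L₂) b c
        (glue A X r₁ r₂) then
      mergeWeight (R₁.subtypeCongr R₂) (L₁.subtypeCongr L₂) b c (glue A X r₁ r₂) v w x y u else 0) =
    u * ∑ j ∈ Finset.range (g + 1),
      mapTerm j R₁ L₁ (optCons b r₁) (optCons v fun i => w i) x y u *
        mapTerm (g - j) R₂ L₂ (optCons c r₂) (optCons v fun i => w i) x y u := by
  have hb : Nonempty {a // a ∈ A} := ⟨b⟩
  have hc : Nonempty {a // a ∉ A} := ⟨c⟩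
  by_cases hconn : Conn R₁ L₁ ∧ Conn R₂ L₂
  swap
  · rw [if_neg fun h => hconn ⟨h.1, h.2.1⟩, Finset.sum_eq_zero, mul_zero]
    intro j _
    by_cases h1 : Conn R₁ L₁
    · rw [mapTerm_of_not_isRooted (R := R₂) fun h => hconn ⟨h1, h.conn⟩, mul_zero]
    · rw [mapTerm_of_not_isRooted (R := R₁) fun h => h1 h.conn, zero_mul]
  obtain ⟨hc₁, hc₂⟩ := hconn
  by_cases hroots : RootsDistinct R₁ (optCons b r₁) ∧ RootsDistinct R₂ (optCons c r₂)
  swap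
  · rw [if_neg fun h => hroots (rootsDistinct_glue.1 h.2.2.roots), Finset.sum_eq_zero, mul_zero]
    intro j _
    by_cases h1 : RootsDistinct R₁ (optCons b r₁)
    · rw [mapTerm_of_not_isRooted (R := R₂) fun h => hroots ⟨h1, h.roots⟩, mul_zero]
    · rw [mapTerm_of_not_isRooted (R := R₁) fun h => h1 h.roots, zero_mul]
  obtain ⟨hr₁, hr₂⟩ := hroots
  obtain ⟨g₁, hg₁⟩ := hc₁.exists_eulerGenus
  obtain ⟨g₂, hg₂⟩ := hc₂.exists_eulerGenus
  have hcard := card_add_card_not (· ∈ A)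
  have hunique : ∀ j, EulerGenus j R₁ L₁ → j = g₁ := fun j hj => by
    rw [EulerGenus] at hj hg₁; omega
  have hunique' : ∀ j, EulerGenus j R₂ L₂ → j = g₂ := fun j hj => by
    rw [EulerGenus] at hj hg₂; omega
  have heuler : cycleCount (R₁.subtypeCongr R₂) + cycleCount (L₁.subtypeCongr L₂) +
      cycleCount (R₁.subtypeCongr R₂ * L₁.subtypeCongr L₂) + 2 * g = Nat.card D + 4 ↔
      g = g₁ + g₂ := by
    rw [subtypeCongr_mul, cycleCount_subtypeCongr, cycleCount_subtypeCongr,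
      cycleCount_subtypeCongr]
    rw [EulerGenus] at hg₁ hg₂
    omega
  by_cases hg : g = g₁ + g₂
  · rw [if_pos ⟨hc₁, hc₂, heuler.2 hg, rootsDistinct_glue.2 ⟨hr₁, hr₂⟩⟩,
      Finset.sum_eq_single_of_mem g₁ (Finset.mem_range.2 (by omega))]
    · have h2 : g - g₁ = g₂ := by omega
      obtain ⟨k₁, hk₁⟩ := Nat.exists_eq_succ_of_ne_zero (cycleCount_pos R₁).ne'
      obtain ⟨k₂, hk₂⟩ := Nat.exists_eq_succ_of_ne_zero (cycleCount_pos R₂).ne'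
      rw [h2, mapTerm_of_isRooted ⟨hc₁, hg₁, hr₁⟩, mapTerm_of_isRooted ⟨hc₂, hg₂, hr₂⟩,
        mergeWeight, rootWeight_optCons, rootWeight_optCons, rootWeight_optCons,
        rootWeight_optCons, rootWeight_glue, cycleDegree_subtypeCongr_left,
        cycleDegree_subtypeCongr_right, weight, weight, weight, subtypeCongr_mul,
        cycleCount_subtypeCongr, cycleCount_subtypeCongr, cycleCount_subtypeCongr, hk₁, hk₂]
      have : k₁.succ + k₂.succ - 1 = k₁ + k₂ + 1 := by omega
      rw [this]
      simp only [Nat.succ_eq_add_one, Nat.add_sub_cancel]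
      ring
    · intro j _ hj
      rw [mapTerm_of_not_isRooted (R := R₁) fun h => hj (hunique j h.genus), zero_mul]
  · rw [if_neg fun h => hg (heuler.1 h.2.2.euler), Finset.sum_eq_zero, mul_zero]
    intro j hj
    rw [Finset.mem_range] at hj
    by_cases h1 : EulerGenus j R₁ L₁
    · rw [mapTerm_of_not_isRooted (R := R₂), mul_zero]
      intro h
      have h2 := hunique j h1
      have h3 := hunique' _ h.genus
      omega
    · rw [mapTerm_of_not_isRooted (R := R₁) fun h => h1 h.genus, zero_mul]

end Glue

omit [Fintype κ] [DecidableEq κ] in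
theorem sum_six_comm {α₁ α₂ α₃ α₄ α₅ α₆ σ : Type} [Fintype α₁] [Fintype α₂] [Fintype α₃]
    [Fintype α₄] [Fintype α₅] [Fintype α₆] (s : Finset σ)
    (f : α₁ → α₂ → α₃ → α₄ → α₅ → α₆ → σ → K) :
    ∑ a₁, ∑ a₂, ∑ a₃, ∑ a₄, ∑ a₅, ∑ a₆, ∑ z ∈ s, f a₁ a₂ a₃ a₄ a₅ a₆ z =
      ∑ z ∈ s, ∑ a₁, ∑ a₂, ∑ a₃, ∑ a₄, ∑ a₅, ∑ a₆, f a₁ a₂ a₃ a₄ a₅ a₆ z := by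
  conv_rhs => rw [Finset.sum_comm]
  refine Finset.sum_congr rfl fun a₁ _ => ?_
  conv_rhs => rw [Finset.sum_comm]
  refine Finset.sum_congr rfl fun a₂ _ => ?_
  conv_rhs => rw [Finset.sum_comm]
  refine Finset.sum_congr rfl fun a₃ _ => ?_
  conv_rhs => rw [Finset.sum_comm]
  refine Finset.sum_congr rfl fun a₄ _ => ?_
  conv_rhs => rw [Finset.sum_comm]
  refine Finset.sum_congr rfl fun a₅ _ => ?_
  exact Finset.sum_comm

-- With the component `A` of `b` fixed, `R` and `L` are pairs of permutations of `A` and of its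
-- complement, `b` ranges over `A`, `c` over the complement, and the roots are distributed over the
-- two parts.
open scoped Classical in
theorem sum_insertTerm_isSplit (g : ℕ) (A : Finset D) (v : K) (w : κ → K) (x y u : K) :
    (∑ R : Perm D, ∑ L : Perm D, ∑ b : D, ∑ c : D, ∑ r : κ → D,
      if IsSplit R L b c (A : Set D) ∧ IsMergeable g R L b c r then
        mergeWeight R L b c r v w x y u else 0) =
    u * ∑ j ∈ Finset.range (g + 1), ∑ X : Finset κ,
      mapSum j {a // a ∈ A} (optCons v fun i : {i // i ∈ X} => w i) x y u *
        mapSum (g - j) {a // a ∉ A} (optCons v fun i : {i // i ∉ X} => w i) x y u := by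
  have h1 : ∀ R : Perm D, (∑ L : Perm D, ∑ b : D, ∑ c : D, ∑ r : κ → D,
      if IsSplit R L b c (A : Set D) ∧ IsMergeable g R L b c r then
        mergeWeight R L b c r v w x y u else 0) =
      if ∀ x, R x ∈ A ↔ x ∈ A then (∑ L : Perm D, if ∀ x, L x ∈ A ↔ x ∈ A then
        (∑ b : D, ∑ c : D, ∑ r : κ → D,
        if IsSplit R L b c (A : Set D) ∧ IsMergeable g R L b c r then
          mergeWeight R L b c r v w x y u else 0) else 0) else 0 := by
    intro R
    split_ifs with hR
    · refine Finset.sum_congr rfl fun L _ => ?_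
      split_ifs with hL
      · rfl
      · exact Finset.sum_eq_zero fun b _ => Finset.sum_eq_zero fun c _ =>
          Finset.sum_eq_zero fun r _ => if_neg fun h => hL h.1.inv.2
    · exact Finset.sum_eq_zero fun L _ => Finset.sum_eq_zero fun b _ =>
        Finset.sum_eq_zero fun c _ => Finset.sum_eq_zero fun r _ => if_neg fun h => hR h.1.inv.1
  simp only [h1]
  rw [sum_perm_ite (· ∈ A)]
  simp only [sum_perm_ite (· ∈ A)]
  have h2 : ∀ (R₁ L₁ : Perm {a // a ∈ A}) (R₂ L₂ : Perm {a // a ∉ A}),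
      (∑ b : D, ∑ c : D, ∑ r : κ → D,
      if IsSplit (R₁.subtypeCongr R₂) (L₁.subtypeCongr L₂) b c (A : Set D) ∧
          IsMergeable g (R₁.subtypeCongr R₂) (L₁.subtypeCongr L₂) b c r then
        mergeWeight (R₁.subtypeCongr R₂) (L₁.subtypeCongr L₂) b c r v w x y u else 0) =
      ∑ b : {a // a ∈ A}, ∑ c : {a // a ∉ A}, ∑ j ∈ Finset.range (g + 1), ∑ X : Finset κ,
        u * ((∑ r₁ : {i // i ∈ X} → {a // a ∈ A},
            mapTerm j R₁ L₁ (optCons b r₁) (optCons v fun i => w i) x y u) *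
          ∑ r₂ : {i // i ∉ X} → {a // a ∉ A},
            mapTerm (g - j) R₂ L₂ (optCons c r₂) (optCons v fun i => w i) x y u) := by
    intro R₁ L₁ R₂ L₂
    have hsplit := fun b c => isSplit_subtypeCongr (· ∈ A) R₁ L₁ R₂ L₂ (b := b) (c := c)
    have hA : {x | x ∈ A} = (A : Set D) := rfl
    rw [hA] at hsplit
    have h3 : ∀ b : D, (∑ c : D, ∑ r : κ → D,
        if IsSplit (R₁.subtypeCongr R₂) (L₁.subtypeCongr L₂) b c (A : Set D) ∧
          IsMergeable g (R₁.subtypeCongr R₂) (L₁.subtypeCongr L₂) b c r then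
        mergeWeight (R₁.subtypeCongr R₂) (L₁.subtypeCongr L₂) b c r v w x y u else 0) =
        if b ∈ A then (∑ c : D, if c ∉ A then ∑ r : κ → D, (if Conn R₁ L₁ ∧ Conn R₂ L₂ ∧
          IsMergeable g (R₁.subtypeCongr R₂) (L₁.subtypeCongr L₂) b c r then
        mergeWeight (R₁.subtypeCongr R₂) (L₁.subtypeCongr L₂) b c r v w x y u else 0) else 0)
        else 0 := by
      intro b
      by_cases hb : b ∈ A
      · rw [if_pos hb]
        refine Finset.sum_congr rfl fun c _ => ?_
        by_cases hc : c ∈ A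
        · rw [if_neg (not_not.2 hc)]
          exact Finset.sum_eq_zero fun r _ => if_neg fun h => h.1.right_notMem hc
        · rw [if_pos hc]
          refine Finset.sum_congr rfl fun r _ => ?_
          simp only [hsplit, hb, hc, not_false_eq_true, true_and, and_assoc]
      · rw [if_neg hb]
        exact Finset.sum_eq_zero fun c _ => Finset.sum_eq_zero fun r _ =>
          if_neg fun h => hb h.1.left_mem
    simp only [h3]
    rw [sum_ite_pred (· ∈ A)]
    simp only [sum_ite_pred (· ∉ A), sum_glue A, mergeTerm_glue]
    refine Finset.sum_congr rfl fun b _ => Finset.sum_congr rfl fun c _ => ?_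
    rw [Finset.sum_comm (s := Finset.range (g + 1))]
    refine Finset.sum_congr rfl fun X _ => ?_
    simp only [Finset.sum_mul_sum]
    simp only [Finset.mul_sum]
    conv_rhs => rw [Finset.sum_comm]
    refine Finset.sum_congr rfl fun r₁ _ => ?_
    exact Finset.sum_comm
  simp only [h2]
  rw [sum_six_comm, Finset.mul_sum]
  refine Finset.sum_congr rfl fun j _ => ?_
  rw [sum_six_comm, Finset.mul_sum]
  refine Finset.sum_congr rfl fun X _ => ?_
  simp only [mapSum, sum_optCons, ← Finset.mul_sum, ← Finset.sum_mul]

-- If `b` and `c` together reach all darts, the map is either connected or the union of two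
-- components; in the second case the component `A` of `b` is unique, so the sum over all `A` counts
-- it once.
open scoped Classical in
theorem mul_sum_insertTerm_not_sameCycle (g : ℕ) (v : K) (w : κ → K) (x y u : K) :
    u * (∑ R : Perm D, ∑ L : Perm D, ∑ b : D, ∑ c : D, ∑ r : κ → D,
      if R.SameCycle c b then 0 else insertTerm g R L (some b) (some c) r v w x y u) =
    v * ((if g = 0 then 0 else mapSum (g - 1) D (optCons v (optCons v w)) x y u) +
      u * ∑ A : Finset D, ∑ j ∈ Finset.range (g + 1), ∑ X : Finset κ,
      mapSum j {a // a ∈ A} (optCons v fun i : {i // i ∈ X} => w i) x y u *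
        mapSum (g - j) {a // a ∉ A} (optCons v fun i : {i // i ∉ X} => w i) x y u) := by
  rw [← sum_insertTerm_conn, Finset.mul_sum (Finset.univ : Finset (Finset D)),
    Finset.sum_congr rfl fun A _ => (sum_insertTerm_isSplit g A v w x y u).symm]
  have hA : ∀ (f : Perm D → Perm D → D → D → (κ → D) → Finset D → K),
      ∑ A : Finset D, ∑ R : Perm D, ∑ L : Perm D, ∑ b : D, ∑ c : D, ∑ r : κ → D, f R L b c r A =
      ∑ R : Perm D, ∑ L : Perm D, ∑ b : D, ∑ c : D, ∑ r : κ → D, ∑ A : Finset D, f R L b c r A := by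
    intro f
    -- Only five sums have to be crossed; the sixth is taken over a one-point type.
    have := sum_six_comm (α₆ := Unit) Finset.univ fun R L b c r _ A => f R L b c r A
    simpa using this.symm
  rw [hA]
  simp only [← Finset.sum_add_distrib]
  simp only [Finset.mul_sum]
  refine Finset.sum_congr rfl fun R _ => Finset.sum_congr rfl fun L _ =>
    Finset.sum_congr rfl fun b _ => Finset.sum_congr rfl fun c _ =>
      Finset.sum_congr rfl fun r _ => ?_
  by_cases hM : IsMergeable g R L b c r
  swap
  · simp only [hM, and_false, if_false, Finset.sum_const_zero, add_zero, mul_zero]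
    split_ifs with hs
    · rw [mul_zero]
    · rw [mul_insertTerm_of_not_sameCycle hs, if_neg fun h => hM h.2, mul_zero]
  simp only [hM, and_true]
  rw [if_neg hM.not_sameCycle, mul_insertTerm_of_not_sameCycle hM.not_sameCycle]
  congr 1
  by_cases hc : Conn R L
  · rw [if_pos ⟨hc.connVia b c, hM⟩, if_pos hc, Finset.sum_eq_zero, add_zero]
    exact fun A _ => if_neg fun h => h.not_conn hc
  rw [if_neg hc, zero_add]
  by_cases hv : ConnVia R L b c
  · obtain ⟨A, hA⟩ := hv.exists_isSplit hc
    rw [if_pos ⟨hv, hM⟩, Finset.sum_eq_single_of_mem A.toFinset (Finset.mem_univ _), if_pos]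
    · rwa [Set.coe_toFinset]
    · intro B _ hB
      refine if_neg fun h => hB ?_
      rw [← Finset.coe_inj, Set.coe_toFinset]
      exact h.unique hA
  · rw [if_neg fun h => hv h.1, Finset.sum_eq_zero]
    exact fun A _ => if_neg fun h => hv h.connVia

end Merging

/-! ### The recursion for the generating series -/

section Series

variable {D κ K : Type} [CommRing K]

/-- The contributions to the recursion in which the removal of the root dart splits a vertex. -/
noncomputable def splitSum [Fintype κ] [DecidableEq κ] (g : ℕ) (D : Type) [Fintype D]
    [DecidableEq D] (v : K) (w : κ → K) (x y u : K) : K :=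
  rootedSum g D (fun d => ∑ k ∈ Finset.range d, v ^ k) w x y u +
    ∑ j, rootedSum g D
      (fun d => ∑ k ∈ Finset.range d, ((d - k : ℕ) : K) * v ^ k * w j ^ (d - k))
      (fun i : {i // i ≠ j} => w i) x y u

variable [Fintype κ] [DecidableEq κ]

theorem mul_splitSum [Fintype D] [DecidableEq D] (g : ℕ) (v : K) (w : κ → K) (x y u : K) :
    v * splitSum g D v w x y u =
      rootedSum g D (fun d => ∑ k ∈ Finset.range d, v ^ (k + 1)) w x y u +
      ∑ j, rootedSum g D
        (fun d => ∑ k ∈ Finset.range d, ((d - k : ℕ) : K) * v ^ (k + 1) * w j ^ (d - k))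
        (fun i : {i // i ≠ j} => w i) x y u := by
  rw [splitSum, mul_add, Finset.mul_sum]
  simp only [mul_rootedSum, Finset.mul_sum]
  have h1 : (fun d : ℕ => ∑ k ∈ Finset.range d, v * v ^ k) =
      fun d => ∑ k ∈ Finset.range d, v ^ (k + 1) :=
    funext fun d => Finset.sum_congr rfl fun k _ => (pow_succ' v k).symm
  have h2 : ∀ j, (fun d : ℕ => ∑ k ∈ Finset.range d,
      v * (((d - k : ℕ) : K) * v ^ k * w j ^ (d - k))) =
      fun d => ∑ k ∈ Finset.range d, ((d - k : ℕ) : K) * v ^ (k + 1) * w j ^ (d - k) :=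
    fun j => funext fun d => Finset.sum_congr rfl fun k _ => by ring
  simp only [h1, h2]

open scoped Classical in
theorem sum_insertTerm_eq [Fintype D] [DecidableEq D] (g : ℕ) (v : K) (w : κ → K) (x y u : K) :
    (∑ R : Perm D, ∑ L : Perm D, ∑ b : Option D, ∑ c : Option D, ∑ r : κ → D,
        insertTerm g R L b c r v w x y u) =
      (∑ R : Perm D, ∑ L : Perm D, ∑ r : κ → D, insertTerm g R L none none r v w x y u) +
      (∑ R : Perm D, ∑ L : Perm D, ∑ c : D, ∑ r : κ → D,
        insertTerm g R L none (some c) r v w x y u) +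
      (∑ R : Perm D, ∑ L : Perm D, ∑ b : D, ∑ r : κ → D,
        insertTerm g R L (some b) none r v w x y u) +
      ((∑ R : Perm D, ∑ L : Perm D, ∑ b : D, ∑ c : D, ∑ r : κ → D,
        (if R.SameCycle c b then insertTerm g R L (some b) (some c) r v w x y u else 0)) +
      ∑ R : Perm D, ∑ L : Perm D, ∑ b : D, ∑ c : D, ∑ r : κ → D,
        if R.SameCycle c b then 0 else insertTerm g R L (some b) (some c) r v w x y u) := by
  simp only [Fintype.sum_option, ← Finset.sum_add_distrib]
  refine Finset.sum_congr rfl fun R _ => Finset.sum_congr rfl fun L _ => ?_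
  rw [Finset.sum_add_distrib, ← add_assoc]
  congr 1
  refine Finset.sum_congr rfl fun b _ => Finset.sum_congr rfl fun c _ =>
    Finset.sum_congr rfl fun r _ => ?_
  split_ifs
  · rw [add_zero]
  · rw [zero_add]

theorem mul_sum_insertTerm [Fintype D] [DecidableEq D] (g : ℕ) (v : K) (w : κ → K) (x y u : K) :
    u * (∑ R : Perm D, ∑ L : Perm D, ∑ b : Option D, ∑ c : Option D, ∑ r : κ → D,
        insertTerm g R L b c r v w x y u) =
      v * ((if Fintype.card D = 0 ∧ g = 0 ∧ Fintype.card κ = 0 then u * (x * y) else 0) +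
        u * (x + y) * mapSum g D (optCons v w) x y u +
        (if g = 0 then 0 else mapSum (g - 1) D (optCons v (optCons v w)) x y u) +
        u * (∑ A : Finset D, ∑ j ∈ Finset.range (g + 1), ∑ X : Finset κ,
          mapSum j {a // a ∈ A} (optCons v fun i : {i // i ∈ X} => w i) x y u *
            mapSum (g - j) {a // a ∉ A} (optCons v fun i : {i // i ∉ X} => w i) x y u) +
        u * u * splitSum g D v w x y u) := by
  rw [sum_insertTerm_eq, sum_insertTerm_none_none, sum_insertTerm_none_some,
    sum_insertTerm_some_none, sum_insertTerm_sameCycle, ← mul_splitSum, mul_add,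
    mul_add u _ (Finset.sum _ _), mul_sum_insertTerm_not_sameCycle]
  generalize mapSum g D (optCons v w) x y u = a
  generalize splitSum g D v w x y u = b
  generalize (if g = 0 then 0 else mapSum (g - 1) D (optCons v (optCons v w)) x y u) = c
  generalize (∑ A : Finset D, ∑ j ∈ Finset.range (g + 1), ∑ X : Finset κ,
    mapSum j {a // a ∈ A} (optCons v fun i : {i // i ∈ X} => w i) x y u *
      mapSum (g - j) {a // a ∉ A} (optCons v fun i : {i // i ∉ X} => w i) x y u) = d
  split_ifs
  · ring
  · ring

variable [Algebra ℚ K]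

/-- The generating series of rooted hypermaps of genus `g`, with one vertex not counted. -/
noncomputable def mapSeries {ι : Type} [Fintype ι] [DecidableEq ι] (g : ℕ) (v : ι → K)
    (x y u : K) : PowerSeries K :=
  PowerSeries.mk fun t => (t.factorial : ℚ)⁻¹ • mapSum g (Fin t) v x y u

noncomputable def rootedSeries (g : ℕ) (φ : ℕ → K) (w : κ → K) (x y u : K) : PowerSeries K :=
  PowerSeries.mk fun t => (t.factorial : ℚ)⁻¹ • rootedSum g (Fin t) φ w x y u

theorem mapSeries_congr {ι ι' : Type} [Fintype ι] [DecidableEq ι] [Fintype ι'] [DecidableEq ι']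
    (e : ι ≃ ι') (g : ℕ) {v : ι → K} {v' : ι' → K} (h : ∀ i, v i = v' (e i)) (x y u : K) :
    mapSeries g v x y u = mapSeries g v' x y u := by
  have hv : v = v' ∘ e := funext h
  rw [mapSeries, mapSeries, hv]
  simp only [mapSum_congr_index]

theorem mapSeries_dual {ι : Type} [Fintype ι] [DecidableEq ι] (g : ℕ) (v : ι → K) (x y u : K) :
    mapSeries g v x y u = mapSeries g v y x u := by
  rw [mapSeries, mapSeries]
  simp only [mapSum_dual _ _ x y]

theorem mapSeries_optCons (g : ℕ) (v : K) (w : κ → K) (x y u : K) :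
    mapSeries g (optCons v w) x y u = rootedSeries g (fun d => v ^ d) w x y u := by
  simp only [mapSeries, rootedSeries, mapSum_optCons]

theorem rootedSeries_sub (g : ℕ) (φ ψ : ℕ → K) (w : κ → K) (x y u : K) :
    rootedSeries g φ w x y u - rootedSeries g ψ w x y u =
      rootedSeries g (fun d => φ d - ψ d) w x y u := by
  ext t
  simp only [rootedSeries, map_sub, PowerSeries.coeff_mk, ← smul_sub, rootedSum_sub]

theorem C_mul_rootedSeries (g : ℕ) (a : K) (φ : ℕ → K) (w : κ → K) (x y u : K) :
    PowerSeries.C a * rootedSeries g φ w x y u =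
      rootedSeries g (fun d => a * φ d) w x y u := by
  ext t
  simp only [rootedSeries, PowerSeries.coeff_C_mul, PowerSeries.coeff_mk, mul_smul_comm,
    mul_rootedSum]

/-- The series of products of two hypermaps among which the roots are distributed. -/
noncomputable def productSeries (g : ℕ) (v : K) (w : κ → K) (x y u : K) : PowerSeries K :=
  ∑ j ∈ Finset.range (g + 1), ∑ X : Finset κ,
    mapSeries j (optCons v fun i : {i // i ∈ X} => w i) x y u *
      mapSeries (g - j) (optCons v fun i : {i // i ∉ X} => w i) x y u

/-- This is the product rule for exponential generating functions. The summand depends only on the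
size of `A`, and the `m.choose k` subsets of size `k` turn `1 / m!` into `1 / (k! (m - k)!)`. -/
theorem coeff_productSeries (g : ℕ) (v : K) (w : κ → K) (x y u : K) (m : ℕ) :
    PowerSeries.coeff m (productSeries g v w x y u) = (m.factorial : ℚ)⁻¹ •
      ∑ A : Finset (Fin m), ∑ j ∈ Finset.range (g + 1), ∑ X : Finset κ,
        mapSum j {a // a ∈ A} (optCons v fun i : {i // i ∈ X} => w i) x y u *
          mapSum (g - j) {a // a ∉ A} (optCons v fun i : {i // i ∉ X} => w i) x y u := by
  set f : ℕ → K := fun k => ∑ j ∈ Finset.range (g + 1), ∑ X : Finset κ,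
    mapSum j (Fin k) (optCons v fun i : {i // i ∈ X} => w i) x y u *
      mapSum (g - j) (Fin (m - k)) (optCons v fun i : {i // i ∉ X} => w i) x y u with hf
  have h1 : ∀ A : Finset (Fin m), (∑ j ∈ Finset.range (g + 1), ∑ X : Finset κ,
        mapSum j {a // a ∈ A} (optCons v fun i : {i // i ∈ X} => w i) x y u *
          mapSum (g - j) {a // a ∉ A} (optCons v fun i : {i // i ∉ X} => w i) x y u) =
      f A.card := by
    intro A
    refine Finset.sum_congr rfl fun j _ => Finset.sum_congr rfl fun X _ => ?_
    rw [mapSum_congr_dart A.equivFin, mapSum_congr_dart (Fintype.equivFinOfCardEq (α := {a // a ∉ A})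
      (n := m - A.card) (by simp [Fintype.card_subtype_compl]))]
  rw [Finset.sum_congr rfl fun A _ => h1 A, ← Finset.powerset_univ, Finset.sum_powerset_apply_card f,
    Finset.card_univ, Fintype.card_fin, productSeries, map_sum, Finset.smul_sum]
  simp only [map_sum, PowerSeries.coeff_mul, mapSeries, PowerSeries.coeff_mk]
  simp only [Finset.Nat.sum_antidiagonal_eq_sum_range_succ_mk]
  have h2 : ∀ k ∈ Finset.range (m + 1), ∀ a b : K, (m.factorial : ℚ)⁻¹ • m.choose k • (a * b) =
      ((k.factorial : ℚ)⁻¹ • a) * (((m - k).factorial : ℚ)⁻¹ • b) := by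
    intro k hk a b
    rw [Finset.mem_range, Nat.lt_succ_iff] at hk
    rw [smul_mul_smul_comm, ← Nat.cast_smul_eq_nsmul ℚ, smul_smul]
    congr 1
    rw [Nat.cast_choose ℚ hk]
    field_simp
  have h3 : ∀ k ∈ Finset.range (m + 1), (m.factorial : ℚ)⁻¹ • m.choose k • f k =
      ∑ j ∈ Finset.range (g + 1), ∑ X : Finset κ,
        ((k.factorial : ℚ)⁻¹ • mapSum j (Fin k) (optCons v fun i : {i // i ∈ X} => w i) x y u) *
          (((m - k).factorial : ℚ)⁻¹ •
            mapSum (g - j) (Fin (m - k)) (optCons v fun i : {i // i ∉ X} => w i) x y u) := by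
    intro k hk
    simp only [hf, Finset.smul_sum]
    exact Finset.sum_congr rfl fun j _ => Finset.sum_congr rfl fun X _ => h2 k hk _ _
  rw [Finset.sum_congr rfl h3]
  conv_rhs => rw [Finset.sum_comm]
  refine Finset.sum_congr rfl fun j _ => ?_
  rw [Finset.sum_comm]

open PowerSeries in
/-- The effect of removing the root dart on the generating series. -/
theorem C_mul_mapSeries (g : ℕ) (v : K) (w : κ → K) (x y u : K) :
    C u * mapSeries g (optCons v w) x y u = C v * X *
      (C (if g = 0 ∧ Fintype.card κ = 0 then u * (x * y) else 0) +
        C (u * (x + y)) * mapSeries g (optCons v w) x y u +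
        (if g = 0 then 0 else mapSeries (g - 1) (optCons v (optCons v w)) x y u) +
        C u * productSeries g v w x y u +
        C (u * u) * (rootedSeries g (fun d => ∑ k ∈ Finset.range d, v ^ k) w x y u +
          ∑ j, rootedSeries g
            (fun d => ∑ k ∈ Finset.range d, ((d - k : ℕ) : K) * v ^ k * w j ^ (d - k))
            (fun i : {i // i ≠ j} => w i) x y u)) := by
  ext t
  rw [mul_assoc, coeff_C_mul, coeff_C_mul]
  cases t with
  | zero =>
    rw [coeff_zero_X_mul, mul_zero, mapSeries, coeff_mk, mapSum_of_isEmpty, smul_zero, mul_zero]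
  | succ m =>
    rw [coeff_succ_X_mul]
    simp only [map_add, map_sum, coeff_C_mul, coeff_productSeries]
    have hif : coeff m (if g = 0 then 0 else mapSeries (g - 1) (optCons v (optCons v w)) x y u) =
        (m.factorial : ℚ)⁻¹ •
          (if g = 0 then 0 else mapSum (g - 1) (Fin m) (optCons v (optCons v w)) x y u) := by
      split_ifs
      · simp
      · rw [mapSeries, coeff_mk]
    have hC : coeff m (C (if g = 0 ∧ Fintype.card κ = 0 then u * (x * y) else 0)) =
        (m.factorial : ℚ)⁻¹ • (if Fintype.card (Fin m) = 0 ∧ g = 0 ∧ Fintype.card κ = 0 then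
          u * (x * y) else 0) := by
      rw [coeff_C, Fintype.card_fin]
      by_cases hm : m = 0
      · simp [hm]
      · simp [hm]
    rw [hif, hC]
    simp only [mapSeries, rootedSeries, coeff_mk, ← Finset.smul_sum, ← smul_add, mul_smul_comm]
    -- The factor `m + 1` comes from the position of the first root in `mapSum_option`.
    have hfact : (((m + 1).factorial : ℕ) : ℚ)⁻¹ * ((m + 1 : ℕ) : ℚ) = (m.factorial : ℚ)⁻¹ := by
      rw [Nat.factorial_succ]
      push_cast
      field_simp
    rw [mapSum_congr_dart (finSuccEquiv m), mapSum_option, Fintype.card_fin, ← nsmul_eq_mul,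
      ← Nat.cast_smul_eq_nsmul ℚ, mul_smul_comm, smul_smul, hfact, mul_sum_insertTerm, splitSum,
      Fintype.card_fin]

end Series

/-! ### Isomorphism classes and labelled hypermaps -/

section Classes

variable {D : Type} {ρ : ℕ}

theorem cycleCount_le_card [Finite D] (p : Perm D) : cycleCount p ≤ Nat.card D :=
  Nat.card_le_card_of_surjective _ (Quotient.mk_surjective (s := SameCycle.setoid p))

theorem cycleDegree_le_card [Finite D] (p : Perm D) (x : D) : cycleDegree p x ≤ Nat.card D :=
  Nat.card_le_card_of_injective _ Subtype.val_injective

theorem multirootedHypermap_ext {M M' : MultirootedHypermap D ρ} (hR : M.R = M'.R)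
    (hL : M.L = M'.L) (hr : M.root = M'.root) : M = M' := by
  cases M
  cases M'
  cases hR
  cases hL
  cases hr
  rfl

/-- The hypermap obtained by renaming the darts. -/
def relabel (σ : Perm D) (M : MultirootedHypermap D ρ) : MultirootedHypermap D ρ where
  R := σ.permCongr M.R
  L := σ.permCongr M.L
  nonempty := M.nonempty
  transitive := by
    rw [isPretransitive_iff_conn, conn_permCongr, ← isPretransitive_iff_conn]
    exact M.transitive
  root := σ ∘ M.root
  distinct_vertices := (rootsDistinct_permCongr σ).2 M.distinct_vertices

theorem isomorphic_relabel (σ : Perm D) (M : MultirootedHypermap D ρ) :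
    M.Isomorphic (relabel σ M) :=
  ⟨σ, fun a => by simp [relabel], fun a => by simp [relabel], fun _ => rfl⟩

theorem exists_relabel_eq {M M' : MultirootedHypermap D ρ} (h : M.Isomorphic M') :
    ∃ σ, relabel σ M = M' := by
  obtain ⟨σ, hR, hL, hr⟩ := h
  refine ⟨σ, multirootedHypermap_ext ?_ ?_ (funext hr)⟩
  · ext a
    simp [relabel, hR]
  · ext a
    simp [relabel, hL]

/-- The darts on which two relabellings with the same result agree form an invariant set. It
contains a root, so by connectedness it is everything. Thus a rooted map has no nontrivial
automorphism. -/
theorem relabel_injective (M : MultirootedHypermap D ρ) (i : Fin ρ) :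
    Function.Injective fun σ => relabel σ M := by
  intro σ τ h
  have hR : σ.permCongr M.R = τ.permCongr M.R := congrArg MultirootedHypermap.R h
  have hL : σ.permCongr M.L = τ.permCongr M.L := congrArg MultirootedHypermap.L h
  have hr : σ ∘ M.root = τ ∘ M.root := congrArg MultirootedHypermap.root h
  have key : ∀ p : Perm D, σ.permCongr p = τ.permCongr p →
      ∀ x, p x ∈ {x | σ x = τ x} ↔ x ∈ {x | σ x = τ x} := by
    intro p hp x
    have h1 : σ (p x) = τ (p (τ.symm (σ x))) := by
      have := Equiv.congr_fun hp (σ x)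
      simpa using this
    simp only [Set.mem_ofPred_eq, h1, EmbeddingLike.apply_eq_iff_eq, Equiv.symm_apply_eq]
  have hconn := (isPretransitive_iff_conn M.R M.L).1 M.transitive
  have := hconn {x | σ x = τ x} ⟨key _ hR, key _ hL⟩ ⟨M.root i, congrFun hr i⟩
  exact Equiv.ext fun x => Set.eq_univ_iff_forall.1 this x

/-- Fix a representative in every class. Its `t!` relabellings are pairwise different and exhaust
the class. The index `i` guarantees that there is a root at all. -/
theorem card_eq_ncard_mul_factorial {t : ℕ} (i : Fin ρ)
    (S : Set (MultirootedHypermap (Fin t) ρ))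
    (hS : ∀ M M', M.Isomorphic M' → (M ∈ S ↔ M' ∈ S)) :
    Nat.card S =
      Set.ncard (Quotient.mk (MultirootedHypermap.isoSetoid t ρ) '' S) * t.factorial := by
  have hperm : Nat.card (Perm (Fin t)) = t.factorial := by
    rw [Nat.card_perm, Nat.card_fin]
  rw [← Nat.card_coe_set_eq, ← hperm, ← Nat.card_prod]
  have hout : ∀ q : Quotient (MultirootedHypermap.isoSetoid t ρ),
      q ∈ Quotient.mk (MultirootedHypermap.isoSetoid t ρ) '' S → q.out ∈ S := by
    rintro _ ⟨M, hM, rfl⟩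
    have : (MultirootedHypermap.isoSetoid t ρ) (Quotient.out (Quotient.mk _ M)) M :=
      Quotient.mk_out M
    exact (hS _ _ this).2 hM
  symm
  refine Nat.card_eq_of_bijective (fun s : (Quotient.mk (MultirootedHypermap.isoSetoid t ρ) '' S :
      Set _) × Perm (Fin t) =>
    (⟨relabel s.2 s.1.1.out, (hS _ _ (isomorphic_relabel _ _)).1 (hout _ s.1.2)⟩ : S)) ⟨?_, ?_⟩
  · rintro ⟨⟨q, hq⟩, σ⟩ ⟨⟨q', hq'⟩, σ'⟩ h
    have h' : relabel σ q.out = relabel σ' q'.out := congrArg Subtype.val h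
    have hqq : q = q' := by
      rw [← Quotient.out_eq q, ← Quotient.out_eq q']
      refine Quotient.sound ((isomorphic_relabel σ _).trans ?_)
      rw [h']
      exact (isomorphic_relabel σ' _).symm
    subst hqq
    rw [relabel_injective _ i h']
  · rintro ⟨M, hM⟩
    have : (MultirootedHypermap.isoSetoid t ρ) (Quotient.out (Quotient.mk _ M)) M :=
      Quotient.mk_out M
    obtain ⟨σ, hσ⟩ := exists_relabel_eq this
    exact ⟨⟨⟨Quotient.mk _ M, M, hM, rfl⟩, σ⟩, Subtype.ext hσ⟩

theorem hasGenus_iff (M : MultirootedHypermap D ρ) (g : ℕ) :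
    M.HasGenus g ↔ EulerGenus g M.R M.L := by
  rw [MultirootedHypermap.HasGenus, EulerGenus, MultirootedHypermap.numVertices,
    MultirootedHypermap.numHyperedges, MultirootedHypermap.numFaces]
  omega

/-- The labelled rooted hypermaps of genus `g` with `f` faces, `e` hyperedges and roots of
degrees `d`. -/
def IsCounted (g f e : ℕ) (d : Fin ρ → ℕ) (s : Perm D × Perm D × (Fin ρ → D)) : Prop :=
  IsRooted g s.1 s.2.1 s.2.2 ∧ cycleCount (s.1 * s.2.1) = f ∧ cycleCount s.2.1 = e ∧
    ∀ i, cycleDegree s.1 (s.2.2 i) = d i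

theorem numMultirooted_mul_factorial (g f e : ℕ) {t : ℕ} (ht : t ≠ 0) (i : Fin ρ)
    (d : Fin ρ → ℕ) : numMultirooted g t f e d * t.factorial =
      Nat.card {s : Perm (Fin t) × Perm (Fin t) × (Fin ρ → Fin t) // IsCounted g f e d s} := by
  rw [numMultirooted, if_neg ht, ← card_eq_ncard_mul_factorial i]
  · have : NeZero t := ⟨ht⟩
    exact Nat.card_congr
      { toFun := fun M => ⟨(M.1.R, M.1.L, M.1.root),
          ⟨(isPretransitive_iff_conn _ _).1 M.1.transitive, (hasGenus_iff _ _).1 M.2.1,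
            M.1.distinct_vertices⟩, M.2.2⟩
        invFun := fun s => ⟨⟨s.1.1, s.1.2.1, ⟨0⟩, (isPretransitive_iff_conn _ _).2 s.2.1.conn,
          s.1.2.2, s.2.1.roots⟩, (hasGenus_iff _ _).2 s.2.1.genus, s.2.2⟩
        left_inv := fun _ => rfl
        right_inv := fun _ => rfl }
  · intro M M' h
    obtain ⟨σ, rfl⟩ := exists_relabel_eq h
    have hmul : σ.permCongr M.R * σ.permCongr M.L = σ.permCongr (M.R * M.L) :=
      (map_mul σ.permCongrHom M.R M.L).symm
    have h1 : (relabel σ M).numFaces = M.numFaces := by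
      rw [MultirootedHypermap.numFaces, MultirootedHypermap.numFaces, relabel, hmul,
        cycleCount_permCongr]
    have h2 : (relabel σ M).numHyperedges = M.numHyperedges := cycleCount_permCongr σ M.L
    have h3 : ∀ i, (relabel σ M).rootDegree i = M.rootDegree i := fun i =>
      cycleDegree_permCongr σ M.R (M.root i)
    have h4 : (relabel σ M).HasGenus g ↔ M.HasGenus g := by
      rw [hasGenus_iff, hasGenus_iff, relabel, eulerGenus_permCongr]
    simp only [Set.mem_ofPred_eq, h1, h2, h3, h4]

-- After multiplication by `t!` the left side is a sum over labelled maps, each of which is counted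
-- for exactly one triple `(f, e, d)`, namely its own numbers, and these lie in the ranges of
-- summation. The factor `u` restores the vertex that `weight` leaves out.
open scoped Classical in
theorem sum_numMultirooted {K : Type} [CommRing K] [Algebra ℚ K] (g : ℕ) {t : ℕ} (ht : t ≠ 0)
    (i : Fin ρ) (v : Fin ρ → K) (x y u : K) :
    ∑ f ∈ Finset.Icc 1 (t + 1), ∑ e ∈ Finset.range (t + 1), ∑ d : Fin ρ → Fin (t + 1),
      (numMultirooted g t f e (fun i => (d i : ℕ)) : K) *
        ((∏ i, v i ^ (d i : ℕ)) * x ^ f * y ^ e * u ^ (t + 2 - 2 * g - e - f)) =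
      (t.factorial : ℚ)⁻¹ • (u * mapSum g (Fin t) v x y u) := by
  have ht' : (t.factorial : ℚ) ≠ 0 := by exact_mod_cast t.factorial_ne_zero
  rw [eq_inv_smul_iff₀ ht']
  have hN : ∀ f e (d : Fin ρ → Fin (t + 1)) (a : K),
      (t.factorial : ℚ) • ((numMultirooted g t f e (fun i => (d i : ℕ)) : K) * a) =
      ∑ s : Perm (Fin t) × Perm (Fin t) × (Fin ρ → Fin t),
        if IsCounted g f e (fun i => (d i : ℕ)) s then a else 0 := by
    intro f e d a
    rw [← Finset.sum_filter, Finset.sum_const, ← Fintype.card_subtype, ← Nat.card_eq_fintype_card,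
      ← numMultirooted_mul_factorial g f e ht i, Nat.cast_smul_eq_nsmul, nsmul_eq_mul,
      nsmul_eq_mul]
    push_cast
    ring
  simp only [Finset.smul_sum, hN]
  have hs : ∀ s : Perm (Fin t) × Perm (Fin t) × (Fin ρ → Fin t),
      (∑ f ∈ Finset.Icc 1 (t + 1), ∑ e ∈ Finset.range (t + 1), ∑ d : Fin ρ → Fin (t + 1),
        if IsCounted g f e (fun i => (d i : ℕ)) s then
          (∏ i, v i ^ (d i : ℕ)) * x ^ f * y ^ e * u ^ (t + 2 - 2 * g - e - f) else 0) =
      u * mapTerm g s.1 s.2.1 s.2.2 v x y u := by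
    rintro ⟨R, L, r⟩
    by_cases hr : IsRooted g R L r
    swap
    · rw [mapTerm_of_not_isRooted hr, mul_zero]
      exact Finset.sum_eq_zero fun f _ => Finset.sum_eq_zero fun e _ =>
        Finset.sum_eq_zero fun d _ => if_neg fun h => hr h.1
    have : Nonempty (Fin t) := ⟨r i⟩
    have hF := cycleCount_le_card (R * L)
    have hF' := cycleCount_pos (R * L)
    have hE := cycleCount_le_card L
    have hV := cycleCount_pos R
    have hd := fun i => cycleDegree_le_card R (r i)
    have hg := hr.genus
    rw [EulerGenus] at hg
    rw [Nat.card_fin] at hF hE hg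
    simp only [Nat.card_fin] at hd
    rw [Finset.sum_eq_single_of_mem (cycleCount (R * L)) (Finset.mem_Icc.2 (by omega)),
      Finset.sum_eq_single_of_mem (cycleCount L) (Finset.mem_range.2 (by omega)),
      Finset.sum_eq_single_of_mem (fun i => ⟨cycleDegree R (r i), Nat.lt_succ_of_le (hd i)⟩)
        (Finset.mem_univ _), if_pos ⟨hr, rfl, rfl, fun _ => rfl⟩, mapTerm_of_isRooted hr,
      rootWeight, weight]
    -- By the Euler relation the truncated subtractions are exact here and give the number of
    -- vertices, which is positive.
    · have h1 : t + 2 - 2 * g - cycleCount L - cycleCount (R * L) = cycleCount R - 1 + 1 := by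
        omega
      rw [h1]
      ring
    · intro d _ hne
      refine if_neg fun h => hne (funext fun i => Fin.ext ?_)
      exact (h.2.2.2 i).symm
    · intro e _ hne
      exact Finset.sum_eq_zero fun d _ => if_neg fun h => hne h.2.2.1.symm
    · intro f _ hne
      exact Finset.sum_eq_zero fun e _ => Finset.sum_eq_zero fun d _ =>
        if_neg fun h => hne h.2.1.symm
  rw [mapSum, Finset.mul_sum]
  simp only [Finset.mul_sum]
  have hprod : (∑ R : Perm (Fin t), ∑ L : Perm (Fin t), ∑ r : Fin ρ → Fin t,
      u * mapTerm g R L r v x y u) =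
      ∑ s : Perm (Fin t) × Perm (Fin t) × (Fin ρ → Fin t),
        u * mapTerm g s.1 s.2.1 s.2.2 v x y u := by
    rw [Fintype.sum_prod_type]
    exact Finset.sum_congr rfl fun R _ => by rw [Fintype.sum_prod_type]
  rw [hprod, ← Finset.sum_congr rfl fun s _ => hs s]
  conv_rhs => rw [Finset.sum_comm]
  refine Finset.sum_congr rfl fun f _ => ?_
  conv_rhs => rw [Finset.sum_comm]
  refine Finset.sum_congr rfl fun e _ => ?_
  exact Finset.sum_comm

/-! ### Evaluation of the generating series -/

/-- The separate constant is the empty map: it exists only in genus 0 with one root. It is also what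
breaks the symmetry between `p` and `q`. -/
theorem evalAt_hypermapSeries {N n : ℕ} (g : ℕ) (a : Fin (n + 1) → HPoly N) (p q : HPoly N) :
    (hypermapSeries g (n + 1)).evalAt a p q =
      PowerSeries.C uu * mapSeries g a p q uu +
        PowerSeries.C (if g = 0 ∧ n = 0 then p * uu else 0) := by
  ext t : 1
  rw [HSeries.evalAt, PowerSeries.coeff_map, hypermapSeries, PowerSeries.coeff_mk, map_add,
    PowerSeries.coeff_C_mul, mapSeries, PowerSeries.coeff_mk]
  simp only [map_sum, map_mul, map_natCast, map_prod, map_pow, AlgHom.toRingHom_eq_coe,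
    RingHom.coe_coe, vv, xx, yy, uu, MvPolynomial.aeval_X]
  by_cases ht : t = 0
  · subst ht
    -- For `t = 0` the ranges shrink to `f = 1`, `e = 0` and all degrees 0, and the exponent of `u`
    -- is `2 - 1 = 1`. Labelled maps contribute nothing, since no dart is available as a root.
    rw [mapSum_of_isEmpty, smul_zero, mul_zero, zero_add, PowerSeries.coeff_zero_C, zero_add,
      Finset.Icc_self, Finset.sum_singleton, zero_add, Finset.range_one, Finset.sum_singleton,
      Fintype.sum_unique]
    simp only [numMultirooted, Fin.val_eq_zero, if_true, and_true, true_and, implies_true,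
      Nat.add_eq_right]
    by_cases h : g = 0 ∧ n = 0
    · rw [if_pos h, if_pos h]
      simp [h.1]
    · rw [if_neg h, if_neg h]
      simp
  · rw [sum_numMultirooted g ht 0, PowerSeries.coeff_C, if_neg ht, add_zero, mul_smul_comm]

end Classes

/-! ### The terms of the functional equation -/

section Terms

variable {n : ℕ}

theorem evalAt_self (F : HSeries n) : F.evalAt vv xx yy = F := by
  have h : (MvPolynomial.aeval (R := ℚ) (fun s : HVar n =>
      match s with
      | HVar.v i => (vv i : HPoly n)
      | HVar.x => xx
      | HVar.y => yy
      | HVar.u => uu) : HPoly n →ₐ[ℚ] HPoly n) = AlgHom.id ℚ _ := by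
    refine MvPolynomial.algHom_ext fun s => ?_
    cases s <;> simp [vv, xx, yy, uu]
  ext t : 1
  rw [HSeries.evalAt, PowerSeries.coeff_map]
  exact DFunLike.congr_fun h _

theorem mapSeries_cons (g : ℕ) {N : ℕ} (a : HPoly N) (w : Fin n → HPoly N) (x y u : HPoly N) :
    mapSeries g (Fin.cons a w : Fin (n + 1) → HPoly N) x y u = mapSeries g (optCons a w) x y u := by
  refine mapSeries_congr (finSuccEquiv n) g (fun i => ?_) x y u
  cases i using Fin.cases <;> simp

theorem mapSeries_vv (g : ℕ) (x y u : HPoly (n + 1)) :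
    mapSeries g vv x y u = mapSeries g (optCons (vv 0) fun i : Fin n => vv i.succ) x y u := by
  rw [← mapSeries_cons]
  congr
  funext i
  cases i using Fin.cases <;> rfl

theorem mapSeries_headSublist (g : ℕ) (a : HPoly (n + 1)) (X : Finset (Fin n)) {p : Fin n → Prop}
    [Fintype {i // p i}] [DecidableEq {i // p i}] (h : ∀ i, i ∈ X ↔ p i) (x y u : HPoly (n + 1)) :
    mapSeries g (headSublist a X) x y u =
      mapSeries g (optCons a fun i : {i // p i} => vv i.1.succ) x y u := by
  rw [headSublist, mapSeries_cons]
  refine mapSeries_congr (Equiv.optionCongr ((X.orderIsoOfFin rfl).toEquiv.trans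
    (Equiv.subtypeEquivRight h))) g (fun i => ?_) x y u
  cases i <;> rfl

theorem hypermapSeries_succ (g n : ℕ) : hypermapSeries g (n + 1) =
    PowerSeries.C uu * mapSeries g (optCons (vv 0) fun i : Fin n => vv i.succ) xx yy uu +
      PowerSeries.C (if g = 0 ∧ n = 0 then xx * uu else 0) := by
  rw [← evalAt_self (hypermapSeries g (n + 1)), evalAt_hypermapSeries, mapSeries_vv]

theorem exactQuot_mul_left {S : Type} [CommRing S] [IsDomain S] {b : S} (hb : b ≠ 0) (q : S) :
    exactQuot (b * q) b = q := by
  rw [exactQuot, dif_pos (Dvd.intro q rfl)]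
  exact mul_left_cancel₀ hb (Exists.choose_spec (Dvd.intro q rfl : b ∣ b * q)).symm

theorem C_ne_zero {a : HPoly n} (ha : a ≠ 0) : (PowerSeries.C a : HSeries n) ≠ 0 := fun h =>
  ha (PowerSeries.C_injective (h.trans (map_zero _).symm))

theorem uu_ne_zero : (uu : HPoly n) ≠ 0 := MvPolynomial.X_ne_zero _

theorem vv_sub_one_ne_zero (i : Fin n) : (vv i - 1 : HPoly n) ≠ 0 := by
  intro h
  have := congrArg (MvPolynomial.eval fun _ => (0 : ℚ)) h
  simp [vv] at this

theorem vv_sub_vv_ne_zero {i j : Fin n} (h : i ≠ j) : (vv i - vv j : HPoly n) ≠ 0 := by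
  rw [sub_ne_zero]
  intro h'
  have := MvPolynomial.X_injective h'
  simp [h] at this

-- In the product of `u * M_j` plus a possible `y * u` with `u * M_{g-j}` plus a possible `x * u`,
-- the empty map occurs on the left only for `j = 0`, `X = ∅` and on the right only for `j = g`, `X`
-- everything. The mixed terms give `x + y` times `M`, and the product of two empty maps gives the
-- one-dart map.
open PowerSeries in
theorem convolutionTerm_hypermapSeries (g n : ℕ) : convolutionTerm hypermapSeries g n =
    C uu * (C uu * productSeries g (vv 0) (fun i : Fin n => vv i.succ) xx yy uu +
      C (uu * (xx + yy)) * mapSeries g (optCons (vv 0) fun i : Fin n => vv i.succ) xx yy uu +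
      C (if g = 0 ∧ n = 0 then uu * (xx * yy) else 0)) := by
  set M : HSeries (n + 1) := mapSeries g (optCons (vv 0) fun i : Fin n => vv i.succ) xx yy uu
  set A : ℕ → Finset (Fin n) → HSeries (n + 1) := fun j X =>
    mapSeries j (optCons (vv 0) fun i : {i // i ∈ X} => vv i.1.succ) xx yy uu with hA
  set B : ℕ → Finset (Fin n) → HSeries (n + 1) := fun j X =>
    mapSeries j (optCons (vv 0) fun i : {i // i ∉ X} => vv i.1.succ) xx yy uu with hB
  have hM₁ : A g Finset.univ = M :=
    mapSeries_congr (Equiv.optionCongr (Equiv.subtypeUnivEquiv fun i => Finset.mem_univ i)) g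
      (fun i => by cases i <;> rfl) _ _ _
  have hM₂ : B g ∅ = M :=
    mapSeries_congr (Equiv.optionCongr (Equiv.subtypeUnivEquiv fun i => Finset.notMem_empty i)) g
      (fun i => by cases i <;> rfl) _ _ _
  have hterm : ∀ j ∈ Finset.range (g + 1), ∀ X : Finset (Fin n),
      (hypermapSeries j (X.card + 1)).evalAt (headSublist (vv 0) X) yy xx *
        (hypermapSeries (g - j) (Xᶜ.card + 1)).evalAt (headSublist (vv 0) Xᶜ) xx yy =
      C uu * (C uu * (A j X * B (g - j) X)) +
        (if j = 0 ∧ X = ∅ then C uu * (C (uu * yy) * B g X) else 0) +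
        (if j = g ∧ X = Finset.univ then C uu * (C (uu * xx) * A g X) else 0) +
        (if j = 0 ∧ X = ∅ then C uu * C (if g = 0 ∧ n = 0 then uu * (xx * yy) else 0) else 0) := by
    intro j hj X
    have hj' : j ≤ g := Nat.lt_succ_iff.1 (Finset.mem_range.1 hj)
    rw [evalAt_hypermapSeries, evalAt_hypermapSeries, mapSeries_headSublist j _ X fun _ => Iff.rfl,
      mapSeries_headSublist (g - j) _ Xᶜ fun _ => Finset.mem_compl, mapSeries_dual _ _ yy]
    change (C uu * A j X + _) * (C uu * B (g - j) X + _) = _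
    have h1 : g - j = 0 ∧ Xᶜ.card = 0 ↔ j = g ∧ X = Finset.univ := by
      rw [Finset.card_eq_zero, Finset.compl_eq_empty_iff]
      exact and_congr_left' (by omega)
    have h0 : j = 0 ∧ X.card = 0 ↔ j = 0 ∧ X = ∅ := by
      rw [Finset.card_eq_zero]
    rw [if_congr h0 rfl rfl, if_congr h1 rfl rfl]
    -- Both factors can be empty at once only in genus 0 and without further roots.
    have h2 : j = 0 ∧ X = ∅ → (j = g ∧ X = Finset.univ ↔ g = 0 ∧ n = 0) := by
      rintro ⟨rfl, rfl⟩
      rw [eq_comm (a := (∅ : Finset (Fin n))), Finset.univ_eq_empty_iff,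
        ← Fintype.card_eq_zero_iff, Fintype.card_fin,
        eq_comm (a := 0)]
    by_cases hP : j = 0 ∧ X = ∅ <;> by_cases hQ : j = g ∧ X = Finset.univ
    · rw [if_pos hP, if_pos hQ, if_pos hP, if_pos hQ, if_pos hP, if_pos ((h2 hP).1 hQ), hP.1,
        ← hP.1.symm.trans hQ.1]
      simp only [map_mul]
      ring
    · rw [if_pos hP, if_neg hQ, if_pos hP, if_neg hQ, if_pos hP, if_neg (mt (h2 hP).2 hQ), hP.1]
      simp only [map_mul, map_zero, tsub_zero]
      ring
    · rw [if_neg hP, if_pos hQ, if_neg hP, if_pos hQ, if_neg hP, hQ.1]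
      simp only [map_mul, map_zero]
      ring
    · rw [if_neg hP, if_neg hQ, if_neg hP, if_neg hQ, if_neg hP]
      simp only [map_zero]
      ring
  rw [convolutionTerm, Finset.sum_congr rfl fun j hj => Finset.sum_congr rfl fun X _ =>
    hterm j hj X]
  simp only [Finset.sum_add_distrib, ← Finset.mul_sum, ite_and]
  have hp : ∑ j ∈ Finset.range (g + 1), ∑ X, A j X * B (g - j) X =
    productSeries g (vv 0) (fun i : Fin n => vv i.succ) xx yy uu := rfl
  have hs : ∀ (k : ℕ) (Y : Finset (Fin n)) (f : Finset (Fin n) → HSeries (n + 1)), k ≤ g →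
      ∑ j ∈ Finset.range (g + 1), ∑ X, (if j = k then if X = Y then f X else 0 else 0) = f Y := by
    intro k Y f hk
    rw [Finset.sum_eq_single_of_mem k (Finset.mem_range.2 (Nat.lt_succ_of_le hk))
      fun j _ hj => by simp [hj]]
    simp
  rw [hs 0 ∅ (fun X => C uu * (C (uu * yy) * B g X)) g.zero_le,
    hs g Finset.univ (fun X => C uu * (C (uu * xx) * A g X)) le_rfl, hs 0 ∅ _ g.zero_le, hp, hM₁,
    hM₂]
  simp only [map_mul, map_add]
  ring

open PowerSeries in
theorem handleTerm_hypermapSeries (g n : ℕ) : handleTerm hypermapSeries g n =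
    C uu * (if g = 0 then 0 else mapSeries (g - 1)
      (optCons (vv 0) (optCons (vv 0) fun i : Fin n => vv i.succ)) xx yy uu) := by
  rw [handleTerm]
  split_ifs with hg
  · rw [mul_zero]
  · rw [evalAt_hypermapSeries, if_neg (by omega), map_zero, add_zero, mapSeries_dual]
    congr 1
    refine mapSeries_congr ((finSuccEquiv (n + 1)).trans (Equiv.optionCongr (finSuccEquiv n))) _
      (fun i => ?_) _ _ _
    cases i using Fin.cases with
    | zero => simp
    | succ i =>
      rw [Equiv.trans_apply, finSuccEquiv_succ]
      cases i using Fin.cases <;> rfl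

-- The empty map does not depend on the `v` variables and cancels in the difference; the rest is `v
-- ^ d - 1 = (v - 1) * ∑ v ^ k` for the degree `d` of the first root.
open PowerSeries in
theorem differenceAtOne_hypermapSeries (g n : ℕ) : differenceAtOne hypermapSeries g n =
    C (vv 0 - 1) * (C uu * rootedSeries g (fun d => ∑ k ∈ Finset.range d, vv 0 ^ k)
      (fun i : Fin n => vv i.succ) xx yy uu) := by
  rw [differenceAtOne, evalAt_hypermapSeries, evalAt_hypermapSeries, add_sub_add_right_eq_sub,
    mapSeries_vv, mapSeries_cons, mapSeries_dual, mapSeries_dual _ _ yy, mapSeries_optCons,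
    mapSeries_optCons, ← mul_sub, rootedSeries_sub, mul_left_comm (C (vv 0 - 1)), C_mul_rootedSeries _ (vv 0 - 1)]
  simp only [one_pow, mul_geom_sum]

-- Again the empty map cancels, and the factorisation of a difference of `d`-th powers is applied to
-- the degree `d` of the first root.
open PowerSeries in
theorem differenceAt_hypermapSeries (g n : ℕ) (i : Fin n) : differenceAt hypermapSeries g n i =
    C (vv i.succ - vv 0) * (C uu * rootedSeries g
      (fun d => ∑ k ∈ Finset.range d, vv 0 ^ k * vv i.succ ^ (d - 1 - k))
      (fun k : {k : Fin n // k ≠ i} => vv k.1.succ) xx yy uu) := by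
  have hX : ∀ k : Fin n, k ∈ ({i}ᶜ : Finset (Fin n)) ↔ k ≠ i := by simp
  rw [differenceAt, evalAt_hypermapSeries, evalAt_hypermapSeries, add_sub_add_right_eq_sub,
    mapSeries_headSublist g _ _ hX, mapSeries_headSublist g _ _ hX, mapSeries_dual,
    mapSeries_dual _ _ yy, mapSeries_optCons,
    mapSeries_optCons, ← mul_sub, rootedSeries_sub, mul_left_comm (C (vv i.succ - vv 0)),
    C_mul_rootedSeries _ (vv i.succ - vv 0)]
  congr 2
  funext d
  rw [← neg_sub (vv 0 : HPoly (n + 1)), ← neg_sub (vv 0 ^ d), neg_mul, mul_comm,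
    (Commute.all _ _).geom_sum₂_mul]

/-! ### The derivative with respect to one root variable -/

theorem pderiv_pow_eq_zero {s : HVar n} {a : HPoly n} (h : MvPolynomial.pderiv s a = 0) (k : ℕ) :
    MvPolynomial.pderiv s (a ^ k) = 0 := by
  rw [Derivation.leibniz_pow, h, smul_zero, smul_zero]

theorem pderiv_mul_eq_zero {s : HVar n} {a b : HPoly n} (ha : MvPolynomial.pderiv s a = 0)
    (hb : MvPolynomial.pderiv s b = 0) : MvPolynomial.pderiv s (a * b) = 0 := by
  rw [Derivation.leibniz, ha, hb, smul_zero, smul_zero, add_zero]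

theorem deriv_rootedSeries {κ : Type} [Fintype κ] [DecidableEq κ] (g : ℕ) (j : Fin n)
    (φ : ℕ → HPoly n) {w : κ → HPoly n} {x y u : HPoly n}
    (hw : ∀ i, MvPolynomial.pderiv (HVar.v j) (w i) = 0)
    (hx : MvPolynomial.pderiv (HVar.v j) x = 0) (hy : MvPolynomial.pderiv (HVar.v j) y = 0)
    (hu : MvPolynomial.pderiv (HVar.v j) u = 0) :
    HSeries.deriv j (rootedSeries g φ w x y u) =
      rootedSeries g (fun d => MvPolynomial.pderiv (HVar.v j) (φ d)) w x y u := by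
  ext t : 1
  rw [HSeries.deriv, PowerSeries.coeff_mk, rootedSeries, rootedSeries, PowerSeries.coeff_mk,
    PowerSeries.coeff_mk, Derivation.map_smul, rootedSum, rootedSum]
  refine congrArg _ ?_
  rw [map_sum]
  refine Finset.sum_congr rfl fun R _ => ?_
  rw [map_sum]
  refine Finset.sum_congr rfl fun L _ => ?_
  rw [map_sum]
  refine Finset.sum_congr rfl fun c _ => ?_
  rw [map_sum]
  refine Finset.sum_congr rfl fun r _ => ?_
  split_ifs
  · have hz : MvPolynomial.pderiv (HVar.v j) (rootWeight R r w * weight R L x y u) = 0 := by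
      refine pderiv_mul_eq_zero ?_ (pderiv_mul_eq_zero (pderiv_mul_eq_zero
        (pderiv_pow_eq_zero hx _) (pderiv_pow_eq_zero hy _)) (pderiv_pow_eq_zero hu _))
      exact Finset.prod_induction _ (fun a => MvPolynomial.pderiv (HVar.v j) a = 0)
        (fun _ _ => pderiv_mul_eq_zero) (Derivation.map_one_eq_zero _)
        fun i _ => pderiv_pow_eq_zero (hw i) _
    rw [Derivation.leibniz, hz, smul_zero, zero_add, smul_eq_mul, mul_comm]
  · exact map_zero _

theorem pderiv_vv_of_ne {i j : Fin n} (h : i ≠ j) : MvPolynomial.pderiv (HVar.v j) (vv i) = 0 :=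
  MvPolynomial.pderiv_X_of_ne (by simpa using h)

-- The variable `v_j` marks only the first root here, so the operator acts on its weight alone.
-- Multiplying by `v_j`, differentiating and multiplying again turns `v_j ^ (d - 1 - k)` into `(d -
-- k) * v_j ^ (d - k)`: it chooses a dart in the vertex that is split off.
open PowerSeries in
theorem C_mul_deriv_rootedSeries (g : ℕ) (i : Fin n) : C (vv i.succ) * HSeries.deriv i.succ
      (C (vv i.succ) * (C uu * rootedSeries g
        (fun d => ∑ k ∈ Finset.range d, vv 0 ^ k * vv i.succ ^ (d - 1 - k))
        (fun k : {k : Fin n // k ≠ i} => vv k.1.succ) xx yy uu)) =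
    C uu * rootedSeries g
      (fun d => ∑ k ∈ Finset.range d, ((d - k : ℕ) : HPoly (n + 1)) * vv 0 ^ k *
        vv i.succ ^ (d - k))
      (fun k : {k : Fin n // k ≠ i} => vv k.1.succ) xx yy uu := by
  rw [C_mul_rootedSeries, C_mul_rootedSeries, deriv_rootedSeries, C_mul_rootedSeries,
    C_mul_rootedSeries]
  · congr 1
    funext d
    simp only [Finset.mul_sum, map_sum]
    refine Finset.sum_congr rfl fun k hk => ?_
    -- Writing `d = k + m + 1` removes the truncated subtractions from the exponents.
    obtain ⟨m, rfl⟩ := Nat.exists_eq_add_of_lt (Finset.mem_range.1 hk)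
    have h1 : k + m + 1 - 1 - k = m := by omega
    have h2 : k + m + 1 - k = m + 1 := by omega
    have h3 : MvPolynomial.pderiv (HVar.v i.succ) (uu * vv 0 ^ k : HPoly (n + 1)) = 0 :=
      pderiv_mul_eq_zero (MvPolynomial.pderiv_X_of_ne (by simp))
        (pderiv_pow_eq_zero (pderiv_vv_of_ne (Fin.succ_ne_zero i).symm) _)
    have h4 : vv i.succ * (uu * (vv 0 ^ k * vv i.succ ^ m)) =
        (uu * vv 0 ^ k) * vv i.succ ^ (m + 1) := by
      ring
    rw [h1, h2, h4, Derivation.leibniz, h3, smul_zero, add_zero, Derivation.leibniz_pow, vv,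
      MvPolynomial.pderiv_X_self, Nat.add_sub_cancel]
    simp only [smul_eq_mul, nsmul_eq_mul]
    ring
  · exact fun k => pderiv_vv_of_ne fun h => k.2 (Fin.succ_injective _ h)
  · exact MvPolynomial.pderiv_X_of_ne (by simp)
  · exact MvPolynomial.pderiv_X_of_ne (by simp)
  · exact MvPolynomial.pderiv_X_of_ne (by simp)

end Terms

/-! ### The functional equation -/

-- Each term has been written as its divisor times an explicit quotient, so divisibility is
-- immediate, and the sum of the quotients is the right side of `C_mul_mapSeries`.
open PowerSeries in
theorem functionalEquation_hypermapSeries (g n : ℕ) : FunctionalEquation hypermapSeries g n := by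
  have hv : ∀ i : Fin n, (vv i.succ - vv 0 : HPoly (n + 1)) ≠ 0 := fun i =>
    vv_sub_vv_ne_zero (Fin.succ_ne_zero i)
  refine ⟨?_, ?_, ?_, fun i => ?_, ?_⟩
  · exact convolutionTerm_hypermapSeries g n ▸ dvd_mul_right _ _
  · exact handleTerm_hypermapSeries g n ▸ dvd_mul_right _ _
  · exact differenceAtOne_hypermapSeries g n ▸ dvd_mul_right _ _
  · exact differenceAt_hypermapSeries g n i ▸ dvd_mul_right _ _
  · have hi : ∀ i : Fin n, C (vv i.succ) * HSeries.deriv i.succ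
        (C (vv i.succ) *
          exactQuot (differenceAt hypermapSeries g n i) (C (vv i.succ - vv 0))) =
      C uu * rootedSeries g (fun d => ∑ k ∈ Finset.range d,
          ((d - k : ℕ) : HPoly (n + 1)) * vv 0 ^ k * vv i.succ ^ (d - k))
        (fun k : {k : Fin n // k ≠ i} => vv k.1.succ) xx yy uu := fun i => by
      rw [differenceAt_hypermapSeries, exactQuot_mul_left (C_ne_zero (hv i)),
        C_mul_deriv_rootedSeries]
    rw [Finset.sum_congr rfl fun i _ => hi i, convolutionTerm_hypermapSeries,
      handleTerm_hypermapSeries, differenceAtOne_hypermapSeries,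
      exactQuot_mul_left (C_ne_zero uu_ne_zero), exactQuot_mul_left (C_ne_zero uu_ne_zero),
      exactQuot_mul_left (C_ne_zero (vv_sub_one_ne_zero 0)), hypermapSeries_succ, C_mul_mapSeries,
      Fintype.card_fin, ← Finset.mul_sum, apply_ite C (g = 0 ∧ n = 0) (xx * uu) 0, map_zero]
    simp only [map_mul]
    ring

/-! ### Uniqueness of the solution -/

section Uniqueness

variable {n m : ℕ} {t : ℕ} {A B A' B' : HSeries n}

/-- The coefficients of degree less than `t` are the same. -/
def AgreeBelow (t : ℕ) (A B : HSeries n) : Prop :=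
  ∀ k < t, PowerSeries.coeff k A = PowerSeries.coeff k B

theorem AgreeBelow.refl (t : ℕ) (A : HSeries n) : AgreeBelow t A A := fun _ _ => rfl

theorem AgreeBelow.add (h : AgreeBelow t A B) (h' : AgreeBelow t A' B') :
    AgreeBelow t (A + A') (B + B') := fun k hk => by
  rw [map_add, map_add, h k hk, h' k hk]

theorem AgreeBelow.sub (h : AgreeBelow t A B) (h' : AgreeBelow t A' B') :
    AgreeBelow t (A - A') (B - B') := fun k hk => by
  rw [map_sub, map_sub, h k hk, h' k hk]

theorem AgreeBelow.mul (h : AgreeBelow t A B) (h' : AgreeBelow t A' B') :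
    AgreeBelow t (A * A') (B * B') := fun k hk => by
  rw [PowerSeries.coeff_mul, PowerSeries.coeff_mul]
  refine Finset.sum_congr rfl fun p hp => ?_
  rw [Finset.HasAntidiagonal.mem_antidiagonal] at hp
  rw [h _ (by omega), h' _ (by omega)]

theorem AgreeBelow.sum {ι : Type} (s : Finset ι) {f f' : ι → HSeries n}
    (h : ∀ i ∈ s, AgreeBelow t (f i) (f' i)) : AgreeBelow t (∑ i ∈ s, f i) (∑ i ∈ s, f' i) :=
  fun k hk => by
    rw [map_sum, map_sum]
    exact Finset.sum_congr rfl fun i hi => h i hi k hk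

theorem AgreeBelow.evalAt (h : AgreeBelow t A B) (a : Fin n → HPoly m) (p q : HPoly m) :
    AgreeBelow t (A.evalAt a p q) (B.evalAt a p q) := fun k hk => by
  rw [HSeries.evalAt, HSeries.evalAt, PowerSeries.coeff_map, PowerSeries.coeff_map, h k hk]

theorem AgreeBelow.deriv (h : AgreeBelow t A B) (j : Fin n) :
    AgreeBelow t (HSeries.deriv j A) (HSeries.deriv j B) := fun k hk => by
  rw [HSeries.deriv, HSeries.deriv, PowerSeries.coeff_mk, PowerSeries.coeff_mk, h k hk]

theorem AgreeBelow.C_mul_X_mul (h : AgreeBelow t A B) (a : HPoly n) :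
    AgreeBelow (t + 1) (PowerSeries.C a * PowerSeries.X * A)
      (PowerSeries.C a * PowerSeries.X * B) := fun k hk => by
  rw [mul_assoc, mul_assoc, PowerSeries.coeff_C_mul, PowerSeries.coeff_C_mul]
  cases k with
  | zero => rw [PowerSeries.coeff_zero_X_mul, PowerSeries.coeff_zero_X_mul]
  | succ k => rw [PowerSeries.coeff_succ_X_mul, PowerSeries.coeff_succ_X_mul, h k (by omega)]

/-- Division by a polynomial free of `z` acts on each coefficient separately, and polynomials over
`ℚ` form a domain. -/
theorem AgreeBelow.exactQuot (h : AgreeBelow t A B) {b : HPoly n} (hb : b ≠ 0)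
    (hA : PowerSeries.C b ∣ A) (hB : PowerSeries.C b ∣ B) :
    AgreeBelow t (exactQuot A (PowerSeries.C b)) (exactQuot B (PowerSeries.C b)) := by
  obtain ⟨A, rfl⟩ := hA
  obtain ⟨B, rfl⟩ := hB
  rw [exactQuot_mul_left (C_ne_zero hb), exactQuot_mul_left (C_ne_zero hb)]
  intro k hk
  have := h k hk
  rw [PowerSeries.coeff_C_mul, PowerSeries.coeff_C_mul] at this
  exact mul_left_cancel₀ hb this

/-- All terms on the right that contain the unknown series carry a factor `z`, so agreement below
degree `t` improves to agreement below `t + 1`. The induction treats all genera and numbers of roots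
at once, because the equation for `g` and `ρ` also involves lower genera with one root more. -/
theorem agreeBelow_of_functionalEquation {F G : (g ρ : ℕ) → HSeries ρ}
    (hF : ∀ g n : ℕ, FunctionalEquation F g n) (hG : ∀ g n : ℕ, FunctionalEquation G g n) (t : ℕ) :
    ∀ g n : ℕ, AgreeBelow t (F g (n + 1)) (G g (n + 1)) := by
  induction t with
  | zero => exact fun g n k hk => absurd hk k.not_lt_zero
  | succ t ih =>
    intro g n
    obtain ⟨hF1, hF2, hF3, hF4, hF5⟩ := hF g n
    obtain ⟨hG1, hG2, hG3, hG4, hG5⟩ := hG g n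
    have h1 : AgreeBelow t (convolutionTerm F g n) (convolutionTerm G g n) :=
      AgreeBelow.sum _ fun j _ => AgreeBelow.sum _ fun X _ =>
        ((ih _ _).evalAt _ _ _).mul ((ih _ _).evalAt _ _ _)
    have h2 : AgreeBelow t (handleTerm F g n) (handleTerm G g n) := by
      rw [handleTerm, handleTerm]
      split_ifs
      · exact AgreeBelow.refl _ _
      · exact (ih _ _).evalAt _ _ _
    have h3 : AgreeBelow t (differenceAtOne F g n) (differenceAtOne G g n) :=
      ((ih _ _).evalAt _ _ _).sub ((ih _ _).evalAt _ _ _)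
    have h4 : ∀ i, AgreeBelow t (differenceAt F g n i) (differenceAt G g n i) := fun i =>
      ((ih _ _).evalAt _ _ _).sub ((ih _ _).evalAt _ _ _)
    rw [hF5, hG5]
    refine AgreeBelow.add (AgreeBelow.add (AgreeBelow.add (AgreeBelow.add ?_ ?_) ?_) ?_)
      (AgreeBelow.refl _ _)
    · exact (h1.exactQuot uu_ne_zero hF1 hG1).C_mul_X_mul _
    · exact (h2.exactQuot uu_ne_zero hF2 hG2).C_mul_X_mul _
    · exact (h3.exactQuot (vv_sub_one_ne_zero 0) hF3 hG3).C_mul_X_mul _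
    · refine AgreeBelow.C_mul_X_mul (AgreeBelow.sum _ fun i _ => ?_) _
      exact (AgreeBelow.refl _ _).mul (((AgreeBelow.refl _ _).mul ((h4 i).exactQuot
        (vv_sub_vv_ne_zero (Fin.succ_ne_zero i)) (hF4 i) (hG4 i))).deriv _)

end Uniqueness

end Hypermap

theorem mainTheorem6 :
    (∀ g n : ℕ, FunctionalEquation hypermapSeries g n) ∧
    (∀ F : (g ρ : ℕ) → HSeries ρ, (∀ g n : ℕ, FunctionalEquation F g n) →
      ∀ g n : ℕ, F g (n + 1) = hypermapSeries g (n + 1)) := by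
  refine ⟨Hypermap.functionalEquation_hypermapSeries, fun F hF g n => ?_⟩
  ext t : 1
  exact Hypermap.agreeBelow_of_functionalEquation hF Hypermap.functionalEquation_hypermapSeries
    (t + 1) g n t t.lt_succ_self
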